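/- **Setting.** Let $G(\lambda)\in\mathbb C(\lambda)^{n\times n}$ be $T$-even, i.e. $G(-\lambda)^T=G(\lambda)$, and let $G(\lambda)=P(\lambda)+B^T(\lambda E-A)^{-1}B$ be a minimal $T$-even realization: $P(\lambda)=\sum_{j=0}^m\lambda^jA_j$ with $A_m\ne0$; $A,E\in\mathbb C^{r\times r}$ with $E$ nonsingular; $B\in\mathbb C^{r\times n}$; $P(\lambda)$ and $\lambda E-A$ are $T$-even; and $r$ is the smallest size among all realizations $P'+C'(\lambda E'-A')^{-1}B'$ ($P'$ a matrix polynomial, $E'$ nonsingular) of $G$. Let $$\mathcal S(\lambda)=\begin{bmatrix}P(\lambda)&B^T\\ B&A-\lambda E\end{bmatrix}.$$ **Fiedler matrices.** Matrices of size $mn$ are viewed as $m\times m$ block matrices with $n\times n$ blocks. For $X\in\mathbb C^{n\times n}$ put $M_0(X)=\mathrm{diag}(I_{(m-1)n},X)$ and $M_{-m}(X)=\mathrm{diag}(X,I_{(m-1)n})$, and for $1\le i\le m-1$ $$M_i(X)=\mathrm{diag}\left(I_{(m-i-1)n},\begin{bmatrix}X&I_n\\I_n&0\end{bmatrix},I_{(i-1)n}\right),\qquad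 M_{-i}(X)=\mathrm{diag}\left(I_{(m-i-1)n},\begin{bmatrix}0&I_n\\I_n&X\end{bmatrix},I_{(i-1)n}\right).$$ For $-m\le i\le m-1$ let $M^P_i=M_i(-A_i)$ if $i\ge0$ and $M^P_i=M_i(A_{-i})$ if $i<0$, and let $\mathbb M^P_i=\mathrm{diag}(M^P_i,I_r)$. Let $\mathbb M^{\mathcal S}_i=\mathbb M^P_i$ for $i\ne0,-m$, let $\mathbb M^{\mathcal S}_{-m}=\mathrm{diag}(M^P_{-m},-E)$, and $$\mathbb M^{\mathcal S}_0=\begin{bmatrix}M_0^P&-e_m\otimes B^T\\-e_m^T\otimes B&-A\end{bmatrix},$$ where $e_1,\dots,e_m$ are the columns of $I_m$. For an index tuple $\mathbf t=(t_1,\dots,t_k)$ put $M^P_{\mathbf t}=M^P_{t_1}\cdots M^P_{t_k}$, and similarly $\mathbb M^P_{\mathbf t}$ and $\mathbb M^{\mathcal S}_{\mathbf t}$. **Index tuples.** For $a\le b$, $(a:b)$ denotes the tuple $(a,a+1,\dots,b)$. For $0\le p\le h$ with $h-p$ even, the admissible tuple of $\{0,\dots,h\}$ of index $p$ is $(h-1:h,\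 h-3:h-2,\dots,p+1:p+2,\ 0:p)$; its symmetric complement is $(h-1,h-3,\dots,p+1,\ 0:p-1,\ 0:p-2,\dots,0:1,\ 0)$, where the strings $0:p-1,\dots,0$ are absent if $p=0$. An admissible tuple is simple if its index is $0$ or $1$. For a tuple $\mathbf w$ containing $0$, $i_0(\mathbf w)$ is the largest $s$ such that $(s,s-1,\dots,1,0)$ is a subtuple (subsequence) of $\mathbf w$. Let $0\le h\le m-1$ be even, let $\mathbf w$ be the simple admissible tuple of $\{0,\dots,h\}$ and $\mathbf c_w$ its symmetric complement. Let $\mathbf z$ be such that $\mathbf z+m$ (entrywise shift) is an admissible tuple of $\{0,\dots,m-h-1\}$, denote its index by $\mathrm{Ind}(\mathbf z+m)$, and let $\mathbf c_z+m$ be the symmetric complement of $\mathbf z+m$. Put $$L(\lambda)=(\lambda M^P_{\mathbf z}-M^P_{\mathbf w})M^P_{\mathbf c_w}M^P_{\mathbf c_z},\qquad \mathbb L(\lambda)=(\lambda\mathbb M^{\mathcal S}_{\mathbf z}-\mathbb M^{\mathcal S}_{\mathbf w})\,\mathbb M^P_{\mathbf c_w}\,\mathbb M^P_{\mathbf c_z}.$$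 A quasi-identity matrix is $Q=\epsilon_1I_n\oplus\cdots\oplus\epsilon_mI_n$ with parameters $\epsilon_i\in\{1,-1\}$. **Rosenbrock strong linearization.** A pencil $$\mathbb T(\lambda)=\begin{bmatrix}\mathcal X-\lambda\mathcal Y&\mathcal C\\ \mathcal B&H-\lambda K\end{bmatrix}$$ with constant blocks, where $\mathcal X,\mathcal Y\in\mathbb C^{mn\times mn}$ and $H,K\in\mathbb C^{r\times r}$ with $K$ nonsingular, is a Rosenbrock strong linearization of $G$ if the realization $\mathbb G_{\mathbb T}(\lambda)=\mathcal X-\lambda\mathcal Y+\mathcal C(\lambda K-H)^{-1}\mathcal B$ is minimal and * there are unimodular matrix polynomials $U,V$ and nonsingular $U_0,V_0\in\mathbb C^{r\times r}$ with $\mathrm{diag}(U,U_0)\,\mathbb T\,\mathrm{diag}(V,V_0)=\mathrm{diag}(I_{(m-1)n},\mathcal S)$; * there are biproper rational matrices $\mathcal O_\ell,\mathcal O_r$ (that is, having a nonsingular limit as $\lambda\to\infty$) with $\mathcal O_\ell\,\lambda^{-1}\mathbb G_{\mathbb T}\,\mathcal O_r=\mathrm{diag}(I_{(m-1)n},\lambda^{-m}G)$.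 **Theorem.** Let $\alpha=i_0(\mathbf w)$; then $1\le m-\alpha\le m$. 1. There is a quasi-identity matrix $Q$, unique up to multiplication by $-1$, such that $QL(\lambda)$ is $T$-even. Let $\mathbf s$ be the $(m-\alpha)$-th parameter of $Q$ and $\mathbb Q=\mathrm{diag}(\mathbf sQ,I_r)$. Then $$\mathbb Q\mathbb L(\lambda)=\begin{bmatrix}\mathbf sQL(\lambda)&e_{m-\alpha}\otimes B^T\\ e_{m-\alpha}^T\otimes B&A-\lambda E\end{bmatrix},$$ and $\mathbb Q\mathbb L(\lambda)$ is $T$-even. Moreover, $\mathbb Q$ is the only matrix of the form $\mathrm{diag}(\mathbf s'Q',I_r)$, with $Q'$ a quasi-identity matrix and $\mathbf s'$ its $(m-\alpha)$-th parameter, whose product with $\mathbb L(\lambda)$ is $T$-even. If $r>0$, it is even the only matrix of the form $\mathrm{diag}(Q',I_r)$, with $Q'$ a quasi-identity matrix, with this property. 2. If $A_m$ is nonsingular or $\mathrm{Ind}(\mathbf z+m)=0$, then $\mathbb Q\mathbb L(\lambda)$ is a Rosenbrock strong linearization of $G(\lambda)$. 3. The transfer function $\mathbf sQL(\lambda)+(e_{m-\alpha}\otimes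 B^T)(\lambda E-A)^{-1}(e_{m-\alpha}^T\otimes B)$ of $\mathbb Q\mathbb L(\lambda)$ is $T$-even. -/

import Mathlib

open Matrix
open scoped Polynomial

noncomputable section

/- ## Rational matrices, polynomial matrices, T-evenness -/

/-- A polynomial matrix `M(x)` is T-even: `M(-x)ᵀ = M(x)`. -/
def IsTEven {ι : Type*} (M : Matrix ι ι ℂ[X]) : Prop :=
  (M.map fun f => f.comp (-Polynomial.X))ᵀ = M

/-- A rational matrix `G(x)` is T-even (Hamiltonian): `G(-x)ᵀ = G(x)`.
The substitution `x ↦ -x` is evaluation of a rational function at the element `-x` of `ℂ(x)`. -/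
def IsTEvenRat {ι : Type*} (G : Matrix ι ι (RatFunc ℂ)) : Prop :=
  (G.map fun f => f.eval RatFunc.C (-RatFunc.X))ᵀ = G

/-- `F(x) → D` as `x → ∞` for some nonsingular constant matrix `D`. -/
def IsBiproper {ι : Type*} [Fintype ι] [DecidableEq ι] (F : Matrix ι ι (RatFunc ℂ)) : Prop :=
  ∃ D : Matrix ι ι ℂ, IsUnit D.det ∧
    ∀ i j, Filter.Tendsto (fun z : ℂ => (F i j).eval (RingHom.id ℂ) z)
      (Bornology.cobounded ℂ) (nhds (D i j))

/-- A polynomial matrix whose determinant is a nonzero constant. -/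
def IsUnimodular {ι : Type*} [Fintype ι] [DecidableEq ι] (U : Matrix ι ι ℂ[X]) : Prop :=
  ∃ c : ℂ, c ≠ 0 ∧ U.det = Polynomial.C c

/-- The pencil `x E - A`. -/
def pencil {ι κ : Type*} (E A : Matrix ι κ ℂ) : Matrix ι κ ℂ[X] :=
  (Polynomial.X : ℂ[X]) • E.map Polynomial.C - A.map Polynomial.C

/-- The coefficient of `x ^ j` in a polynomial matrix. -/
def coeffMat {ι : Type*} (P : Matrix ι ι ℂ[X]) (j : ℕ) : Matrix ι ι ℂ :=
  P.map fun f => f.coeff j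

/-- `P(x) = A₀ + A₁ x + ⋯ + A_m x ^ m` with `A_m ≠ 0`. -/
def HasDegree {ι : Type*} (P : Matrix ι ι ℂ[X]) (m : ℕ) : Prop :=
  (∀ i j, (P i j).natDegree ≤ m) ∧ coeffMat P m ≠ 0

/- ## Realizations -/

/-- Data of a realization `P(x) + C (x E - A)⁻¹ B` with `r × r` pencil `x E - A`,
`E` nonsingular. -/
structure Realization (ι : Type*) (r : ℕ) where
  P : Matrix ι ι ℂ[X]
  C : Matrix ι (Fin r) ℂ
  E : Matrix (Fin r) (Fin r) ℂ
  A : Matrix (Fin r) (Fin r) ℂ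
  B : Matrix (Fin r) ι ℂ
  isUnit_det_E : IsUnit E.det

namespace Realization

variable {ι : Type*} {r : ℕ}

/-- The rational matrix `P(x) + C (x E - A)⁻¹ B`. -/
def transfer (R : Realization ι r) : Matrix ι ι (RatFunc ℂ) :=
  R.P.map (algebraMap ℂ[X] (RatFunc ℂ)) +
    R.C.map RatFunc.C *
      ((RatFunc.X : RatFunc ℂ) • R.E.map RatFunc.C - R.A.map RatFunc.C)⁻¹ *
      R.B.map RatFunc.C

/-- The Rosenbrock system matrix `[P(x), C; B, A - x E]`. -/
def systemMatrix (R : Realization ι r) : Matrix (ι ⊕ Fin r) (ι ⊕ Fin r) ℂ[X] :=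
  fromBlocks R.P (R.C.map Polynomial.C) (R.B.map Polynomial.C) (-pencil R.E R.A)

/-- The size `r` is the smallest among all realizations of the same rational matrix. The system
matrix is then said to be irreducible. -/
def IsMinimal (R : Realization ι r) : Prop :=
  ∀ (r' : ℕ) (R' : Realization ι r'), R'.transfer = R.transfer → r ≤ r'

/-- A T-even realization: `C = Bᵀ`, and `P(x)`, `x E - A` are T-even. -/
def IsTEvenRealization (R : Realization ι r) : Prop :=
  R.C = R.Bᵀ ∧ IsTEven R.P ∧ IsTEven (pencil R.E R.A)

end Realization

/- ## Block matrices

Block rows and columns of `mn × mn` matrices are numbered `1, …, m`: the block number of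
`p : Fin m × Fin n` is `p.1 + 1`. -/

/-- `e_k ⊗ C`, where `e_k` is the `k`-th column of the identity matrix of size `m`. -/
def blockCol {α : Type*} [Zero α] (m : ℕ) {n r : ℕ} (k : ℤ) (C : Matrix (Fin n) (Fin r) α) :
    Matrix (Fin m × Fin n) (Fin r) α :=
  Matrix.of fun p j => if ((p.1 : ℕ) : ℤ) + 1 = k then C p.2 j else 0

/-- `e_kᵀ ⊗ B`, where `e_k` is the `k`-th column of the identity matrix of size `m`. -/
def blockRow {α : Type*} [Zero α] (m : ℕ) {n r : ℕ} (k : ℤ) (B : Matrix (Fin r) (Fin n) α) :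
    Matrix (Fin r) (Fin m × Fin n) α :=
  Matrix.of fun i q => if ((q.1 : ℕ) : ℤ) + 1 = k then B i q.2 else 0

/-- `diag(I_{(m-1)n}, M)` for an `n × n` matrix `M`. -/
def padIdentity {α : Type*} [Zero α] [One α] (m : ℕ) {n : ℕ} (M : Matrix (Fin n) (Fin n) α) :
    Matrix (Fin m × Fin n) (Fin m × Fin n) α :=
  Matrix.of fun p q =>
    if (p.1 : ℕ) + 1 = m ∧ (q.1 : ℕ) + 1 = m then M p.2 q.2 else if p = q then 1 else 0

/-- `diag(I_{(m-1)n}, S(x))` for the system matrix `S(x)` of a realization. -/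
def padSystem (m : ℕ) {n r : ℕ} (R : Realization (Fin n) r) :
    Matrix ((Fin m × Fin n) ⊕ Fin r) ((Fin m × Fin n) ⊕ Fin r) ℂ[X] :=
  fromBlocks (padIdentity m R.P) (blockCol m (m : ℤ) (R.C.map Polynomial.C))
    (blockRow m (m : ℤ) (R.B.map Polynomial.C)) (-pencil R.E R.A)

/-- Rosenbrock strong linearization of the rational matrix `R.transfer = P + C (x E - A)⁻¹ B`
with `P` of degree `m`: `LL` is an irreducible system matrix of a realization `R'` of size `r`
with polynomial part a pencil `X - x Y`, satisfying the conditions (a) (finite structure) and (b)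
(structure at infinity). -/
def IsRosenbrockStrongLinearization (m : ℕ) {n r : ℕ} (R : Realization (Fin n) r)
    (LL : Matrix ((Fin m × Fin n) ⊕ Fin r) ((Fin m × Fin n) ⊕ Fin r) ℂ[X]) : Prop :=
  ∃ R' : Realization (Fin m × Fin n) r,
    LL = R'.systemMatrix ∧
    (∃ X Y : Matrix (Fin m × Fin n) (Fin m × Fin n) ℂ, R'.P = -pencil Y X) ∧
    R'.IsMinimal ∧
    (∃ (U V : Matrix (Fin m × Fin n) (Fin m × Fin n) ℂ[X]) (U₀ V₀ : Matrix (Fin r) (Fin r) ℂ),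
      IsUnimodular U ∧ IsUnimodular V ∧ IsUnit U₀.det ∧ IsUnit V₀.det ∧
      fromBlocks U 0 0 (U₀.map Polynomial.C) * LL * fromBlocks V 0 0 (V₀.map Polynomial.C) =
        padSystem m R) ∧
    (∃ Ol Or : Matrix (Fin m × Fin n) (Fin m × Fin n) (RatFunc ℂ),
      IsBiproper Ol ∧ IsBiproper Or ∧
      Ol * ((RatFunc.X : RatFunc ℂ)⁻¹ • R'.transfer) * Or =
        padIdentity m (((RatFunc.X : RatFunc ℂ) ^ m)⁻¹ • R.transfer))

/- ## Fiedler matrices -/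

/-- The `(i, j)` block (`1 ≤ i, j ≤ m`) of the elementary matrix `M_k(X)`, `-m ≤ k ≤ m - 1`:
`M_0(X) = diag(I, X)`, `M_{-m}(X) = diag(X, I)`, and for `1 ≤ l ≤ m - 1` the matrices `M_l(X)`
and `M_{-l}(X)` are the identity except for the rows and columns `m - l`, `m - l + 1`, where they
are `[X, I; I, 0]` and `[0, I; I, X]` respectively. -/
def elemBlock (m : ℤ) {n : ℕ} (k : ℤ) (X : Matrix (Fin n) (Fin n) ℂ) (i j : ℤ) :
    Matrix (Fin n) (Fin n) ℂ :=
  if k = 0 then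
    if i = m ∧ j = m then X else if i = j then 1 else 0
  else if k = -m then
    if i = 1 ∧ j = 1 then X else if i = j then 1 else 0
  else if i = m - |k| ∧ j = m - |k| then
    if 0 < k then X else 0
  else if i = m - |k| + 1 ∧ j = m - |k| + 1 then
    if 0 < k then 0 else X
  else if (i = m - |k| ∧ j = m - |k| + 1) ∨ (i = m - |k| + 1 ∧ j = m - |k|) then 1
  else if i = j then 1 else 0

/-- The elementary matrix `M_k(X)`, `-m ≤ k ≤ m - 1`. -/
def elemMat (m : ℕ) {n : ℕ} (k : ℤ) (X : Matrix (Fin n) (Fin n) ℂ) :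
    Matrix (Fin m × Fin n) (Fin m × Fin n) ℂ :=
  Matrix.of fun p q =>
    elemBlock (m : ℤ) k X (((p.1 : ℕ) : ℤ) + 1) (((q.1 : ℕ) : ℤ) + 1) p.2 q.2

/-- The Fiedler matrix `M_k^P` of `P(x)`: `M_k(-A_k)` if `k ≥ 0`, `M_k(A_{-k})` if `k < 0`. -/
def fiedlerP (m : ℕ) {n : ℕ} (P : Matrix (Fin n) (Fin n) ℂ[X]) (k : ℤ) :
    Matrix (Fin m × Fin n) (Fin m × Fin n) ℂ :=
  if 0 ≤ k then elemMat m k (-coeffMat P k.natAbs) else elemMat m k (coeffMat P k.natAbs)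

/-- `diag(M_k^P, I_r)`. -/
def fiedlerPExt (m : ℕ) {n : ℕ} (r : ℕ) (P : Matrix (Fin n) (Fin n) ℂ[X]) (k : ℤ) :
    Matrix ((Fin m × Fin n) ⊕ Fin r) ((Fin m × Fin n) ⊕ Fin r) ℂ :=
  fromBlocks (fiedlerP m P k) 0 0 1

/-- The Fiedler matrices of the system matrix. Since `M_k(X)⁻¹ = M_{-k}(-X)` for
`1 ≤ k ≤ m - 1`, the last case also covers the negative indices, for which the Fiedler matrix is
the inverse of the one of index `-k`. -/
def fiedlerS (m : ℕ) {n r : ℕ} (R : Realization (Fin n) r) (k : ℤ) :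
    Matrix ((Fin m × Fin n) ⊕ Fin r) ((Fin m × Fin n) ⊕ Fin r) ℂ :=
  if k = 0 then
    fromBlocks (fiedlerP m R.P 0) (-blockCol m (m : ℤ) R.C) (-blockRow m (m : ℤ) R.B) (-R.A)
  else if k = -(m : ℤ) then
    fromBlocks (fiedlerP m R.P (-(m : ℤ))) 0 0 (-R.E)
  else fiedlerPExt m r R.P k

/- ## Index tuples -/

/-- The string `(0 : b) = (0, 1, …, b)`. -/
def stringZero (b : ℕ) : List ℤ := (List.range (b + 1)).map fun i => (i : ℤ)

/-- `w = (h-1 : h, h-3 : h-2, …, p+1 : p+2, 0 : p)`, the admissible tuple of `{0, …, h}` with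
index `p`; here `0 ≤ p ≤ h` and `h - p` is even. -/
def IsAdmissible (h p : ℕ) (w : List ℤ) : Prop :=
  p ≤ h ∧ Even (h - p) ∧
    w = ((List.range ((h - p) / 2)).reverse.flatMap fun i =>
        [(p : ℤ) + 2 * i + 1, (p : ℤ) + 2 * i + 2]) ++ stringZero p

/-- The symmetric complement `(h-1, h-3, …, p+1, 0 : p-1, 0 : p-2, …, 0 : 1, 0)` of the admissible
tuple of `{0, …, h}` with index `p`. -/
def symmetricComplement (h p : ℕ) : List ℤ :=
  ((List.range ((h - p) / 2)).reverse.map fun i => (p : ℤ) + 2 * i + 1) ++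
    (List.range p).reverse.flatMap stringZero

/-- The number of consecutive inversions of `α` at `t`: the largest `s` such that
`(t + s, …, t + 1, t)` is a subtuple of `α`; it is `-1` if `t` does not occur in `α`. -/
def inversionsAt (t : ℤ) (α : List ℤ) : ℤ :=
  if t ∈ α then
    (Nat.findGreatest
      (fun s => ((List.range (s + 1)).reverse.map fun i => t + (i : ℤ)).Sublist α) α.length : ℤ)
  else -1

/- ## The pencils -/

/-- `(x M^P_z - M^P_w) M^P_{c_w} M^P_{c_z}`. -/
def pencilP (m : ℕ) {n : ℕ} (P : Matrix (Fin n) (Fin n) ℂ[X]) (z w cw cz : List ℤ) :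
    Matrix (Fin m × Fin n) (Fin m × Fin n) ℂ[X] :=
  pencil (z.map (fiedlerP m P)).prod (w.map (fiedlerP m P)).prod *
    ((cw.map (fiedlerP m P)).prod.map Polynomial.C) *
    ((cz.map (fiedlerP m P)).prod.map Polynomial.C)

/-- `(x 𝕄^S_z - 𝕄^S_w) 𝕄^P_{c_w} 𝕄^P_{c_z}`. -/
def pencilS (m : ℕ) {n r : ℕ} (R : Realization (Fin n) r) (z w cw cz : List ℤ) :
    Matrix ((Fin m × Fin n) ⊕ Fin r) ((Fin m × Fin n) ⊕ Fin r) ℂ[X] :=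
  pencil (z.map (fiedlerS m R)).prod (w.map (fiedlerS m R)).prod *
    ((cw.map (fiedlerPExt m r R.P)).prod.map Polynomial.C) *
    ((cz.map (fiedlerPExt m r R.P)).prod.map Polynomial.C)

/-- The quasi-identity matrix `ε₁ I_n ⊕ ⋯ ⊕ ε_m I_n`, `ε_i = ±1`. -/
def quasiIdentity {m : ℕ} (n : ℕ) (ε : Fin m → ℤˣ) :
    Matrix (Fin m × Fin n) (Fin m × Fin n) ℂ[X] :=
  Matrix.diagonal fun p => ((ε p.1 : ℤ) : ℂ[X])

/-- `diag(Q, I_r)`. -/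
def quasiIdentityExt {m n : ℕ} (r : ℕ) (Q : Matrix (Fin m × Fin n) (Fin m × Fin n) ℂ[X]) :
    Matrix ((Fin m × Fin n) ⊕ Fin r) ((Fin m × Fin n) ⊕ Fin r) ℂ[X] :=
  fromBlocks Q 0 0 1

/-- The realization with polynomial part `L`, state pencil `x E - A`, `C`-part `e_k ⊗ Bᵀ` and
`B`-part `e_kᵀ ⊗ B`. -/
def liftRealization (m : ℕ) {n r : ℕ} (R : Realization (Fin n) r) (k : ℤ)
    (L : Matrix (Fin m × Fin n) (Fin m × Fin n) ℂ[X]) : Realization (Fin m × Fin n) r where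
  P := L
  C := blockCol m k R.Bᵀ
  E := R.E
  A := R.A
  B := blockRow m k R.B
  isUnit_det_E := R.isUnit_det_E

end

/-! Since h is even, the simple tuple w has index 0. Write h = 2s and m - h - 1 = p + 2s', where p
is the index of z + m, so that m = p + 2s' + 2s + 1. For 1 ≤ i ≤ m - 1 the Fiedler matrices M_i and
M_{-i} of P are mutually inverse and act on two adjacent blocks only (`swp`). Factors on disjoint
blocks commute, and every index tuple collapses to a few products: odd and even indices at the low
end, odd and even indices at the high end, and a string at -m.

Symmetry. A pencil xE - A is T-even iff E is skew and A is symmetric. After commuting factors, both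
coefficients of L take the form X Y X (`leadCoeff_eq`, `constCoeff_eq`), where Y is a product of
factors with essentially disjoint supports: pairs [X, 1; 1, 0], a Hankel matrix coming from the
symmetric complement of the string at -m, and a diagonal block. Because A_jᵀ = (-1)^j A_j, each
piece multiplied by a sign matrix D is symmetric or skew as soon as consecutive signs agree or
differ in a prescribed way; `evenSign` meets all of these conditions at once. Conjugation by X then
gives `leadCoeff_skew` and `constCoeff_symmetric`.

Uniqueness. If D and D' both work, then D D' commutes with both coefficients, hence with each of the
factors. A nonzero block in position (a, b) forces equal signs at a and b, and the off-diagonal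
identities together with the block A_m on the Hankel antidiagonals connect all block positions
(`dgl_eq_of_commute_coeffs`).

Linearization. Cancelling mutually inverse Fiedler matrices, L is a constant left factor times x M_Z
- M_0 times a constant right factor, where M_Z is a product of the Fiedler matrices of all indices
-m, …, -1 (`leadCoeff_factor`, `constCoeff_factor`). The right factor is invertible when A_m is
nonsingular or p = 0. A pencil x M_Z - M_0 is reduced one block at a time, each elimination being
one step of the Horner scheme (`chain_elimination`). This works over any commutative ring and for
any element x: over ℂ[x] it gives the finite structure, and over the ring of proper rational
functions, with 1/x in place of x, the structure at infinity. The transformations preserve the block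
that carries A_0, which is also the block where B enters, so the state part is carried along
unchanged; at infinity A_0 is simply replaced by A_0 + C (xE - A)⁻¹ B.

State part. The constant factors move e_m to e_{m-α} with α = min(s, 1), which gives the displayed
block form. Minimality passes to the lifted realization because its diagonal block at m - α differs
from G by a polynomial matrix. -/

noncomputable section

/-! ### Calculus of block matrices with a single nonzero block; blocks are numbered from 0. -/

section BlockCalculus

variable {S : Type*} [CommRing S] {m n : ℕ}

/-- The `m × m` block matrix whose only nonzero block is `X`, in block row `a` and block column `b`
(numbered from `0`). -/
def blk (m : ℕ) {n : ℕ} (a b : ℕ) (X : Matrix (Fin n) (Fin n) S) :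
    Matrix (Fin m × Fin n) (Fin m × Fin n) S :=
  Matrix.of fun p q => if (p.1 : ℕ) = a ∧ (q.1 : ℕ) = b then X p.2 q.2 else 0

lemma blk_mul_blk (a b c d : ℕ) (X Y : Matrix (Fin n) (Fin n) S) :
    blk m a b X * blk m c d Y = if b = c ∧ b < m then blk m a d (X * Y) else 0 := by
  ext p q
  by_cases h : b = c ∧ b < m
  · obtain ⟨rfl, hb⟩ := h
    simp only [blk, mul_apply, Fintype.sum_prod_type, of_apply, hb, and_self, if_true]
    rw [Finset.sum_eq_single ⟨b, hb⟩]
    · by_cases hp : (p.1 : ℕ) = a <;> by_cases hq : (q.1 : ℕ) = d <;> simp [hp, hq]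
    · intro i _ hi
      have : (i : ℕ) ≠ b := fun h => hi (Fin.ext h)
      simp [this]
    · simp
  · simp only [if_neg h, blk, mul_apply, of_apply, Matrix.zero_apply]
    refine Finset.sum_eq_zero fun i _ => ?_
    by_cases hb : (i.1 : ℕ) = b
    · have hc : (i.1 : ℕ) ≠ c := fun hc => h ⟨hb.symm.trans hc, hb ▸ i.1.2⟩
      simp [hc]
    · simp [hb]

lemma blk_mul_same {a b d : ℕ} (hb : b < m) (X Y : Matrix (Fin n) (Fin n) S) :
    blk m a b X * blk m b d Y = blk m a d (X * Y) := by simp [blk_mul_blk, hb]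

lemma blk_mul_ne {a b c d : ℕ} (hb : b ≠ c) (X Y : Matrix (Fin n) (Fin n) S) :
    blk m a b X * blk m c d Y = 0 := by simp [blk_mul_blk, hb]

lemma blk_add (a b : ℕ) (X Y : Matrix (Fin n) (Fin n) S) :
    blk m a b (X + Y) = blk m a b X + blk m a b Y := by
  ext p q; simp only [blk, of_apply, Matrix.add_apply]; split_ifs <;> simp

lemma blk_neg (a b : ℕ) (X : Matrix (Fin n) (Fin n) S) :
    blk m a b (-X) = -blk m a b X := by
  ext p q; simp only [blk, of_apply, Matrix.neg_apply]; split_ifs <;> simp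

lemma blk_sub (a b : ℕ) (X Y : Matrix (Fin n) (Fin n) S) :
    blk m a b (X - Y) = blk m a b X - blk m a b Y := by
  rw [sub_eq_add_neg, blk_add, blk_neg, sub_eq_add_neg]

lemma blk_zero (a b : ℕ) : blk m a b (0 : Matrix (Fin n) (Fin n) S) = 0 := by
  ext p q; simp [blk]

lemma blk_smul (a b : ℕ) (x : S) (X : Matrix (Fin n) (Fin n) S) :
    blk m a b (x • X) = x • blk m a b X := by
  ext p q; simp [blk]

lemma blk_transpose (a b : ℕ) (X : Matrix (Fin n) (Fin n) S) :
    (blk m a b X)ᵀ = blk m b a Xᵀ := by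
  ext p q; simp [blk, and_comm]

lemma blk_map {T : Type*} [CommRing T] (f : S →+* T) (a b : ℕ) (X : Matrix (Fin n) (Fin n) S) :
    (blk m a b X).map f = blk m a b (X.map f) := by
  ext p q; simp only [blk, of_apply, map_apply]; split_ifs <;> simp

/-- The projection onto the first `t` blocks. -/
def prj (S : Type*) [CommRing S] (m n t : ℕ) : Matrix (Fin m × Fin n) (Fin m × Fin n) S :=
  Matrix.diagonal fun p => if (p.1 : ℕ) < t then 1 else 0

lemma prj_zero : prj S m n 0 = 0 := by
  ext p q; simp [prj]

lemma prj_eq_one {t : ℕ} (h : m ≤ t) : prj S m n t = 1 := by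
  ext p q
  have : (p.1 : ℕ) < t := p.1.2.trans_le h
  simp [prj, Matrix.diagonal_apply, one_apply, this]

lemma prj_succ (t : ℕ) : prj S m n (t + 1) = prj S m n t + blk m t t 1 := by
  ext p q
  simp only [prj, blk, diagonal_apply, Matrix.add_apply, of_apply]
  by_cases hpq : p = q
  · subst hpq
    rcases lt_trichotomy (p.1 : ℕ) t with h | h | h
    · simp [h, h.ne, h.trans (Nat.lt_succ_self t)]
    · simp [h]
    · simp [h.not_gt, h.ne', Nat.not_lt.2 (Nat.succ_le_of_lt h)]
  · by_cases h : (p.1 : ℕ) = t ∧ (q.1 : ℕ) = t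
    · have : p.2 ≠ q.2 := fun h2 => hpq (Prod.ext (Fin.ext (h.1.trans h.2.symm)) h2)
      simp [hpq, h, one_apply, this]
    · simp [hpq, h]

lemma prj_mul_blk (t a b : ℕ) (X : Matrix (Fin n) (Fin n) S) :
    prj S m n t * blk m a b X = if a < t then blk m a b X else 0 := by
  ext p q
  simp only [prj, diagonal_mul, blk, of_apply]
  by_cases ha : a < t
  · by_cases h : (p.1 : ℕ) = a <;> simp [h, ha]
  · by_cases h : (p.1 : ℕ) = a <;> simp [h, ha]

lemma blk_mul_prj (t a b : ℕ) (X : Matrix (Fin n) (Fin n) S) :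
    blk m a b X * prj S m n t = if b < t then blk m a b X else 0 := by
  ext p q
  simp only [prj, mul_diagonal, blk, of_apply]
  by_cases ha : b < t
  · by_cases h : (q.1 : ℕ) = b <;> simp [h, ha]
  · by_cases h : (q.1 : ℕ) = b <;> simp [h, ha]

lemma prj_transpose (t : ℕ) : (prj S m n t)ᵀ = prj S m n t := by simp [prj]

/-- The matrix that is the identity except for the block rows and columns `a`, `b`, where it is
`[X, 1; 1, 0]`. -/
def swp (m : ℕ) {n : ℕ} (a b : ℕ) (X : Matrix (Fin n) (Fin n) S) :
    Matrix (Fin m × Fin n) (Fin m × Fin n) S :=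
  1 - blk m a a 1 - blk m b b 1 + blk m a a X + blk m a b 1 + blk m b a 1

/-- The matrix that is the identity except for the diagonal block `a`, which is `X`. -/
def dgb (m : ℕ) {n : ℕ} (a : ℕ) (X : Matrix (Fin n) (Fin n) S) :
    Matrix (Fin m × Fin n) (Fin m × Fin n) S :=
  1 - blk m a a 1 + blk m a a X

/-- This is [X, 1; 1, 0]⁻¹ = [0, 1; 1, -X], that is M_i(X)⁻¹ = M_{-i}(-X). Reversing the two block
arguments of `swp` thus passes between positive and negative indices. -/
lemma swp_mul_swp {a b : ℕ} (ha : a < m) (hb : b < m) (hab : a ≠ b)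
    (X : Matrix (Fin n) (Fin n) S) : swp m a b X * swp m b a (-X) = 1 := by
  simp only [swp, mul_add, add_mul, mul_sub, sub_mul, one_mul, mul_one, blk_mul_blk, ha, hb, hab,
    hab.symm, and_true, if_true, if_false, blk_neg, mul_neg]
  abel

lemma swp_mul_swp' {a b : ℕ} (ha : a < m) (hb : b < m) (hab : a ≠ b)
    (X : Matrix (Fin n) (Fin n) S) : swp m a b (-X) * swp m b a X = 1 := by
  simpa using swp_mul_swp ha hb hab (-X)

lemma isUnit_swp {a b : ℕ} (ha : a < m) (hb : b < m) (hab : a ≠ b)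
    (X : Matrix (Fin n) (Fin n) S) : IsUnit (swp m a b X) :=
  IsUnit.of_mul_eq_one _ (swp_mul_swp ha hb hab X)

lemma swp_map {T : Type*} [CommRing T] (f : S →+* T) (a b : ℕ) (X : Matrix (Fin n) (Fin n) S) :
    (swp m a b X).map f = swp m a b (X.map f) := by
  simp only [swp, ← RingHom.mapMatrix_apply, map_add, map_sub, map_one]
  simp only [RingHom.mapMatrix_apply, blk_map, Matrix.map_one f (map_zero f) (map_one f)]

lemma dgb_map {T : Type*} [CommRing T] (f : S →+* T) (a : ℕ) (X : Matrix (Fin n) (Fin n) S) :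
    (dgb m a X).map f = dgb m a (X.map f) := by
  simp only [dgb, ← RingHom.mapMatrix_apply, map_add, map_sub, map_one]
  simp only [RingHom.mapMatrix_apply, blk_map, Matrix.map_one f (map_zero f) (map_one f)]

lemma swp_commute_swp {a b c d : ℕ} (hac : a ≠ c) (had : a ≠ d) (hbc : b ≠ c) (hbd : b ≠ d)
    (X Y : Matrix (Fin n) (Fin n) S) : Commute (swp m a b X) (swp m c d Y) := by
  simp only [Commute, SemiconjBy, swp, mul_add, add_mul, mul_sub, sub_mul, one_mul, mul_one,
    blk_mul_blk, hac, had, hbc, hbd, hac.symm, had.symm, hbc.symm, hbd.symm, false_and, if_false]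
  abel

lemma blk_mul_swp {a b c d : ℕ} (hda : d ≠ a) (hdb : d ≠ b) (X Y : Matrix (Fin n) (Fin n) S) :
    blk m c d Y * swp m a b X = blk m c d Y := by
  simp [swp, mul_add, mul_sub, blk_mul_blk, hda, hdb]

lemma swp_mul_blk {a b c d : ℕ} (hda : d ≠ a) (hdb : d ≠ b) (X Y : Matrix (Fin n) (Fin n) S) :
    swp m a b X * blk m d c Y = blk m d c Y := by
  simp [swp, add_mul, sub_mul, blk_mul_blk, hda.symm, hdb.symm]

end BlockCalculus

/-! ### Block elimination along a chain of blocks. -/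

section Elimination

variable {S : Type*} [CommRing S] {m n : ℕ}

/-- Cancelling the factor `swp m a b X` on the right leaves [-1, xZ; x, -xX] on the blocks a, b,
because N is the identity at a. The pivot -1 clears its row and column and leaves x(xZ - X) at b,
one Horner step; the factor `1 - 2 • blk m a a 1` turns the pivot into 1. The term `2 • blk m a a 1`
on the right records that 1 on top of the 1 that N subtracts. -/
lemma elimination_step_right {a b : ℕ} (ha : a < m) (hb : b < m) (hab : a ≠ b) (x : S)
    (X Z : Matrix (Fin n) (Fin n) S) (Δ N : Matrix (Fin m × Fin n) (Fin m × Fin n) S)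
    (hΔa : ∀ d Y, Δ * blk m a d Y = 0) (hΔb : ∀ d Y, Δ * blk m b d Y = 0)
    (hbΔ : ∀ d Y, blk m d a Y * Δ = 0)
    (hN : ∀ d Y, N * blk m a d Y = blk m a d Y) (hN' : ∀ d Y, blk m d a Y * N = blk m d a Y) :
    (1 - (2 : S) • blk m a a 1 + blk m b a (x • 1)) *
        (Δ + blk m a a (x • Z) + x • blk m b b 1 - N * swp m a b X) *
        (swp m b a (-X) * (1 + blk m a b (x • Z))) =
      Δ + (2 : S) • blk m a a 1 + blk m b b (x • (x • Z - X)) - N := by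
  have h1 : (Δ + blk m a a (x • Z) + x • blk m b b 1 - N * swp m a b X) * swp m b a (-X) =
      Δ + blk m a b (x • Z) + blk m b a (x • 1) - blk m b b (x • X) - N := by
    rw [sub_mul, mul_assoc N, swp_mul_swp ha hb hab, mul_one]
    simp only [Matrix.one_mul, swp, mul_add, add_mul, mul_sub, mul_one, hΔa, hΔb, blk_mul_blk, ha,
      hb, hab,
      hab.symm, and_true, if_true, if_false, blk_neg, smul_mul_assoc, blk_smul, mul_neg]
    module
  rw [mul_assoc, ← mul_assoc (_ - N * _), h1]
  simp only [mul_zero, mul_add, add_mul, mul_sub, sub_mul, mul_one, one_mul, hΔa, hbΔ, hN, hN',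
    blk_mul_blk,
    ha, hb, hab, hab.symm, and_true, if_true, if_false, smul_mul_assoc,
    blk_smul, mul_smul_comm, smul_add, smul_sub, smul_smul, blk_sub]
  module

/-- The mirror image, for a factor that stands on the left of N. -/
lemma elimination_step_left {a b : ℕ} (ha : a < m) (hb : b < m) (hab : a ≠ b) (x : S)
    (X Z : Matrix (Fin n) (Fin n) S) (Δ N : Matrix (Fin m × Fin n) (Fin m × Fin n) S)
    (hΔa : ∀ d Y, Δ * blk m a d Y = 0) (hbΔ : ∀ d Y, blk m d b Y * Δ = 0)
    (haΔ : ∀ d Y, blk m d a Y * Δ = 0)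
    (hN : ∀ d Y, N * blk m a d Y = blk m a d Y) (hN' : ∀ d Y, blk m d a Y * N = blk m d a Y) :
    ((1 + blk m b a (x • Z)) * swp m b a (-X)) *
        (Δ + blk m a a (x • Z) + x • blk m b b 1 - swp m a b X * N) *
        (1 - (2 : S) • blk m a a 1 + blk m a b (x • 1)) =
      Δ + (2 : S) • blk m a a 1 + blk m b b (x • (x • Z - X)) - N := by
  have h1 : swp m b a (-X) * (Δ + blk m a a (x • Z) + x • blk m b b 1 - swp m a b X * N) =
      Δ + blk m b a (x • Z) + blk m a b (x • 1) - blk m b b (x • X) - N := by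
    rw [mul_sub, ← mul_assoc (swp m b a (-X)), swp_mul_swp' hb ha hab.symm, one_mul]
    simp only [Matrix.mul_one, swp, mul_add, add_mul, sub_mul, one_mul, haΔ, hbΔ, blk_mul_blk, ha,
      hb, hab,
      hab.symm, and_true, if_true, if_false, blk_neg, mul_smul_comm, blk_smul, neg_mul]
    module
  rw [mul_assoc (1 + _), h1]
  simp only [zero_mul, mul_add, add_mul, mul_sub, sub_mul, mul_one, one_mul, hΔa, haΔ, hN, hN',
    blk_mul_blk,
    ha, hb, hab, hab.symm, and_true, if_true, if_false, smul_mul_assoc,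
    blk_smul, mul_smul_comm, smul_add, smul_sub, smul_smul, blk_sub]
  module

/-- The left factor of a Fiedler product along the chain of blocks `c 0, c 1, …`. -/
def chainL (m : ℕ) (c : ℕ → ℕ) (X : ℕ → Matrix (Fin n) (Fin n) S) (left : ℕ → Bool) :
    ℕ → Matrix (Fin m × Fin n) (Fin m × Fin n) S
  | 0 => 1
  | j + 1 => if left j then swp m (c (j + 1)) (c j) (X j) * chainL m c X left j
      else chainL m c X left j

/-- The right factor of a Fiedler product along the chain of blocks `c 0, c 1, …`. -/
def chainR (m : ℕ) (c : ℕ → ℕ) (X : ℕ → Matrix (Fin n) (Fin n) S) (left : ℕ → Bool) :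
    ℕ → Matrix (Fin m × Fin n) (Fin m × Fin n) S
  | 0 => 1
  | j + 1 => if left j then chainR m c X left j
      else chainR m c X left j * swp m (c (j + 1)) (c j) (X j)

/-- The leading part of the Fiedler pencil along a chain, with the blocks outside the chain
prepared to become identity blocks. -/
def chainLead (m : ℕ) (c : ℕ → ℕ) (x : S) (j : ℕ) (Z : Matrix (Fin n) (Fin n) S) :
    Matrix (Fin m × Fin n) (Fin m × Fin n) S :=
  (2 : S) • (1 - ∑ i ∈ Finset.range (j + 1), blk m (c i) (c i) 1) + blk m (c j) (c j) (x • Z) +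
    x • ∑ i ∈ Finset.range j, blk m (c i) (c i) 1

/-- The Horner scheme. -/
def horner (x : S) (X : ℕ → Matrix (Fin n) (Fin n) S) :
    ℕ → Matrix (Fin n) (Fin n) S → Matrix (Fin n) (Fin n) S
  | 0, Z => Z
  | j + 1, Z => horner x X j (x • Z - X j)

lemma smul_horner (x : S) (X : ℕ → Matrix (Fin n) (Fin n) S) (j : ℕ)
    (Z : Matrix (Fin n) (Fin n) S) :
    x • horner x X j Z = x ^ (j + 1) • Z - ∑ i ∈ Finset.range j, x ^ (i + 1) • X i := by
  induction j generalizing Z with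
  | zero => simp [horner]
  | succ j ih =>
    rw [horner, ih, Finset.sum_range_succ]
    module

variable {c : ℕ → ℕ} {X : ℕ → Matrix (Fin n) (Fin n) S} {left : ℕ → Bool} {K : ℕ}

/-- The first j steps of the chain touch only the blocks c 0, …, c j, so a later block of the chain
sees the identity. The next three lemmas are the same fact for the other sides. -/
lemma blk_mul_chainL (hinj : ∀ i ≤ K, ∀ j ≤ K, c i = c j → i = j) {j i : ℕ} (hji : j < i)
    (hi : i ≤ K) (d : ℕ) (Y : Matrix (Fin n) (Fin n) S) :
    blk m d (c i) Y * chainL m c X left j = blk m d (c i) Y := by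
  induction j with
  | zero => simp [chainL]
  | succ j ih =>
    have h1 : c i ≠ c (j + 1) := fun h => by have := hinj _ hi _ (by omega) h; omega
    have h2 : c i ≠ c j := fun h => by have := hinj _ hi _ (by omega) h; omega
    rw [chainL]
    split_ifs
    · rw [← mul_assoc, blk_mul_swp h1 h2, ih (by omega)]
    · exact ih (by omega)

lemma chainL_mul_blk (hinj : ∀ i ≤ K, ∀ j ≤ K, c i = c j → i = j) {j i : ℕ} (hji : j < i)
    (hi : i ≤ K) (d : ℕ) (Y : Matrix (Fin n) (Fin n) S) :
    chainL m c X left j * blk m (c i) d Y = blk m (c i) d Y := by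
  induction j with
  | zero => simp [chainL]
  | succ j ih =>
    have h1 : c i ≠ c (j + 1) := fun h => by have := hinj _ hi _ (by omega) h; omega
    have h2 : c i ≠ c j := fun h => by have := hinj _ hi _ (by omega) h; omega
    rw [chainL]
    split_ifs
    · rw [mul_assoc, ih (by omega), swp_mul_blk h1 h2]
    · exact ih (by omega)

lemma blk_mul_chainR (hinj : ∀ i ≤ K, ∀ j ≤ K, c i = c j → i = j) {j i : ℕ} (hji : j < i)
    (hi : i ≤ K) (d : ℕ) (Y : Matrix (Fin n) (Fin n) S) :
    blk m d (c i) Y * chainR m c X left j = blk m d (c i) Y := by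
  induction j with
  | zero => simp [chainR]
  | succ j ih =>
    have h1 : c i ≠ c (j + 1) := fun h => by have := hinj _ hi _ (by omega) h; omega
    have h2 : c i ≠ c j := fun h => by have := hinj _ hi _ (by omega) h; omega
    rw [chainR]
    split_ifs
    · exact ih (by omega)
    · rw [← mul_assoc, ih (by omega), blk_mul_swp h1 h2]

lemma chainR_mul_blk (hinj : ∀ i ≤ K, ∀ j ≤ K, c i = c j → i = j) {j i : ℕ} (hji : j < i)
    (hi : i ≤ K) (d : ℕ) (Y : Matrix (Fin n) (Fin n) S) :
    chainR m c X left j * blk m (c i) d Y = blk m (c i) d Y := by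
  induction j with
  | zero => simp [chainR]
  | succ j ih =>
    have h1 : c i ≠ c (j + 1) := fun h => by have := hinj _ hi _ (by omega) h; omega
    have h2 : c i ≠ c j := fun h => by have := hinj _ hi _ (by omega) h; omega
    rw [chainR]
    split_ifs
    · exact ih (by omega)
    · rw [mul_assoc, swp_mul_blk h1 h2, ih (by omega)]

/-- Block elimination in a Fiedler pencil. -/
theorem chain_elimination (hlt : ∀ i ≤ K, c i < m)
    (hinj : ∀ i ≤ K, ∀ j ≤ K, c i = c j → i = j) (x : S) {j : ℕ} (hj : j ≤ K)
    (Z : Matrix (Fin n) (Fin n) S) :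
    ∃ U V : Matrix (Fin m × Fin n) (Fin m × Fin n) S, IsUnit U ∧ IsUnit V ∧
      U * (chainLead m c x j Z -
          chainL m c X left j * (1 - blk m (c 0) (c 0) 1) * chainR m c X left j) * V =
        1 - blk m (c 0) (c 0) 1 + blk m (c 0) (c 0) (x • horner x X j Z) ∧
      U * chainL m c X left j * blk m (c 0) (c 0) 1 = blk m (c 0) (c 0) 1 ∧
      blk m (c 0) (c 0) 1 * (chainR m c X left j * V) = blk m (c 0) (c 0) 1 := by
  -- Z must vary, since eliminating the block c (j + 1) replaces it by x • Z - X j. The last two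
  -- claims say that the transformations preserve the block c 0; they allow the coefficient at c 0,
  -- left out of the pencil here, and the state blocks to be put back afterwards.
  induction j generalizing Z with
  | zero =>
    refine ⟨1, 1, isUnit_one, isUnit_one, ?_, by simp [chainL], by simp [chainR]⟩
    simp only [chainLead, chainL, chainR, horner, Finset.sum_range_succ, Finset.sum_range_zero,
      one_mul, mul_one, zero_add, smul_zero, add_zero]
    module
  | succ j ih =>
    obtain ⟨U, V, hU, hV, hUV, hUL, hRV⟩ := ih (by omega) (x • Z - X j)
    have ha : c (j + 1) < m := hlt _ hj
    have hb : c j < m := hlt _ (by omega)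
    have hne : ∀ i ≤ j, c (j + 1) ≠ c i := fun i hi h => by
      have := hinj _ hj _ (by omega) h; omega
    have hne' : ∀ i < j, c j ≠ c i := fun i hi h => by
      have := hinj _ (by omega) _ (by omega) h; omega
    have hab := hne j le_rfl
    set a := c (j + 1) with ha_def
    set b := c j with hb_def
    set A := chainL m c X left j with hA
    set B := chainR m c X left j with hB
    set T : Matrix (Fin m × Fin n) (Fin m × Fin n) S := 1 - blk m (c 0) (c 0) 1 with hT
    -- Δ is the part of the lead supported off the two active blocks a and b. Blocks outside the
    -- chain have coefficient 2, so that subtracting the chain product, which is 1 there, leaves an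
    -- identity block.
    set Δ : Matrix (Fin m × Fin n) (Fin m × Fin n) S :=
      (2 : S) • (1 - ∑ i ∈ Finset.range (j + 1 + 1), blk m (c i) (c i) 1) +
      x • ∑ i ∈ Finset.range j, blk m (c i) (c i) 1 with hΔ
    have h0 := hne 0 (Nat.zero_le _)
    have hAa : ∀ d Y, A * blk m a d Y = blk m a d Y :=
      fun d Y => chainL_mul_blk hinj (Nat.lt_succ_self j) hj d Y
    have haA : ∀ d Y, blk m d a Y * A = blk m d a Y :=
      fun d Y => blk_mul_chainL hinj (Nat.lt_succ_self j) hj d Y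
    have hBa : ∀ d Y, B * blk m a d Y = blk m a d Y :=
      fun d Y => chainR_mul_blk hinj (Nat.lt_succ_self j) hj d Y
    have haB : ∀ d Y, blk m d a Y * B = blk m d a Y :=
      fun d Y => blk_mul_chainR hinj (Nat.lt_succ_self j) hj d Y
    have hTa : ∀ d Y, T * blk m a d Y = blk m a d Y := fun d Y => by
      rw [hT, sub_mul, one_mul, blk_mul_ne h0.symm, sub_zero]
    have haT : ∀ d Y, blk m d a Y * T = blk m d a Y := fun d Y => by
      rw [hT, mul_sub, mul_one, blk_mul_ne h0, sub_zero]
    have hN : ∀ d Y, A * T * B * blk m a d Y = blk m a d Y := fun d Y => by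
      rw [mul_assoc, hBa, mul_assoc, hTa, hAa]
    have hN' : ∀ d Y, blk m d a Y * (A * T * B) = blk m d a Y := fun d Y => by
      rw [← mul_assoc, ← mul_assoc, haA, haT, haB]
    have hs1 : ∀ (k : ℕ) (d : ℕ) (Y : Matrix (Fin n) (Fin n) S), (∀ i < k, c i ≠ b) →
        (∑ i ∈ Finset.range k, blk m (c i) (c i) (1 : Matrix (Fin n) (Fin n) S)) * blk m b d Y
          = 0 := fun k d Y h => by
      rw [Finset.sum_mul]
      exact Finset.sum_eq_zero fun i hi => blk_mul_ne (h i (Finset.mem_range.1 hi)) _ _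
    have hs2 : ∀ (k : ℕ) (d : ℕ) (Y : Matrix (Fin n) (Fin n) S), (∀ i < k, c i ≠ a) →
        (∑ i ∈ Finset.range k, blk m (c i) (c i) (1 : Matrix (Fin n) (Fin n) S)) * blk m a d Y
          = 0 := fun k d Y h => by
      rw [Finset.sum_mul]
      exact Finset.sum_eq_zero fun i hi => blk_mul_ne (h i (Finset.mem_range.1 hi)) _ _
    have hs3 : ∀ (k : ℕ) (d : ℕ) (Y : Matrix (Fin n) (Fin n) S), (∀ i < k, c i ≠ b) →
        blk m d b Y * (∑ i ∈ Finset.range k, blk m (c i) (c i) (1 : Matrix (Fin n) (Fin n) S))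
          = 0 := fun k d Y h => by
      rw [Finset.mul_sum]
      exact Finset.sum_eq_zero fun i hi => blk_mul_ne (h i (Finset.mem_range.1 hi)).symm _ _
    have hs4 : ∀ (k : ℕ) (d : ℕ) (Y : Matrix (Fin n) (Fin n) S), (∀ i < k, c i ≠ a) →
        blk m d a Y * (∑ i ∈ Finset.range k, blk m (c i) (c i) (1 : Matrix (Fin n) (Fin n) S))
          = 0 := fun k d Y h => by
      rw [Finset.mul_sum]
      exact Finset.sum_eq_zero fun i hi => blk_mul_ne (h i (Finset.mem_range.1 hi)).symm _ _
    have hΔa : ∀ d Y, Δ * blk m a d Y = 0 := fun d Y => by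
      rw [hΔ, Finset.sum_range_succ, add_mul, smul_mul_assoc, smul_mul_assoc, sub_mul, add_mul,
        hs2 _ _ _ fun i hi => (hne i (by omega)).symm, hs2 _ _ _ fun i hi =>
        (hne i (by omega)).symm, ← ha_def, blk_mul_same ha]
      simp
    have haΔ : ∀ d Y, blk m d a Y * Δ = 0 := fun d Y => by
      rw [hΔ, Finset.sum_range_succ, mul_add, mul_smul_comm, mul_smul_comm, mul_sub, mul_add,
        hs4 _ _ _ fun i hi => (hne i (by omega)).symm, hs4 _ _ _ fun i hi =>
        (hne i (by omega)).symm, ← ha_def, blk_mul_same ha]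
      simp
    have hΔb : ∀ d Y, Δ * blk m b d Y = 0 := fun d Y => by
      rw [hΔ, Finset.sum_range_succ, Finset.sum_range_succ, add_mul, smul_mul_assoc,
        smul_mul_assoc, sub_mul, add_mul, add_mul, ← ha_def, ← hb_def,
        hs1 _ _ _ fun i hi => (hne' i hi).symm, blk_mul_same hb, blk_mul_ne hab]
      simp
    have hbΔ : ∀ d Y, blk m d b Y * Δ = 0 := fun d Y => by
      rw [hΔ, Finset.sum_range_succ, Finset.sum_range_succ, mul_add, mul_smul_comm,
        mul_smul_comm, mul_sub, mul_add, mul_add, ← ha_def, ← hb_def,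
        hs3 _ _ _ fun i hi => (hne' i hi).symm, blk_mul_same hb, blk_mul_ne hab.symm]
      simp
    have hD' : chainLead m c x (j + 1) Z = Δ + blk m a a (x • Z) + x • blk m b b 1 := by
      rw [chainLead, hΔ, Finset.sum_range_succ _ j, ← hb_def, ← ha_def]
      module
    have hD : chainLead m c x j (x • Z - X j) =
        Δ + (2 : S) • blk m a a 1 + blk m b b (x • (x • Z - X j)) := by
      rw [chainLead, hΔ, Finset.sum_range_succ _ (j + 1), ← hb_def, ← ha_def]
      module
    -- An involution: it changes the sign of block a and adds a multiple of it to block b.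
    have hsq : ∀ Y : Matrix (Fin n) (Fin n) S, IsUnit (1 - (2 : S) • blk m a a 1 + blk m b a Y) :=
      fun Y => IsUnit.of_mul_eq_one (1 - (2 : S) • blk m a a 1 + blk m b a Y) <| by
        simp only [mul_add, add_mul, mul_sub, sub_mul, mul_one, one_mul, blk_mul_blk, ha, hab,
          and_true, if_true, if_false, smul_mul_assoc, mul_smul_comm]
        module
    have hsq' : ∀ Y : Matrix (Fin n) (Fin n) S, IsUnit (1 - (2 : S) • blk m a a 1 + blk m a b Y) :=
      fun Y => IsUnit.of_mul_eq_one (1 - (2 : S) • blk m a a 1 + blk m a b Y) <| by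
        simp only [mul_add, add_mul, mul_sub, sub_mul, mul_one, one_mul, blk_mul_blk, ha,
          hab.symm, and_true, if_true, if_false, smul_mul_assoc, false_and, mul_smul_comm]
        module
    have htr : ∀ (d e : ℕ) (Y : Matrix (Fin n) (Fin n) S), d ≠ e → IsUnit (1 + blk m d e Y) :=
      fun d e Y hde => IsUnit.of_mul_eq_one (1 - blk m d e Y) <| by
        simp [mul_sub, add_mul, blk_mul_blk, hde.symm]
    have hLT : ∀ Y : Matrix (Fin n) (Fin n) S, (1 - (2 : S) • blk m a a 1 + blk m b a Y) * A *
        blk m (c 0) (c 0) 1 = A * blk m (c 0) (c 0) 1 := fun Y => by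
      simp only [sub_mul, add_mul, one_mul, smul_mul_assoc, haA, blk_mul_ne h0, smul_zero,
        sub_zero, add_zero]
    have hRT : ∀ Y : Matrix (Fin n) (Fin n) S, blk m (c 0) (c 0) 1 * (B *
        (1 - (2 : S) • blk m a a 1 + blk m a b Y)) = blk m (c 0) (c 0) 1 * B := fun Y => by
      simp only [mul_sub, mul_add, mul_one, mul_smul_comm, hBa, blk_mul_ne h0.symm, smul_zero,
        sub_zero, add_zero]
    have hcL : chainL m c X left (j + 1) = if left j then swp m a b (X j) * A else A := rfl
    have hcR : chainR m c X left (j + 1) = if left j then B else B * swp m a b (X j) := rfl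
    have hh : horner x X (j + 1) Z = horner x X j (x • Z - X j) := rfl
    rw [hcL, hcR, hh, hD']
    by_cases hl : left j
    · simp only [hl, if_true]
      refine ⟨U * ((1 + blk m b a (x • Z)) * swp m b a (-X j)),
        (1 - (2 : S) • blk m a a 1 + blk m a b (x • 1)) * V,
        hU.mul ((htr _ _ _ hab.symm).mul (isUnit_swp hb ha hab.symm _)), (hsq' _).mul hV, ?_, ?_, ?_⟩
      · rw [← hUV, hD, ← elimination_step_left ha hb hab x (X j) Z Δ (A * T * B) hΔa hbΔ haΔ hN hN']
        simp only [mul_assoc]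
      · refine Eq.trans ?_ hUL
        have : (1 + blk m b a (x • Z)) * swp m b a (-X j) * (swp m a b (X j) * A) *
            blk m (c 0) (c 0) 1 = A * blk m (c 0) (c 0) 1 := by
          rw [mul_assoc (1 + _), ← mul_assoc (swp m b a _), swp_mul_swp' hb ha hab.symm, one_mul,
            add_mul, one_mul, haA, add_mul, blk_mul_ne h0, add_zero]
        rw [mul_assoc U, mul_assoc U, this, mul_assoc U]
      · refine Eq.trans ?_ hRV
        rw [← mul_assoc B, ← mul_assoc (blk m _ _ _), hRT, mul_assoc]
    · simp only [hl]
      refine ⟨U * (1 - (2 : S) • blk m a a 1 + blk m b a (x • 1)),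
        swp m b a (-X j) * (1 + blk m a b (x • Z)) * V,
        hU.mul (hsq _), ((isUnit_swp hb ha hab.symm _).mul (htr _ _ _ hab)).mul hV, ?_, ?_, ?_⟩
      · rw [← hUV, hD, ← elimination_step_right ha hb hab x (X j) Z Δ (A * T * B) hΔa hΔb haΔ hN hN']
        simp only [mul_assoc, Bool.false_eq_true, if_false]
      · simp only [Bool.false_eq_true, if_false]
        refine Eq.trans ?_ hUL
        rw [mul_assoc U, mul_assoc U, hLT, mul_assoc U]
      · simp only [Bool.false_eq_true, if_false]
        have : blk m (c 0) (c 0) 1 * (B * swp m a b (X j) *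
            (swp m b a (-X j) * (1 + blk m a b (x • Z)))) = blk m (c 0) (c 0) 1 * B := by
          rw [mul_assoc B, ← mul_assoc (swp m a b _), swp_mul_swp ha hb hab, one_mul,
            mul_add, mul_one, hBa, mul_add, blk_mul_ne h0.symm, add_zero]
        refine Eq.trans ?_ hRV
        rw [← mul_assoc (B * _), ← mul_assoc (blk m _ _ _), this, mul_assoc]

end Elimination

/-! ### Ordered products over index tuples. -/

section OrderedProducts

variable {M : Type*} [Monoid M]

/-- The product `f (s - 1) ⋯ f 1 f 0`. -/
def revProd (f : ℕ → M) : ℕ → M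
  | 0 => 1
  | s + 1 => f s * revProd f s

/-- The product `f 0 f 1 ⋯ f (s - 1)`. -/
def fwdProd (f : ℕ → M) : ℕ → M
  | 0 => 1
  | s + 1 => fwdProd f s * f s

lemma revProd_eq_prod (f : ℕ → M) (s : ℕ) :
    ((List.range s).reverse.map f).prod = revProd f s := by
  induction s with
  | zero => simp [revProd]
  | succ s ih => simp only [List.range_succ, List.reverse_append, List.reverse_singleton,
      List.singleton_append, List.map_cons, List.prod_cons, ih, revProd]

lemma fwdProd_eq_prod (f : ℕ → M) (s : ℕ) : ((List.range s).map f).prod = fwdProd f s := by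
  induction s with
  | zero => simp [fwdProd]
  | succ s ih => rw [List.prod_range_succ, ih, fwdProd]

lemma revProd_congr {f g : ℕ → M} {s : ℕ} (h : ∀ i < s, f i = g i) :
    revProd f s = revProd g s := by
  induction s with
  | zero => rfl
  | succ s ih => rw [revProd, revProd, h s (by omega), ih fun i hi => h i (by omega)]

lemma fwdProd_congr {f g : ℕ → M} {s : ℕ} (h : ∀ i < s, f i = g i) :
    fwdProd f s = fwdProd g s := by
  induction s with
  | zero => rfl
  | succ s ih => rw [fwdProd, fwdProd, h s (by omega), ih fun i hi => h i (by omega)]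

lemma Commute.revProd_right {f : ℕ → M} {s : ℕ} {x : M} (h : ∀ i < s, Commute x (f i)) :
    Commute x (revProd f s) := by
  induction s with
  | zero => exact Commute.one_right x
  | succ s ih => exact (h s (by omega)).mul_right (ih fun i hi => h i (by omega))

/-- Separates the odd from the even indices in a product of strings (2i + 1 : 2i + 2): the even
factor of a string commutes with the odd factors of all strings to its right, whose indices are at
least 3 away. -/
lemma revProd_mul {f g : ℕ → M} {s : ℕ} (h : ∀ i < s, ∀ j < i, Commute (g i) (f j)) :
    revProd (fun i => f i * g i) s = revProd f s * revProd g s := by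
  induction s with
  | zero => simp [revProd]
  | succ s ih =>
    have hc : Commute (g s) (revProd f s) := Commute.revProd_right fun j hj => h s (by omega) j hj
    rw [revProd, revProd, revProd, ih fun i hi => h i (by omega), mul_assoc, ← mul_assoc (g s),
      hc.eq]
    simp only [mul_assoc]

lemma isUnit_revProd {f : ℕ → M} {s : ℕ} (h : ∀ i < s, IsUnit (f i)) : IsUnit (revProd f s) := by
  induction s with
  | zero => exact isUnit_one
  | succ s ih => exact (h s (by omega)).mul (ih fun i hi => h i (by omega))

lemma isUnit_fwdProd {f : ℕ → M} {s : ℕ} (h : ∀ i < s, IsUnit (f i)) : IsUnit (fwdProd f s) := by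
  induction s with
  | zero => exact isUnit_one
  | succ s ih => exact (ih fun i hi => h i (by omega)).mul (h s (by omega))

lemma prod_map_flatMap_pair (F : ℤ → M) (a b : ℕ → ℤ) (l : List ℕ) :
    ((l.flatMap fun i => [a i, b i]).map F).prod = (l.map fun i => F (a i) * F (b i)).prod := by
  induction l with
  | nil => simp
  | cons i l ih => simp [List.flatMap_cons, ih, mul_assoc]

lemma prod_map_flatMap (F : ℤ → M) (a : ℕ → List ℤ) (l : List ℕ) :
    ((l.flatMap a).map F).prod = (l.map fun i => ((a i).map F).prod).prod := by
  induction l with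
  | nil => simp
  | cons i l ih => simp [List.flatMap_cons, ih]

/-- In the index tuples the cast from ℕ to ℤ acts on the whole list, as a monadic bind; this turns
it into an ordinary `List.map`. -/
lemma bind_pure_natCast (l : List ℕ) :
    (do let a ← l; pure (a : ℤ)) = l.map (fun i : ℕ => (i : ℤ)) :=
  bind_pure_comp _ _

lemma prod_map_stringZero (F : ℤ → M) (b : ℕ) :
    ((stringZero b).map F).prod = fwdProd (fun i : ℕ => F i) (b + 1) := by
  rw [stringZero, bind_pure_natCast, List.map_map, List.map_map, ← fwdProd_eq_prod]
  rfl

lemma prod_map_symmetricComplement (F : ℤ → M) (h p : ℕ) :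
    ((symmetricComplement h p).map F).prod =
      revProd (fun i => F ((p : ℤ) + 2 * i + 1)) ((h - p) / 2) *
        revProd (fun b => fwdProd (fun i : ℕ => F i) (b + 1)) p := by
  rw [symmetricComplement, bind_pure_natCast, List.map_append, List.prod_append, List.map_map,
    List.map_map, prod_map_flatMap, ← revProd_eq_prod, ← revProd_eq_prod]
  simp only [prod_map_stringZero]
  rfl

end OrderedProducts

/-! ### Disjoint pairs, Hankel matrices and their symmetry under sign matrices. -/

section Structured

variable {S : Type*} [CommRing S] {m n : ℕ}

/-- The block diagonal matrix with blocks `d i • 1`. -/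
def dgl (m n : ℕ) (d : ℕ → S) : Matrix (Fin m × Fin n) (Fin m × Fin n) S :=
  Matrix.diagonal fun p => d p.1

lemma dgl_mul_blk (d : ℕ → S) (a b : ℕ) (X : Matrix (Fin n) (Fin n) S) :
    dgl m n d * blk m a b X = d a • blk m a b X := by
  ext p q
  simp only [dgl, diagonal_mul, blk, of_apply, Matrix.smul_apply, smul_eq_mul]
  split_ifs with h
  · rw [h.1]
  · simp

lemma blk_mul_dgl (d : ℕ → S) (a b : ℕ) (X : Matrix (Fin n) (Fin n) S) :
    blk m a b X * dgl m n d = d b • blk m a b X := by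
  ext p q
  simp only [dgl, mul_diagonal, blk, of_apply, Matrix.smul_apply, smul_eq_mul]
  split_ifs with h
  · rw [h.2, mul_comm]
  · simp

lemma dgl_transpose (d : ℕ → S) : (dgl m n d)ᵀ = dgl m n d := by simp [dgl]

lemma blk_injective {a b : ℕ} (ha : a < m) (hb : b < m) {X Y : Matrix (Fin n) (Fin n) S}
    (h : blk m a b X = blk m a b Y) : X = Y := by
  ext i j
  have := congrFun (congrFun h (⟨a, ha⟩, i)) (⟨b, hb⟩, j)
  simpa [blk] using this

/-- A block diagonal matrix of scalar blocks that commutes with a matrix has equal scalars at the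
row and the column of a nonzero block. -/
lemma eq_of_commute_dgl [IsDomain S] {d : ℕ → S} {A : Matrix (Fin m × Fin n) (Fin m × Fin n) S}
    (h : Commute (dgl m n d) A) {a b : ℕ} (ha : a < m) (hb : b < m)
    {X : Matrix (Fin n) (Fin n) S} (hX : X ≠ 0)
    (hA : blk m a a 1 * A * blk m b b 1 = blk m a b X) : d a = d b := by
  have h1 : blk m a a 1 * (dgl m n d * A) * blk m b b 1 = d a • blk m a b X := by
    rw [← hA, ← mul_assoc, blk_mul_dgl]
    simp only [smul_mul_assoc]
  have h2 : blk m a a 1 * (A * dgl m n d) * blk m b b 1 = d b • blk m a b X := by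
    rw [← hA, ← mul_assoc, mul_assoc _ _ (blk m b b 1), dgl_mul_blk]
    simp only [mul_smul_comm]
  rw [h.eq, h2, ← blk_smul, ← blk_smul] at h1
  have h3 := blk_injective ha hb h1
  by_contra hne
  refine hX ?_
  have : (d b - d a) • X = 0 := by rw [sub_smul, h3, sub_self]
  exact (smul_eq_zero.1 this).resolve_left (sub_ne_zero.2 (Ne.symm hne))

/-- The pairs `{β i, γ i}`, `i < s`, are disjoint pairs of distinct block numbers. -/
structure DisjointPairs (m s : ℕ) (β γ : ℕ → ℕ) : Prop where
  lt_left : ∀ i < s, β i < m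
  lt_right : ∀ i < s, γ i < m
  ne : ∀ i < s, ∀ j < s, β i ≠ γ j
  inj_left : ∀ i < s, ∀ j < s, β i = β j → i = j
  inj_right : ∀ i < s, ∀ j < s, γ i = γ j → i = j

lemma DisjointPairs.mono {s t : ℕ} {β γ : ℕ → ℕ} (h : DisjointPairs m t β γ) (hst : s ≤ t) :
    DisjointPairs m s β γ where
  lt_left i hi := h.lt_left i (by omega)
  lt_right i hi := h.lt_right i (by omega)
  ne i hi j hj := h.ne i (by omega) j (by omega)
  inj_left i hi j hj := h.inj_left i (by omega) j (by omega)
  inj_right i hi j hj := h.inj_right i (by omega) j (by omega)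

variable {s : ℕ} {β γ : ℕ → ℕ} {X : ℕ → Matrix (Fin n) (Fin n) S}

/-- On disjoint supports the deviations from the identity annihilate each other, so the product is
additive in them. -/
lemma revProd_swp_eq (h : DisjointPairs m s β γ) :
    revProd (fun i => swp m (β i) (γ i) (X i)) s =
      1 + ∑ i ∈ Finset.range s, (swp m (β i) (γ i) (X i) - 1) := by
  induction s with
  | zero => simp [revProd]
  | succ s ih =>
    rw [revProd, ih (h.mono (Nat.le_succ s)), Finset.sum_range_succ]
    have : (swp m (β s) (γ s) (X s) - 1) *
        ∑ i ∈ Finset.range s, (swp m (β i) (γ i) (X i) - 1) = 0 := by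
      rw [Finset.mul_sum]
      refine Finset.sum_eq_zero fun i hi => ?_
      have hi := Finset.mem_range.1 hi
      have h1 : β s ≠ β i := fun e => by
        have := h.inj_left s (by omega) i (by omega) e; omega
      have h2 : γ s ≠ γ i := fun e => by
        have := h.inj_right s (by omega) i (by omega) e; omega
      have h3 := h.ne s (by omega) i (by omega)
      have h4 := (h.ne i (by omega) s (by omega)).symm
      simp only [swp, mul_add, add_mul, mul_sub, sub_mul, one_mul, mul_one, blk_mul_blk, h1, h2, h3,
        h4, false_and, if_false]
      abel
    rw [sub_mul, one_mul, sub_eq_zero] at this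
    rw [mul_add, this, mul_one]
    abel

lemma revProd_swp_sub (h : DisjointPairs m s β γ) :
    revProd (fun i => swp m (β i) (γ i) (X i)) s - 1 +
      ∑ i ∈ Finset.range s, (blk m (β i) (β i) 1 + blk m (γ i) (γ i) 1) =
    ∑ i ∈ Finset.range s,
      (blk m (β i) (β i) (X i) + (blk m (β i) (γ i) 1 + blk m (γ i) (β i) 1)) := by
  rw [revProd_swp_eq h, add_sub_cancel_left, ← Finset.sum_add_distrib]
  refine Finset.sum_congr rfl fun i _ => ?_
  rw [swp]
  abel

/-- The identity outside the pairs is cut away, because for σ = -1 it would not be skew. What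
remains is a sum of blocks [X, 1; 1, 0], and the two conditions on d match the off-diagonal
identities. -/
lemma symmetric_dgl_mul_pairs (h : DisjointPairs m s β γ) {d : ℕ → S} {σ : S}
    (hd : ∀ i < s, d (γ i) = σ * d (β i)) (hd' : ∀ i < s, d (β i) = σ * d (γ i))
    (hX : ∀ i < s, (X i)ᵀ = σ • X i) :
    (dgl m n d * (revProd (fun i => swp m (β i) (γ i) (X i)) s - 1 +
      ∑ i ∈ Finset.range s, (blk m (β i) (β i) 1 + blk m (γ i) (γ i) 1)))ᵀ =
    σ • (dgl m n d * (revProd (fun i => swp m (β i) (γ i) (X i)) s - 1 +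
      ∑ i ∈ Finset.range s, (blk m (β i) (β i) 1 + blk m (γ i) (γ i) 1))) := by
  rw [revProd_swp_sub h, Finset.mul_sum, transpose_sum, Finset.smul_sum]
  refine Finset.sum_congr rfl fun i hi => ?_
  have hi := Finset.mem_range.1 hi
  simp only [mul_add, dgl_mul_blk, transpose_add, transpose_smul, blk_transpose, transpose_one,
    hX i hi, blk_smul, smul_add]
  rw [smul_comm (d (β i)) σ, smul_smul σ (d (β i)) (blk m (β i) (γ i) 1),
    smul_smul σ (d (γ i)) (blk m (γ i) (β i) 1), ← hd i hi, ← hd' i hi,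
    add_comm (d (β i) • blk m (γ i) (β i) 1)]

lemma symmetric_dgl_mul_revProd_swp (h : DisjointPairs m s β γ) {d : ℕ → S}
    (hd : ∀ i < s, d (γ i) = d (β i)) (hX : ∀ i < s, (X i)ᵀ = X i) :
    (dgl m n d * revProd (fun i => swp m (β i) (γ i) (X i)) s)ᵀ =
      dgl m n d * revProd (fun i => swp m (β i) (γ i) (X i)) s := by
  have key := symmetric_dgl_mul_pairs (σ := (1 : S)) h (d := d) (X := X)
    (fun i hi => by rw [one_mul, hd i hi]) (fun i hi => by rw [one_mul, hd i hi])
    (fun i hi => by rw [one_smul, hX i hi])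
  have h2 : (dgl m n d * ∑ i ∈ Finset.range s, (blk m (β i) (β i) 1 + blk m (γ i) (γ i) 1))ᵀ =
      dgl m n d * ∑ i ∈ Finset.range s, (blk m (β i) (β i) 1 + blk m (γ i) (γ i) 1) := by
    rw [Finset.mul_sum, transpose_sum]
    refine Finset.sum_congr rfl fun i _ => ?_
    simp only [mul_add, dgl_mul_blk, transpose_add, transpose_smul, blk_transpose, transpose_one]
  rw [one_smul, mul_add, transpose_add, h2, add_left_inj, mul_sub, mul_one, transpose_sub,
    dgl_transpose, sub_left_inj] at key
  exact key

/-- The block (β i, γ i) of the product is the identity, which is nonzero as n > 0. -/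
lemma dgl_eq_of_commute_revProd_swp [IsDomain S] [NeZero n] (h : DisjointPairs m s β γ) {d : ℕ → S}
    (hc : Commute (dgl m n d) (revProd (fun i => swp m (β i) (γ i) (X i)) s)) {i : ℕ} (hi : i < s) :
    d (β i) = d (γ i) := by
  refine eq_of_commute_dgl hc (h.lt_left i hi) (h.lt_right i hi)
    (one_ne_zero : (1 : Matrix (Fin n) (Fin n) S) ≠ 0) ?_
  rw [revProd_swp_eq h, mul_add, add_mul, mul_one, blk_mul_ne (h.ne i hi i hi), zero_add,
    Finset.mul_sum, Finset.sum_mul, Finset.sum_eq_single i]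
  · have := h.ne i hi i hi
    simp [swp, mul_add, add_mul, mul_sub, sub_mul, blk_mul_blk, this, h.lt_left i hi,
      h.lt_right i hi]
  · intro j hj hji
    have hj := Finset.mem_range.1 hj
    have h1 : β i ≠ β j := fun e => hji (h.inj_left i hi j hj e).symm
    rw [mul_sub, mul_one, blk_mul_swp h1 (h.ne i hi j hj), sub_self, zero_mul]
  · intro hi'
    exact absurd (Finset.mem_range.2 hi) hi'

/-- The Fiedler matrix of index `t - m`, for coefficients numbered from the leading one. -/
def shf (m : ℕ) (Y : ℕ → Matrix (Fin n) (Fin n) S) (t : ℕ) :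
    Matrix (Fin m × Fin n) (Fin m × Fin n) S :=
  if t = 0 then dgb m 0 (Y 0) else swp m t (t - 1) (Y t)

/-- The Hankel matrix with zeros above the antidiagonal. -/
def hankel (m : ℕ) (Y : ℕ → Matrix (Fin n) (Fin n) S) (a : ℕ) :
    Matrix (Fin m × Fin n) (Fin m × Fin n) S :=
  ∑ j ∈ Finset.range a, ∑ i ∈ Finset.range a,
    if a ≤ i + j + 1 then blk m i j (Y (i + j + 1 - a)) else 0

variable {Y : ℕ → Matrix (Fin n) (Fin n) S}

/-- The string product is of companion type: coefficients in the block column a, identities below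
the diagonal, and the identity beyond block a. Each further factor pushes the coefficient column one
place to the right and extends the subdiagonal. -/
lemma fwdProd_shf {a : ℕ} (ha : a < m) :
    fwdProd (shf m Y) (a + 1) = ∑ i ∈ Finset.range (a + 1), blk m i a (Y i) +
      ∑ i ∈ Finset.range a, blk m (i + 1) i 1 + (1 - prj S m n (a + 1)) := by
  induction a with
  | zero =>
    simp only [fwdProd, shf, if_true, one_mul, dgb, zero_add, Finset.sum_range_one,
      Finset.sum_range_zero, prj_succ, prj_zero]
    abel
  | succ a ih =>
    have hs : shf m Y (a + 1) = swp m (a + 1) a (Y (a + 1)) := by simp [shf]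
    have ha' : a < m := by omega
    have h1 : (∑ i ∈ Finset.range (a + 1), blk m i a (Y i)) * swp m (a + 1) a (Y (a + 1)) =
        ∑ i ∈ Finset.range (a + 1), blk m i (a + 1) (Y i) := by
      rw [Finset.sum_mul]
      refine Finset.sum_congr rfl fun i _ => ?_
      simp [swp, mul_add, mul_sub, blk_mul_blk, ha']
    have h2 : (∑ i ∈ Finset.range a, blk m (i + 1) i (1 : Matrix (Fin n) (Fin n) S)) *
        swp m (a + 1) a (Y (a + 1)) = ∑ i ∈ Finset.range a, blk m (i + 1) i 1 := by
      rw [Finset.sum_mul]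
      refine Finset.sum_congr rfl fun i hi => ?_
      have := Finset.mem_range.1 hi
      exact blk_mul_swp (by omega) (by omega) _ _
    have h3 : (1 - prj S m n (a + 1)) * swp m (a + 1) a (Y (a + 1)) =
        1 - prj S m n (a + 1) - blk m (a + 1) (a + 1) 1 + blk m (a + 1) (a + 1) (Y (a + 1)) +
          blk m (a + 1) a 1 := by
      simp only [swp, sub_mul, one_mul, mul_add, mul_sub, mul_one, prj_mul_blk, lt_irrefl, if_false,
        Nat.lt_succ_self, if_true]
      abel
    rw [fwdProd, ih ha', hs, add_mul, add_mul, h1, h2, h3, Finset.sum_range_succ _ (a + 1),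
      Finset.sum_range_succ (fun i => blk m (i + 1) i _) a, prj_succ (a + 1)]
    abel

/-- A companion-type matrix acts on the smaller Hankel matrix by shifting its block rows down by
one, and supplies the new last block column. -/
lemma hankel_succ (a : ℕ) (ha : a ≤ m) :
    hankel m Y (a + 1) = ∑ i ∈ Finset.range (a + 1), blk m i a (Y i) +
      (∑ i ∈ Finset.range a, blk m (i + 1) i 1) * hankel m Y a := by
  have h1 : ∀ i j, i < a → (∑ k ∈ Finset.range a, blk m (k + 1) k 1) *
      (if a ≤ i + j + 1 then blk m i j (Y (i + j + 1 - a)) else 0) =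
      if a ≤ i + j + 1 then blk m (i + 1) j (Y (i + j + 1 - a)) else 0 := by
    intro i j hi
    split_ifs
    · rw [Finset.sum_mul, Finset.sum_eq_single i]
      · rw [blk_mul_same (by omega), Matrix.one_mul]
      · exact fun k _ hk => blk_mul_ne hk _ _
      · exact fun h => absurd (Finset.mem_range.2 hi) h
    · exact mul_zero _
  rw [hankel, hankel, Finset.sum_range_succ, add_comm, Finset.mul_sum]
  congr 1
  · refine Finset.sum_congr rfl fun i _ => ?_
    rw [if_pos (by omega)]
    congr 2
    omega
  · refine Finset.sum_congr rfl fun j hj => ?_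
    have hj := Finset.mem_range.1 hj
    rw [Finset.sum_range_succ', if_neg (by omega), add_zero, Finset.mul_sum]
    refine Finset.sum_congr rfl fun i hi => ?_
    have hi := Finset.mem_range.1 hi
    rw [h1 i j hi]
    by_cases h : a ≤ i + j + 1
    · rw [if_pos h, if_pos (by omega)]
      congr 2
      omega
    · rw [if_neg h, if_neg (by omega)]

lemma blk_mul_hankel {a b c : ℕ} (h : a ≤ c) (X : Matrix (Fin n) (Fin n) S) :
    blk m b c X * hankel m Y a = 0 := by
  rw [hankel, Finset.mul_sum]
  refine Finset.sum_eq_zero fun j _ => ?_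
  rw [Finset.mul_sum]
  refine Finset.sum_eq_zero fun i hi => ?_
  have hi := Finset.mem_range.1 hi
  split_ifs
  · exact blk_mul_ne (by omega) _ _
  · exact mul_zero _

lemma prj_mul_hankel {a b : ℕ} (h : a ≤ b) : prj S m n b * hankel m Y a = hankel m Y a := by
  rw [hankel, Finset.mul_sum]
  refine Finset.sum_congr rfl fun j _ => ?_
  rw [Finset.mul_sum]
  refine Finset.sum_congr rfl fun i hi => ?_
  have hi := Finset.mem_range.1 hi
  split_ifs
  · rw [prj_mul_blk, if_pos (by omega)]
  · exact mul_zero _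

lemma prj_mul_prj (a b : ℕ) : prj S m n a * prj S m n b = prj S m n (min a b) := by
  simp only [prj, diagonal_mul_diagonal]
  congr 1
  ext p
  by_cases h1 : (p.1 : ℕ) < a <;> by_cases h2 : (p.1 : ℕ) < b <;> simp [h1, h2]

/-- The product `C_{a-1} ⋯ C_1 C_0` of the string products `C_b = M_{0:b}` is a Hankel matrix. -/
lemma revProd_fwdProd_shf {a : ℕ} (ha : a ≤ m) :
    revProd (fun b => fwdProd (shf m Y) (b + 1)) a = hankel m Y a + (1 - prj S m n a) := by
  induction a with
  | zero => simp [revProd, hankel, prj_zero]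
  | succ a ih =>
    rw [revProd, ih (by omega), fwdProd_shf (by omega), hankel_succ _ (by omega)]
    have h1 : (∑ i ∈ Finset.range (a + 1), blk m i a (Y i)) * hankel m Y a = 0 := by
      rw [Finset.sum_mul]
      exact Finset.sum_eq_zero fun i _ => blk_mul_hankel le_rfl _
    have h2 : (∑ i ∈ Finset.range (a + 1), blk m i a (Y i)) * prj S m n a = 0 := by
      rw [Finset.sum_mul]
      exact Finset.sum_eq_zero fun i _ => by rw [blk_mul_prj, if_neg (lt_irrefl a)]
    have h3 : (∑ i ∈ Finset.range a, blk m (i + 1) i (1 : Matrix (Fin n) (Fin n) S)) *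
        prj S m n a = ∑ i ∈ Finset.range a, blk m (i + 1) i 1 := by
      rw [Finset.sum_mul]
      exact Finset.sum_congr rfl fun i hi => by
        rw [blk_mul_prj, if_pos (Finset.mem_range.1 hi)]
    simp only [add_mul, mul_add, mul_sub, sub_mul, one_mul, mul_one, h1, h2, h3,
      prj_mul_hankel (Nat.le_succ a), prj_mul_prj, min_eq_right (Nat.le_succ a)]
    abel

/-- The blocks (i, j) and (j, i) of a Hankel matrix coincide, so only the signs and the parity of
the coefficient need to be compared. -/
lemma symmetric_dgl_mul_hankel {a : ℕ} {d : ℕ → S} {σ : S}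
    (hY : ∀ i < a, ∀ j < a, a ≤ i + j + 1 →
      d i • (Y (i + j + 1 - a))ᵀ = (σ * d j) • Y (i + j + 1 - a)) :
    (dgl m n d * hankel m Y a)ᵀ = σ • (dgl m n d * hankel m Y a) := by
  rw [hankel, Finset.mul_sum, transpose_sum, Finset.smul_sum, ← Finset.sum_congr rfl fun j _ => by
    rw [Finset.mul_sum, transpose_sum], Finset.sum_comm]
  refine Finset.sum_congr rfl fun j hj => ?_
  rw [Finset.mul_sum, Finset.smul_sum]
  refine Finset.sum_congr rfl fun i hi => ?_
  have hi := Finset.mem_range.1 hi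
  have hj := Finset.mem_range.1 hj
  by_cases h : a ≤ i + j + 1
  · rw [if_pos h, if_pos (by omega), dgl_mul_blk, dgl_mul_blk, transpose_smul, blk_transpose,
      ← blk_smul, ← blk_smul, ← blk_smul, smul_smul, add_comm i j, hY j hj i hi (by omega)]
  · rw [if_neg h, if_neg (by omega)]
    simp

/-- The antidiagonal i + j + 1 = a carries the block Y 0, in the application the leading coefficient
A_m; no invertibility is required of it. -/
lemma dgl_eq_of_commute_hankel [IsDomain S] {a : ℕ} (ha : a ≤ m) {d : ℕ → S}
    (hY : Y 0 ≠ 0) (hc : Commute (dgl m n d) (hankel m Y a + (1 - prj S m n a))) {i j : ℕ}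
    (hij : i + j + 1 = a) : d i = d j := by
  refine eq_of_commute_dgl hc (by omega) (by omega) hY ?_
  have h1 : blk m i i 1 * (1 - prj S m n a) = 0 := by
    rw [mul_sub, mul_one, blk_mul_prj, if_pos (by omega), sub_self]
  rw [mul_add, h1, add_zero, hankel, Finset.mul_sum, Finset.sum_mul, Finset.sum_eq_single j]
  · rw [Finset.mul_sum, Finset.sum_mul, Finset.sum_eq_single i]
    · rw [if_pos (by omega), blk_mul_same (by omega), blk_mul_same (by omega), Matrix.one_mul,
        Matrix.mul_one, hij, Nat.sub_self]
    · intro k _ hk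
      split_ifs
      · rw [blk_mul_ne hk.symm, zero_mul]
      · simp
    · exact fun h => absurd (Finset.mem_range.2 (by omega)) h
  · intro k _ hk
    rw [Finset.mul_sum, Finset.sum_mul]
    refine Finset.sum_eq_zero fun l _ => ?_
    split_ifs
    · rw [mul_assoc, blk_mul_ne hk, mul_zero]
    · simp
  · exact fun h => absurd (Finset.mem_range.2 (by omega)) h

end Structured

/-! ### Factors supported on initial and final segments of blocks. -/

section Supports

variable {S : Type*} [CommRing S] {m n : ℕ}

/-- `A` is the identity outside the first `t` blocks. -/
structure ActsBelow (t : ℕ) (A : Matrix (Fin m × Fin n) (Fin m × Fin n) S) : Prop where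
  left : (1 - prj S m n t) * A = 1 - prj S m n t
  right : A * (1 - prj S m n t) = 1 - prj S m n t

/-- `A` is the identity on the first `t` blocks. -/
structure ActsAbove (t : ℕ) (A : Matrix (Fin m × Fin n) (Fin m × Fin n) S) : Prop where
  left : prj S m n t * A = prj S m n t
  right : A * prj S m n t = prj S m n t

variable {t : ℕ} {A B : Matrix (Fin m × Fin n) (Fin m × Fin n) S}

lemma ActsBelow.one : ActsBelow t (1 : Matrix (Fin m × Fin n) (Fin m × Fin n) S) :=
  ⟨mul_one _, one_mul _⟩

lemma ActsAbove.one : ActsAbove t (1 : Matrix (Fin m × Fin n) (Fin m × Fin n) S) :=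
  ⟨mul_one _, one_mul _⟩

lemma ActsBelow.mul (hA : ActsBelow t A) (hB : ActsBelow t B) : ActsBelow t (A * B) :=
  ⟨by rw [← mul_assoc, hA.left, hB.left], by rw [mul_assoc, hB.right, hA.right]⟩

lemma ActsAbove.mul (hA : ActsAbove t A) (hB : ActsAbove t B) : ActsAbove t (A * B) :=
  ⟨by rw [← mul_assoc, hA.left, hB.left], by rw [mul_assoc, hB.right, hA.right]⟩

lemma ActsBelow.revProd {f : ℕ → Matrix (Fin m × Fin n) (Fin m × Fin n) S} {s : ℕ}
    (h : ∀ i < s, ActsBelow t (f i)) : ActsBelow t (revProd f s) := by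
  induction s with
  | zero => exact ActsBelow.one
  | succ s ih => exact (h s (by omega)).mul (ih fun i hi => h i (by omega))

lemma ActsAbove.revProd {f : ℕ → Matrix (Fin m × Fin n) (Fin m × Fin n) S} {s : ℕ}
    (h : ∀ i < s, ActsAbove t (f i)) : ActsAbove t (revProd f s) := by
  induction s with
  | zero => exact ActsAbove.one
  | succ s ih => exact (h s (by omega)).mul (ih fun i hi => h i (by omega))

lemma ActsBelow.fwdProd {f : ℕ → Matrix (Fin m × Fin n) (Fin m × Fin n) S} {s : ℕ}
    (h : ∀ i < s, ActsBelow t (f i)) : ActsBelow t (fwdProd f s) := by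
  induction s with
  | zero => exact ActsBelow.one
  | succ s ih => exact (ih fun i hi => h i (by omega)).mul (h s (by omega))

lemma ActsBelow.swp {a b : ℕ} (ha : a < t) (hb : b < t) (X : Matrix (Fin n) (Fin n) S) :
    ActsBelow t (swp m a b X) := by
  constructor
  · rw [_root_.swp, sub_mul]
    simp only [mul_add, mul_sub, mul_one, one_mul, prj_mul_blk, ha, hb, if_true]
    abel
  · rw [_root_.swp, mul_sub]
    simp only [add_mul, sub_mul, mul_one, one_mul, blk_mul_prj, ha, hb, if_true]
    abel

lemma ActsAbove.swp {a b : ℕ} (ha : t ≤ a) (hb : t ≤ b) (X : Matrix (Fin n) (Fin n) S) :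
    ActsAbove t (swp m a b X) := by
  constructor
  · rw [_root_.swp]
    simp only [mul_add, mul_sub, mul_one, prj_mul_blk, ha.not_gt, hb.not_gt, if_false]
    abel
  · rw [_root_.swp]
    simp only [add_mul, sub_mul, one_mul, blk_mul_prj, ha.not_gt, hb.not_gt, if_false]
    abel

lemma ActsBelow.dgb {a : ℕ} (ha : a < t) (X : Matrix (Fin n) (Fin n) S) :
    ActsBelow t (dgb m a X) := by
  constructor
  · rw [_root_.dgb, sub_mul]
    simp only [mul_add, mul_sub, mul_one, one_mul, prj_mul_blk, ha, if_true]
    abel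
  · rw [_root_.dgb, mul_sub]
    simp only [add_mul, sub_mul, mul_one, one_mul, blk_mul_prj, ha, if_true]
    abel

lemma ActsAbove.dgb {a : ℕ} (ha : t ≤ a) (X : Matrix (Fin n) (Fin n) S) :
    ActsAbove t (dgb m a X) := by
  constructor
  · rw [_root_.dgb]
    simp only [mul_add, mul_sub, mul_one, prj_mul_blk, ha.not_gt, if_false]
    abel
  · rw [_root_.dgb]
    simp only [add_mul, sub_mul, one_mul, blk_mul_prj, ha.not_gt, if_false]
    abel

lemma ActsBelow.shf {Y : ℕ → Matrix (Fin n) (Fin n) S} {i : ℕ} (hi : i < t) :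
    ActsBelow t (shf m Y i) := by
  rw [_root_.shf]
  split_ifs with h
  · exact ActsBelow.dgb (by omega) _
  · exact ActsBelow.swp hi (by omega) _

/-- The deviations A - 1 and B - 1 live on complementary blocks, so their product vanishes. The same
holds in the other order, which makes A and B commute. -/
lemma ActsAbove.mul_eq (hA : ActsAbove t A) (hB : ActsBelow t B) : A * B = A + B - 1 := by
  have h : (A - 1) * (B - 1) = 0 := by
    calc (A - 1) * (B - 1) = (A - 1) * prj S m n t * (B - 1) +
          (A - 1) * ((1 - prj S m n t) * (B - 1)) := by noncomm_ring
      _ = 0 := by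
        rw [sub_mul, one_mul, hA.right, mul_sub (1 - _), mul_one, hB.left]
        simp
  have h' : A * B - A - B + 1 = 0 := by rw [← h]; noncomm_ring
  rw [← sub_eq_zero, ← h']
  abel

lemma ActsBelow.mul_eq (hB : ActsBelow t B) (hA : ActsAbove t A) : B * A = A + B - 1 := by
  have h : (B - 1) * (A - 1) = 0 := by
    calc (B - 1) * (A - 1) = (B - 1) * (prj S m n t * (A - 1)) +
          (B - 1) * (1 - prj S m n t) * (A - 1) := by noncomm_ring
      _ = 0 := by
        rw [mul_sub (prj S m n t), mul_one, hA.left, sub_mul B 1 (1 - prj S m n t), one_mul, hB.right]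
        simp
  have h' : B * A - A - B + 1 = 0 := by rw [← h]; noncomm_ring
  rw [← sub_eq_zero, ← h']
  abel

lemma ActsAbove.commute (hA : ActsAbove t A) (hB : ActsBelow t B) : Commute A B := by
  rw [Commute, SemiconjBy, hA.mul_eq hB, hB.mul_eq hA]

lemma commute_dgl_prj (d : ℕ → S) : Commute (dgl m n d) (prj S m n t) := by
  simp only [Commute, SemiconjBy, dgl, prj, diagonal_mul_diagonal, mul_comm]

/-- Each factor is recovered from the product by means of the projection onto the first t blocks,
which commutes with every block diagonal matrix of scalar blocks. Hence A and B need not be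
invertible, as they may contain A_0 or A_m. -/
lemma commute_dgl_of_mul {d : ℕ → S} (hA : ActsAbove t A) (hB : ActsBelow t B)
    (h : Commute (dgl m n d) (A * B)) : Commute (dgl m n d) A ∧ Commute (dgl m n d) B := by
  have hp : Commute (dgl m n d) (prj S m n t) := commute_dgl_prj d
  have hq : Commute (dgl m n d) (1 - prj S m n t) := (Commute.one_right _).sub_right hp
  have h1 : A = A * B * (1 - prj S m n t) + prj S m n t := by
    rw [mul_assoc, hB.right, mul_sub, mul_one, hA.right, sub_add_cancel]
  have h2 : B = A * B * prj S m n t + (1 - prj S m n t) := by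
    rw [hA.mul_eq hB, ← hB.right, sub_mul, add_mul, hA.right, one_mul]
    noncomm_ring
  constructor
  · rw [h1]; exact (h.mul_right hq).add_right hp
  · rw [h2]; exact (h.mul_right hp).add_right hq

lemma Commute.of_mul_mul {M : Type*} [Monoid M] {d x y : M} (hx : IsUnit x) (hd : Commute d x)
    (h : Commute d (x * y * x)) : Commute d y := by
  obtain ⟨u, rfl⟩ := hx
  have h1 : Commute d (↑u⁻¹ : M) := Commute.units_inv_right hd
  have : y = ↑u⁻¹ * (↑u * y * ↑u) * ↑u⁻¹ := by simp [mul_assoc]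
  rw [this]
  exact (h1.mul_right h).mul_right h1

end Supports

/-! ### The Fiedler matrices in the block calculus. -/

section FiedlerMatrices

variable {m n : ℕ}

lemma one_apply_block {S : Type*} [CommRing S] (p q : Fin m × Fin n) :
    (1 : Matrix (Fin m × Fin n) (Fin m × Fin n) S) p q =
      (if (p.1 : ℕ) = q.1 then 1 else 0 : Matrix (Fin n) (Fin n) S) p.2 q.2 := by
  by_cases h : (p.1 : ℕ) = q.1
  · simp [one_apply, Prod.ext_iff, Fin.ext_iff, h]
  · simp [one_apply, Prod.ext_iff, Fin.ext_iff, h]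

lemma swp_apply {S : Type*} [CommRing S] {a b : ℕ} (hab : a ≠ b) (X : Matrix (Fin n) (Fin n) S)
    (p q : Fin m × Fin n) : swp m a b X p q =
      (if (p.1 : ℕ) = a ∧ (q.1 : ℕ) = a then X else if (p.1 : ℕ) = b ∧ (q.1 : ℕ) = b then 0
        else if ((p.1 : ℕ) = a ∧ (q.1 : ℕ) = b) ∨ ((p.1 : ℕ) = b ∧ (q.1 : ℕ) = a) then 1
        else if (p.1 : ℕ) = q.1 then 1 else 0 : Matrix (Fin n) (Fin n) S) p.2 q.2 := by
  simp only [swp, Matrix.add_apply, Matrix.sub_apply, one_apply_block, blk, of_apply]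
  by_cases h1 : (p.1 : ℕ) = a <;> by_cases h2 : (p.1 : ℕ) = b <;>
    by_cases h3 : (q.1 : ℕ) = a <;> by_cases h4 : (q.1 : ℕ) = b <;>
    simp_all

lemma dgb_apply {S : Type*} [CommRing S] (a : ℕ) (X : Matrix (Fin n) (Fin n) S)
    (p q : Fin m × Fin n) : dgb m a X p q =
      (if (p.1 : ℕ) = a ∧ (q.1 : ℕ) = a then X
        else if (p.1 : ℕ) = q.1 then 1 else 0 : Matrix (Fin n) (Fin n) S) p.2 q.2 := by
  simp only [dgb, Matrix.add_apply, Matrix.sub_apply, one_apply_block, blk, of_apply]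
  by_cases h1 : (p.1 : ℕ) = a <;> by_cases h3 : (q.1 : ℕ) = a <;> simp_all

/-- The rows m - k and m - k + 1 of the definition are the blocks m - 1 - k and m - k when counted
from 0. For the index -k the coefficient sits in the second of these blocks, which reverses the
arguments of `swp`. -/
lemma fiedlerP_natCast (P : Matrix (Fin n) (Fin n) ℂ[X]) {k : ℕ} (hk : k ≠ 0) (hkm : k < m) :
    fiedlerP m P k = swp m (m - 1 - k) (m - k) (-coeffMat P k) := by
  ext p q
  rw [swp_apply (by omega), fiedlerP, if_pos (by positivity), elemMat, of_apply, elemBlock,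
    if_neg (by omega), if_neg (by omega), abs_of_nonneg (by positivity), Int.natAbs_natCast]
  split_ifs <;> first | rfl | (exfalso; omega)

lemma fiedlerP_zero (P : Matrix (Fin n) (Fin n) ℂ[X]) (hm : 0 < m) :
    fiedlerP m P 0 = dgb m (m - 1) (-coeffMat P 0) := by
  ext p q
  rw [dgb_apply, fiedlerP, if_pos le_rfl, elemMat, of_apply, elemBlock, if_pos rfl, Int.natAbs_zero]
  split_ifs <;> first | rfl | (exfalso; omega)

lemma fiedlerP_sub (P : Matrix (Fin n) (Fin n) ℂ[X]) {t : ℕ} (ht : t < m) :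
    fiedlerP m P ((t : ℤ) - m) = shf m (fun t => coeffMat P (m - t)) t := by
  have hab : ((t : ℤ) - m).natAbs = m - t := by omega
  have hab' : |((t : ℤ) - m)| = m - t := by rw [abs_of_nonpos (by omega)]; ring
  rw [shf, fiedlerP, if_neg (by omega), hab]
  split_ifs with h
  · subst h
    ext p q
    rw [dgb_apply, elemMat, of_apply, elemBlock, if_neg (by omega), if_pos (by simp)]
    split_ifs <;> first | rfl | (exfalso; omega)
  · ext p q
    rw [swp_apply (by omega), elemMat, of_apply, elemBlock, if_neg (by omega), if_neg (by omega),
      hab']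
    split_ifs <;> first | rfl | (exfalso; omega)

end FiedlerMatrices

/-! ### The odd, even and string factors, with their supports and invertibility. -/

section Factors

variable {S : Type*} [CommRing S] {m n : ℕ}

/-- The product `M_{2s-1} ⋯ M_3 M_1` of Fiedler matrices. -/
def oddLow (m : ℕ) (A : ℕ → Matrix (Fin n) (Fin n) S) (s : ℕ) :
    Matrix (Fin m × Fin n) (Fin m × Fin n) S :=
  revProd (fun i => swp m (m - 2 - 2 * i) (m - 1 - 2 * i) (-A (2 * i + 1))) s

/-- The product `M_{2s} ⋯ M_4 M_2` of Fiedler matrices. -/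
def evenLow (m : ℕ) (A : ℕ → Matrix (Fin n) (Fin n) S) (s : ℕ) :
    Matrix (Fin m × Fin n) (Fin m × Fin n) S :=
  revProd (fun i => swp m (m - 3 - 2 * i) (m - 2 - 2 * i) (-A (2 * i + 2))) s

/-- The product of the Fiedler matrices of the indices `p + 2 i + 1 - m`, `i < s`. -/
def oddHigh (m : ℕ) (A : ℕ → Matrix (Fin n) (Fin n) S) (p s : ℕ) :
    Matrix (Fin m × Fin n) (Fin m × Fin n) S :=
  revProd (fun i => swp m (p + 2 * i + 1) (p + 2 * i) (A (m - (p + 2 * i + 1)))) s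

/-- The product of the Fiedler matrices of the indices `p + 2 i + 2 - m`, `i < s`. -/
def evenHigh (m : ℕ) (A : ℕ → Matrix (Fin n) (Fin n) S) (p s : ℕ) :
    Matrix (Fin m × Fin n) (Fin m × Fin n) S :=
  revProd (fun i => swp m (p + 2 * i + 2) (p + 2 * i + 1) (A (m - (p + 2 * i + 2)))) s

/-- The product of the Fiedler matrices of the indices `-m, …, a - 1 - m`. -/
def strHigh (m : ℕ) (A : ℕ → Matrix (Fin n) (Fin n) S) (a : ℕ) :
    Matrix (Fin m × Fin n) (Fin m × Fin n) S :=
  fwdProd (shf m fun t => A (m - t)) a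

/-- The product `C_a ⋯ C_2 C_1` of the string products `C_b` of the indices `-m, …, b - 1 - m`. -/
def symHigh (m : ℕ) (A : ℕ → Matrix (Fin n) (Fin n) S) (a : ℕ) :
    Matrix (Fin m × Fin n) (Fin m × Fin n) S :=
  revProd (fun b => strHigh m A (b + 1)) a

variable (A : ℕ → Matrix (Fin n) (Fin n) S) {s s' p t : ℕ}

lemma disjointPairs_oddLow (h : 2 * s < m) :
    DisjointPairs m s (fun i => m - 2 - 2 * i) (fun i => m - 1 - 2 * i) := by
  constructor <;> intros <;> omega

lemma disjointPairs_evenLow (h : 2 * s < m) :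
    DisjointPairs m s (fun i => m - 3 - 2 * i) (fun i => m - 2 - 2 * i) := by
  constructor <;> intros <;> omega

lemma disjointPairs_oddHigh (h : p + 2 * s < m) :
    DisjointPairs m s (fun i => p + 2 * i + 1) (fun i => p + 2 * i) := by
  constructor <;> intros <;> omega

lemma disjointPairs_evenHigh (h : p + 2 * s < m) :
    DisjointPairs m s (fun i => p + 2 * i + 2) (fun i => p + 2 * i + 1) := by
  constructor <;> intros <;> omega

lemma actsAbove_oddLow (h : t + 2 * s ≤ m) : ActsAbove t (oddLow m A s) :=
  ActsAbove.revProd fun i hi => ActsAbove.swp (by omega) (by omega) _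

lemma actsAbove_evenLow (h : t + 2 * s + 1 ≤ m) : ActsAbove t (evenLow m A s) :=
  ActsAbove.revProd fun i hi => ActsAbove.swp (by omega) (by omega) _

lemma actsBelow_evenLow (hm : 0 < m) (h : 2 * s < m) : ActsBelow (m - 1) (evenLow m A s) :=
  ActsBelow.revProd fun i hi => ActsBelow.swp (by omega) (by omega) _

lemma actsAbove_oddHigh : ActsAbove p (oddHigh m A p s) :=
  ActsAbove.revProd fun i hi => ActsAbove.swp (by omega) (by omega) _

lemma actsBelow_oddHigh (h : p + 2 * s ≤ t) : ActsBelow t (oddHigh m A p s) :=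
  ActsBelow.revProd fun i hi => ActsBelow.swp (by omega) (by omega) _

lemma actsAbove_evenHigh : ActsAbove (p + 1) (evenHigh m A p s) :=
  ActsAbove.revProd fun i hi => ActsAbove.swp (by omega) (by omega) _

lemma actsBelow_evenHigh (h : p + 2 * s + 1 ≤ t) : ActsBelow t (evenHigh m A p s) :=
  ActsBelow.revProd fun i hi => ActsBelow.swp (by omega) (by omega) _

lemma actsBelow_strHigh (h : p ≤ t) : ActsBelow t (strHigh m A p) :=
  ActsBelow.fwdProd fun i hi => ActsBelow.shf (by omega)

lemma actsBelow_symHigh (h : p ≤ t) : ActsBelow t (symHigh m A p) :=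
  ActsBelow.revProd fun i hi => actsBelow_strHigh A (by omega)

lemma isUnit_oddLow (h : 2 * s < m) : IsUnit (oddLow m A s) :=
  isUnit_revProd fun i hi => isUnit_swp (by omega) (by omega) (by omega) _

lemma isUnit_oddHigh (h : p + 2 * s < m) : IsUnit (oddHigh m A p s) :=
  isUnit_revProd fun i hi => isUnit_swp (by omega) (by omega) (by omega) _

lemma isUnit_dgb {a : ℕ} (ha : a < m) {X : Matrix (Fin n) (Fin n) S} (hX : IsUnit X) :
    IsUnit (dgb m a X) := by
  obtain ⟨u, rfl⟩ := hX
  have h : (u : Matrix (Fin n) (Fin n) S) * (↑u⁻¹ : Matrix (Fin n) (Fin n) S) = 1 := u.mul_inv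
  refine IsUnit.of_mul_eq_one (dgb m a (↑u⁻¹ : Matrix (Fin n) (Fin n) S)) ?_
  simp only [dgb, mul_add, add_mul, mul_sub, sub_mul, one_mul, mul_one, blk_mul_same ha]
  rw [h]
  abel

/-- The only factor that can be singular is M_{-m}, and it is absent for p = 0. This is where the
hypothesis of the linearization statement enters. -/
lemma isUnit_symHigh (hp : p < m) (hA : IsUnit (A m) ∨ p = 0) : IsUnit (symHigh m A p) := by
  refine isUnit_revProd fun b hb => isUnit_fwdProd fun i hi => ?_
  rw [shf]
  split_ifs with h
  · exact isUnit_dgb (by omega) (hA.resolve_right (by omega))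
  · exact isUnit_swp (by omega) (by omega) (by omega) _

lemma symHigh_eq_hankel (hp : p ≤ m) :
    symHigh m A p = hankel m (fun t => A (m - t)) p + (1 - prj S m n p) :=
  revProd_fwdProd_shf hp

end Factors

/-! ### Fiedler products over the tuples w, z and their symmetric complements. -/

section Products

variable {m n : ℕ} (P : Matrix (Fin n) (Fin n) ℂ[X]) {s p : ℕ}

lemma prod_map_admissible {M : Type*} [Monoid M] (F : ℤ → M) (p s : ℕ) :
    ((((do let a ← (List.range s).reverse; pure (a : ℤ)).flatMap fun i =>
      [(p : ℤ) + 2 * i + 1, (p : ℤ) + 2 * i + 2]) ++ stringZero p).map F).prod =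
    revProd (fun i : ℕ => F ((p : ℤ) + 2 * i + 1) * F ((p : ℤ) + 2 * i + 2)) s *
      fwdProd (fun i : ℕ => F i) (p + 1) := by
  rw [List.map_append, List.prod_append, prod_map_stringZero, bind_pure_natCast, List.flatMap_map,
    ← revProd_eq_prod]
  congr 1
  exact prod_map_flatMap_pair F _ _ _

lemma fiedlerP_odd {i : ℕ} (h : 2 * i + 1 < m) : fiedlerP m P (((0 : ℕ) : ℤ) + 2 * i + 1) =
    swp m (m - 2 - 2 * i) (m - 1 - 2 * i) (-coeffMat P (2 * i + 1)) := by
  have : ((0 : ℕ) : ℤ) + 2 * i + 1 = ((2 * i + 1 : ℕ) : ℤ) := by push_cast; ring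
  rw [this, fiedlerP_natCast P (by omega) h]
  congr 1 <;> omega

lemma fiedlerP_even {i : ℕ} (h : 2 * i + 2 < m) : fiedlerP m P (((0 : ℕ) : ℤ) + 2 * i + 2) =
    swp m (m - 3 - 2 * i) (m - 2 - 2 * i) (-coeffMat P (2 * i + 2)) := by
  have : ((0 : ℕ) : ℤ) + 2 * i + 2 = ((2 * i + 2 : ℕ) : ℤ) := by push_cast; ring
  rw [this, fiedlerP_natCast P (by omega) h]
  congr 1 <;> omega

lemma fiedlerP_oddHigh {i : ℕ} (h : p + 2 * i + 1 < m) :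
    fiedlerP m P ((p : ℤ) + 2 * i + 1 - m) =
      swp m (p + 2 * i + 1) (p + 2 * i) (coeffMat P (m - (p + 2 * i + 1))) := by
  have : (p : ℤ) + 2 * i + 1 - m = ((p + 2 * i + 1 : ℕ) : ℤ) - m := by push_cast; ring
  rw [this, fiedlerP_sub P h, shf, if_neg (by omega)]
  rfl

lemma fiedlerP_evenHigh {i : ℕ} (h : p + 2 * i + 2 < m) :
    fiedlerP m P ((p : ℤ) + 2 * i + 2 - m) =
      swp m (p + 2 * i + 2) (p + 2 * i + 1) (coeffMat P (m - (p + 2 * i + 2))) := by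
  have : (p : ℤ) + 2 * i + 2 - m = ((p + 2 * i + 2 : ℕ) : ℤ) - m := by push_cast; ring
  rw [this, fiedlerP_sub P h, shf, if_neg (by omega)]
  rfl

lemma revProd_pairs_low (h : 2 * s < m) :
    revProd (fun i : ℕ => fiedlerP m P (((0 : ℕ) : ℤ) + 2 * i + 1) *
      fiedlerP m P (((0 : ℕ) : ℤ) + 2 * i + 2)) s =
      oddLow m (coeffMat P) s * evenLow m (coeffMat P) s := by
  rw [oddLow, evenLow, ← revProd_mul]
  · exact revProd_congr fun i hi => by rw [fiedlerP_odd P (by omega), fiedlerP_even P (by omega)]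
  · intro i hi j hj
    exact swp_commute_swp (by omega) (by omega) (by omega) (by omega) _ _

lemma prod_w (h : 2 * s < m) {w : List ℤ} (hw : IsAdmissible (2 * s) 0 w) :
    (w.map (fiedlerP m P)).prod = oddLow m (coeffMat P) s * evenLow m (coeffMat P) s *
      dgb m (m - 1) (-coeffMat P 0) := by
  rw [hw.2.2, Nat.sub_zero, Nat.mul_div_cancel_left _ two_pos, prod_map_admissible,
    revProd_pairs_low P h]
  simp [fwdProd, fiedlerP_zero P (by omega : 0 < m)]

lemma prod_cw (h : 2 * s < m) :
    ((symmetricComplement (2 * s) 0).map (fiedlerP m P)).prod = oddLow m (coeffMat P) s := by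
  rw [prod_map_symmetricComplement, Nat.sub_zero, Nat.mul_div_cancel_left _ two_pos, revProd,
    mul_one, oddLow]
  exact revProd_congr fun i hi => fiedlerP_odd P (by omega)

lemma eq_map_sub_of_map_add {z l : List ℤ} {c : ℤ} (h : (z.map fun t => t + c) = l) :
    z = l.map fun t => t - c := by
  rw [← h, List.map_map]
  conv_lhs => rw [← List.map_id z]
  exact List.map_congr_left fun t _ => by simp

lemma revProd_pairs_high (h : p + 2 * s < m) :
    revProd (fun i : ℕ => fiedlerP m P ((p : ℤ) + 2 * i + 1 - m) *
      fiedlerP m P ((p : ℤ) + 2 * i + 2 - m)) s =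
      oddHigh m (coeffMat P) p s * evenHigh m (coeffMat P) p s := by
  rw [oddHigh, evenHigh, ← revProd_mul]
  · exact revProd_congr fun i hi => by
      rw [fiedlerP_oddHigh P (by omega), fiedlerP_evenHigh P (by omega)]
  · intro i hi j hj
    exact swp_commute_swp (by omega) (by omega) (by omega) (by omega) _ _

lemma fwdProd_fiedlerP_sub {a : ℕ} (h : a ≤ m) :
    fwdProd (fun i : ℕ => fiedlerP m P ((i : ℤ) - m)) a = strHigh m (coeffMat P) a :=
  fwdProd_congr fun _ hi => fiedlerP_sub P (by omega)

lemma prod_z (h : p + 2 * s < m) {z : List ℤ}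
    (hz : IsAdmissible (p + 2 * s) p (z.map fun t => t + (m : ℤ))) :
    (z.map (fiedlerP m P)).prod = oddHigh m (coeffMat P) p s * evenHigh m (coeffMat P) p s *
      strHigh m (coeffMat P) (p + 1) := by
  rw [eq_map_sub_of_map_add hz.2.2, List.map_map, prod_map_admissible, Nat.add_sub_cancel_left,
    Nat.mul_div_cancel_left _ two_pos]
  simp only [Function.comp_apply]
  rw [revProd_pairs_high P h, fwdProd_fiedlerP_sub P (by omega)]

lemma prod_cz (h : p + 2 * s < m) {cz : List ℤ}
    (hcz : (cz.map fun t => t + (m : ℤ)) = symmetricComplement (p + 2 * s) p) :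
    (cz.map (fiedlerP m P)).prod = oddHigh m (coeffMat P) p s * symHigh m (coeffMat P) p := by
  rw [eq_map_sub_of_map_add hcz, List.map_map, prod_map_symmetricComplement,
    Nat.add_sub_cancel_left, Nat.mul_div_cancel_left _ two_pos, oddHigh, symHigh]
  simp only [Function.comp_apply]
  congr 1
  · exact revProd_congr fun i hi => fiedlerP_oddHigh P (by omega)
  · exact revProd_congr fun i hi => fwdProd_fiedlerP_sub P (by omega)

end Products

/-! ### Symmetry of the coefficients and the signs that produce it. -/

section SymmetricPencil

variable {S : Type*} [CommRing S] {m n : ℕ}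

/-- The leading coefficient `M_z M_{c_w} M_{c_z}`. -/
def leadCoeff (m : ℕ) (A : ℕ → Matrix (Fin n) (Fin n) S) (p s' s : ℕ) :
    Matrix (Fin m × Fin n) (Fin m × Fin n) S :=
  oddHigh m A p s' * evenHigh m A p s' * strHigh m A (p + 1) * oddLow m A s *
    (oddHigh m A p s' * symHigh m A p)

/-- The constant coefficient `M_w M_{c_w} M_{c_z}`. -/
def constCoeff (m : ℕ) (A : ℕ → Matrix (Fin n) (Fin n) S) (p s' s : ℕ) :
    Matrix (Fin m × Fin n) (Fin m × Fin n) S :=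
  oddLow m A s * evenLow m A s * dgb m (m - 1) (-A 0) * oddLow m A s *
    (oddHigh m A p s' * symHigh m A p)

variable {A : ℕ → Matrix (Fin n) (Fin n) S} {p s' s : ℕ}

lemma actsAbove_trail (hm : p + 2 * s' + 2 * s + 1 = m) :
    ActsAbove (p + 2 * s') (evenLow m A s * dgb m (m - 1) (-A 0)) :=
  (actsAbove_evenLow A (by omega)).mul (ActsAbove.dgb (by omega) _)

/-- `oddLow` and the high factors act on complementary blocks, and `symHigh` commutes with
`oddHigh`; moving these apart lets the string of z complete `symHigh m A p` to `symHigh m A (p +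
1)`. -/
lemma leadCoeff_eq' (hm : p + 2 * s' + 2 * s + 1 = m) :
    leadCoeff m A p s' s = oddLow m A s *
      (oddHigh m A p s' * (evenHigh m A p s' * symHigh m A (p + 1)) * oddHigh m A p s') := by
  have h1 : Commute (oddLow m A s) (oddHigh m A p s' * evenHigh m A p s' * strHigh m A (p + 1)) :=
    (actsAbove_oddLow A (t := p + 2 * s' + 1) (by omega)).commute
      (((actsBelow_oddHigh A (by omega)).mul (actsBelow_evenHigh A (by omega))).mul
        (actsBelow_strHigh A (by omega)))
  have h2 : Commute (oddHigh m A p s') (symHigh m A p) :=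
    (actsAbove_oddHigh A).commute (actsBelow_symHigh A le_rfl)
  have h3 : symHigh m A (p + 1) = strHigh m A (p + 1) * symHigh m A p := rfl
  rw [leadCoeff, ← h1.eq, h2.eq, h3]
  simp only [mul_assoc]

/-- The form X Y X, in which a sign matrix making D X symmetric reduces skewness of D X Y X to that
of D Y. -/
lemma leadCoeff_eq (hm : p + 2 * s' + 2 * s + 1 = m) :
    leadCoeff m A p s' s = oddHigh m A p s' *
      (evenHigh m A p s' * symHigh m A (p + 1) * oddLow m A s) * oddHigh m A p s' := by
  have h1 : Commute (oddLow m A s)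
      (oddHigh m A p s' * (evenHigh m A p s' * symHigh m A (p + 1))) :=
    (actsAbove_oddLow A (t := p + 2 * s' + 1) (by omega)).commute
      ((actsBelow_oddHigh A (by omega)).mul ((actsBelow_evenHigh A (by omega)).mul
        (actsBelow_symHigh A (by omega))))
  rw [leadCoeff_eq' hm, ← mul_assoc (oddLow m A s), h1.eq]
  simp only [mul_assoc]

lemma constCoeff_eq (hm : p + 2 * s' + 2 * s + 1 = m) :
    constCoeff m A p s' s = oddLow m A s *
      (oddHigh m A p s' * symHigh m A p * (evenLow m A s * dgb m (m - 1) (-A 0))) *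
        oddLow m A s := by
  have hB : ActsBelow (p + 2 * s') (oddHigh m A p s' * symHigh m A p) :=
    (actsBelow_oddHigh A le_rfl).mul (actsBelow_symHigh A (by omega))
  have h1 : Commute (oddLow m A s) (oddHigh m A p s' * symHigh m A p) :=
    (actsAbove_oddLow A (by omega)).commute hB
  have h2 := (actsAbove_trail (A := A) hm).commute hB
  rw [constCoeff, ← h2.eq]
  calc _ = oddLow m A s * (evenLow m A s * dgb m (m - 1) (-A 0)) *
        (oddLow m A s * (oddHigh m A p s' * symHigh m A p)) := by simp only [mul_assoc]
    _ = _ := by rw [h1.eq]; simp only [mul_assoc]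

/-- A block diagonal matrix of scalar blocks that commutes with both coefficients is scalar. -/
theorem dgl_eq_of_commute_coeffs [IsDomain S] [NeZero n] (hm : p + 2 * s' + 2 * s + 1 = m)
    (hA : A m ≠ 0) {d : ℕ → S} (hL : Commute (dgl m n d) (leadCoeff m A p s' s))
    (hC : Commute (dgl m n d) (constCoeff m A p s' s)) {i : ℕ} (hi : i < m) : d i = d 0 := by
  have hC' : constCoeff m A p s' s =
      oddLow m A s * (evenLow m A s * dgb m (m - 1) (-A 0)) * oddLow m A s *
        (oddHigh m A p s' * symHigh m A p) := by
    rw [constCoeff]; simp only [mul_assoc]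
  have hO : ActsAbove (p + 2 * s') (oddLow m A s) := actsAbove_oddLow A (by omega)
  rw [hC'] at hC
  -- The constant coefficient yields `oddHigh` and `symHigh m A p`, the leading one `oddLow`. Since
  -- `oddHigh` and `oddLow` are invertible, they can then be stripped from X Y X, which releases the
  -- middle factors `evenHigh`, `symHigh m A (p + 1)` and `evenLow`.
  obtain ⟨hC1, hC2⟩ := commute_dgl_of_mul ((hO.mul (actsAbove_trail hm)).mul hO)
    ((actsBelow_oddHigh A le_rfl).mul (actsBelow_symHigh A (by omega))) hC
  obtain ⟨hOh, hKp⟩ := commute_dgl_of_mul (actsAbove_oddHigh A) (actsBelow_symHigh A le_rfl) hC2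
  rw [leadCoeff_eq' hm] at hL
  obtain ⟨hOl, hL2⟩ := commute_dgl_of_mul (t := p + 2 * s' + 1) (actsAbove_oddLow A (by omega))
    (((actsBelow_oddHigh A (by omega)).mul ((actsBelow_evenHigh A (by omega)).mul
        (actsBelow_symHigh A (by omega)))).mul (actsBelow_oddHigh A (by omega))) hL
  have hL3 := Commute.of_mul_mul (isUnit_oddHigh A (by omega)) hOh hL2
  obtain ⟨hEh, hKp1⟩ := commute_dgl_of_mul (actsAbove_evenHigh A) (actsBelow_symHigh A le_rfl) hL3
  have hC3 := Commute.of_mul_mul (isUnit_oddLow A (by omega)) hOl hC1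
  have hEl : Commute (dgl m n d) (evenLow m A s) := by
    have hc : Commute (dgb m (m - 1) (-A 0)) (evenLow m A s) :=
      (ActsAbove.dgb le_rfl _).commute (actsBelow_evenLow A (by omega) (by omega))
    rw [← hc.eq] at hC3
    exact (commute_dgl_of_mul (ActsAbove.dgb le_rfl _)
      (actsBelow_evenLow A (by omega) (by omega)) hC3).2
  rw [symHigh_eq_hankel A (by omega)] at hKp hKp1
  have hY : (fun t => A (m - t)) 0 ≠ 0 := hA
  -- Neighbouring blocks are always linked. In the string part the antidiagonals of the Hankel
  -- matrices of sizes p and p + 1 join i and i + 1 to the same block p - 1 - i; elsewhere i and i +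
  -- 1 form a pair of exactly one of the odd and even factors.
  have step : ∀ i, i + 1 < m → d (i + 1) = d i := by
    intro i hi
    by_cases h1 : i < p
    · have e1 := dgl_eq_of_commute_hankel (by omega) hY hKp (i := i) (j := p - 1 - i) (by omega)
      have e2 := dgl_eq_of_commute_hankel (by omega) hY hKp1 (i := i + 1) (j := p - 1 - i)
        (by omega)
      rw [e1, e2]
    by_cases h2 : i < p + 2 * s'
    · rcases Nat.even_or_odd' (i - p) with ⟨j, hj | hj⟩
      · have := dgl_eq_of_commute_revProd_swp (disjointPairs_oddHigh (by omega)) hOh (i := j)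
          (by omega)
        rwa [show p + 2 * j = i by omega] at this
      · have := dgl_eq_of_commute_revProd_swp (disjointPairs_evenHigh (by omega)) hEh (i := j)
          (by omega)
        rwa [show p + 2 * j + 2 = i + 1 by omega, show p + 2 * j + 1 = i by omega] at this
    · rcases Nat.even_or_odd' (m - 2 - i) with ⟨j, hj | hj⟩
      · have := dgl_eq_of_commute_revProd_swp (disjointPairs_oddLow (by omega)) hOl (i := j)
          (by omega)
        rw [show m - 2 - 2 * j = i by omega, show m - 1 - 2 * j = i + 1 by omega] at this
        exact this.symm
      · have := dgl_eq_of_commute_revProd_swp (disjointPairs_evenLow (by omega)) hEl (i := j)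
          (by omega)
        rw [show m - 3 - 2 * j = i by omega, show m - 2 - 2 * j = i + 1 by omega] at this
        exact this.symm
  induction i with
  | zero => rfl
  | succ i ih => rw [step i hi, ih (by omega)]

lemma sum_pairs_low {s : ℕ} (h : 2 * s < m) :
    ∑ i ∈ Finset.range s, (blk m (m - 2 - 2 * i) (m - 2 - 2 * i) (1 : Matrix (Fin n) (Fin n) S) +
      blk m (m - 1 - 2 * i) (m - 1 - 2 * i) 1) = 1 - prj S m n (m - 2 * s) := by
  induction s with
  | zero => simp [prj_eq_one]
  | succ s ih =>
    rw [Finset.sum_range_succ, ih (by omega), show m - 2 * s = m - 2 * (s + 1) + 1 + 1 by omega,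
      prj_succ, prj_succ, show m - 2 - 2 * s = m - 2 * (s + 1) by omega,
      show m - 1 - 2 * s = m - 2 * (s + 1) + 1 by omega]
    abel

lemma sum_pairs_high {s : ℕ} :
    ∑ i ∈ Finset.range s,
      (blk m (p + 2 * i + 2) (p + 2 * i + 2) (1 : Matrix (Fin n) (Fin n) S) +
        blk m (p + 2 * i + 1) (p + 2 * i + 1) 1) =
      prj S m n (p + 2 * s + 1) - prj S m n (p + 1) := by
  induction s with
  | zero => simp
  | succ s ih =>
    rw [Finset.sum_range_succ, ih, show p + 2 * (s + 1) + 1 = p + 2 * s + 1 + 1 + 1 by ring,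
      prj_succ (p + 2 * s + 1 + 1), prj_succ (p + 2 * s + 1)]
    abel

/-- The signs that make the pencil T-even. -/
def evenSign (p H : ℕ) : ℕ → ℤˣ
  | 0 => 1
  | i + 1 => if p ≤ i ∧ Even (i - p) ∧ i ≠ H then evenSign p H i else -evenSign p H i

lemma evenSign_succ_of {p H i : ℕ} (h : p ≤ i ∧ Even (i - p) ∧ i ≠ H) :
    evenSign p H (i + 1) = evenSign p H i := by rw [evenSign, if_pos h]

lemma evenSign_succ_of_not {p H i : ℕ} (h : ¬ (p ≤ i ∧ Even (i - p) ∧ i ≠ H)) :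
    evenSign p H (i + 1) = -evenSign p H i := by rw [evenSign, if_neg h]

lemma evenSign_of_le {p H i : ℕ} (h : i ≤ p) : evenSign p H i = (-1) ^ i := by
  induction i with
  | zero => simp [evenSign]
  | succ i ih => rw [evenSign_succ_of_not (by omega), ih (by omega), pow_succ, mul_neg_one]

/-- A sequence of signs as scalars. -/
def signCoeff (S : Type*) [CommRing S] (ε : ℕ → ℤˣ) (i : ℕ) : S := ((ε i : ℤ) : S)

lemma signCoeff_succ_of {p H i : ℕ} (h : p ≤ i ∧ Even (i - p) ∧ i ≠ H) :
    signCoeff S (evenSign p H) (i + 1) = signCoeff S (evenSign p H) i := by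
  rw [signCoeff, evenSign_succ_of h, signCoeff]

lemma signCoeff_succ_of_not {p H i : ℕ} (h : ¬ (p ≤ i ∧ Even (i - p) ∧ i ≠ H)) :
    signCoeff S (evenSign p H) (i + 1) = -signCoeff S (evenSign p H) i := by
  rw [signCoeff, evenSign_succ_of_not h, signCoeff]
  push_cast
  rfl

lemma signCoeff_of_le {p H i : ℕ} (h : i ≤ p) : signCoeff S (evenSign p H) i = (-1) ^ i := by
  rw [signCoeff, evenSign_of_le h]
  push_cast
  rfl

lemma transpose_even (hA : ∀ j, (A j)ᵀ = (-1 : S) ^ j • A j) {j : ℕ} (hj : Even j) :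
    (A j)ᵀ = A j := by rw [hA, hj.neg_one_pow, one_smul]

lemma transpose_odd (hA : ∀ j, (A j)ᵀ = (-1 : S) ^ j • A j) {j : ℕ} (hj : Odd j) :
    (A j)ᵀ = (-1 : S) • A j := by rw [hA, hj.neg_one_pow]

lemma symmetric_sign_oddHigh (hm : p + 2 * s' + 2 * s + 1 = m)
    (hA : ∀ j, (A j)ᵀ = (-1 : S) ^ j • A j) {d : ℕ → S}
    (hd : ∀ i < s', d (p + 2 * i) = d (p + 2 * i + 1)) :
    (dgl m n d * oddHigh m A p s')ᵀ = dgl m n d * oddHigh m A p s' :=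
  symmetric_dgl_mul_revProd_swp (disjointPairs_oddHigh (by omega)) hd
    fun i hi => transpose_even hA ⟨s' + s - i, by omega⟩

lemma signCoeff_oddHigh {i : ℕ} (hi : i < s') :
    signCoeff S (evenSign p (p + 2 * s')) (p + 2 * i) =
      signCoeff S (evenSign p (p + 2 * s')) (p + 2 * i + 1) :=
  (signCoeff_succ_of ⟨by omega, ⟨i, by omega⟩, by omega⟩).symm

/-- The coefficients have odd index and the signs differ within each pair, so every pair contributes
a skew block. The pairs fill exactly the blocks from p + 2s' + 1 on, and subtracting the projection
removes the remaining identity. -/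
lemma skew_sign_oddLow (hm : p + 2 * s' + 2 * s + 1 = m) (hA : ∀ j, (A j)ᵀ = (-1 : S) ^ j • A j) :
    (dgl m n (signCoeff S (evenSign p (p + 2 * s'))) *
      (oddLow m A s - prj S m n (p + 2 * s' + 1)))ᵀ =
    -(dgl m n (signCoeff S (evenSign p (p + 2 * s'))) *
      (oddLow m A s - prj S m n (p + 2 * s' + 1))) := by
  have hsign : ∀ i < s, signCoeff S (evenSign p (p + 2 * s')) (m - 1 - 2 * i) =
      -signCoeff S (evenSign p (p + 2 * s')) (m - 2 - 2 * i) := fun i hi => by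
    rw [show m - 1 - 2 * i = m - 2 - 2 * i + 1 by omega]
    refine signCoeff_succ_of_not fun h => ?_
    obtain ⟨k, hk⟩ := h.2.1
    omega
  have := symmetric_dgl_mul_pairs (σ := (-1 : S)) (disjointPairs_oddLow (m := m) (s := s) (by omega))
    (d := signCoeff S (evenSign p (p + 2 * s'))) (X := fun i => -A (2 * i + 1))
    (fun i hi => by rw [hsign i hi, neg_one_mul])
    (fun i hi => by rw [hsign i hi, neg_one_mul, neg_neg])
    (fun i hi => by rw [transpose_neg, transpose_odd hA ⟨i, rfl⟩, smul_neg])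
  rw [sum_pairs_low (by omega), neg_one_smul, show m - 2 * s = p + 2 * s' + 1 by omega,
    sub_add_sub_cancel] at this
  exact this

/-- In X Y X the middle factor Y is a direct sum of three pieces which together fill all blocks: the
Hankel matrix on 0, …, p, the pairs of `evenHigh` on p + 1, …, p + 2s', and those of `oddLow`
beyond. No identity block is left over, so D Y can be skew. -/
theorem leadCoeff_skew (hm : p + 2 * s' + 2 * s + 1 = m) (hA : ∀ j, (A j)ᵀ = (-1 : S) ^ j • A j) :
    (dgl m n (signCoeff S (evenSign p (p + 2 * s'))) * leadCoeff m A p s' s)ᵀ =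
      -(dgl m n (signCoeff S (evenSign p (p + 2 * s'))) * leadCoeff m A p s' s) := by
  have hOh := symmetric_sign_oddHigh hm hA (d := signCoeff S (evenSign p (p + 2 * s')))
    fun i hi => signCoeff_oddHigh hi
  have hOl := skew_sign_oddLow (n := n) hm hA
  have hsign : ∀ i < s', signCoeff S (evenSign p (p + 2 * s')) (p + 2 * i + 2) =
      -signCoeff S (evenSign p (p + 2 * s')) (p + 2 * i + 1) := fun i hi => by
    refine signCoeff_succ_of_not fun h => ?_
    obtain ⟨k, hk⟩ := h.2.1
    omega
  have hEh := symmetric_dgl_mul_pairs (σ := (-1 : S))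
    (disjointPairs_evenHigh (m := m) (p := p) (s := s') (by omega))
    (d := signCoeff S (evenSign p (p + 2 * s'))) (X := fun i => A (m - (p + 2 * i + 2)))
    (fun i hi => by rw [hsign i hi, neg_one_mul, neg_neg])
    (fun i hi => by rw [hsign i hi, neg_one_mul])
    (fun i hi => transpose_odd hA ⟨s' + s - i - 1, by omega⟩)
  rw [sum_pairs_high, neg_one_smul] at hEh
  -- The signs alternate on the blocks 0, …, p; the parities balance because m - p = 2s' + 2s + 1 is
  -- odd.
  have hK := symmetric_dgl_mul_hankel (m := m) (σ := (-1 : S)) (a := p + 1)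
    (d := signCoeff S (evenSign p (p + 2 * s'))) (Y := fun t => A (m - t)) (fun i hi j hj hij => by
      rw [signCoeff_of_le (by omega), signCoeff_of_le (by omega), hA, smul_smul, ← pow_add,
        ← pow_succ']
      congr 1
      rw [neg_one_pow_eq_pow_mod_two, neg_one_pow_eq_pow_mod_two (n := j + 1)]
      congr 1
      omega)
  rw [neg_one_smul] at hK
  have hmid : evenHigh m A p s' * symHigh m A (p + 1) * oddLow m A s =
      (evenHigh m A p s' - 1 + (prj S m n (p + 2 * s' + 1) - prj S m n (p + 1))) +
        hankel m (fun t => A (m - t)) (p + 1) + (oddLow m A s - prj S m n (p + 2 * s' + 1)) := by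
    have hb : ActsBelow (p + 2 * s' + 1) (evenHigh m A p s' * symHigh m A (p + 1)) :=
      (actsBelow_evenHigh A le_rfl).mul (actsBelow_symHigh A (by omega))
    rw [hb.mul_eq (actsAbove_oddLow A (by omega)),
      (actsAbove_evenHigh A).mul_eq (actsBelow_symHigh A le_rfl), symHigh_eq_hankel A (by omega)]
    abel
  have hmid' : (dgl m n (signCoeff S (evenSign p (p + 2 * s'))) *
      (evenHigh m A p s' * symHigh m A (p + 1) * oddLow m A s))ᵀ =
      -(dgl m n (signCoeff S (evenSign p (p + 2 * s'))) *
      (evenHigh m A p s' * symHigh m A (p + 1) * oddLow m A s)) := by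
    rw [hmid, mul_add, mul_add, transpose_add, transpose_add, hOl, hK, evenHigh, hEh]
    abel
  rw [leadCoeff_eq hm]
  generalize evenHigh m A p s' * symHigh m A (p + 1) * oddLow m A s = Y at hmid' ⊢
  generalize oddHigh m A p s' = X at hOh ⊢
  rw [transpose_mul, dgl_transpose] at hOh hmid'
  rw [← mul_assoc, ← mul_assoc, ← hOh, mul_assoc Xᵀ]
  rw [transpose_mul, transpose_mul, transpose_mul, transpose_transpose, dgl_transpose, hmid', neg_mul,
    mul_neg]
  simp only [mul_assoc]

/-- The outer factor is now `oddLow`, for which D X is skew on the final blocks and not symmetric.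
Moving D across it changes the signs there, so the middle factor has to be symmetric for the
modified signs d'. Leftover identities are harmless, being symmetric. -/
theorem constCoeff_symmetric (hm : p + 2 * s' + 2 * s + 1 = m)
    (hA : ∀ j, (A j)ᵀ = (-1 : S) ^ j • A j) :
    (dgl m n (signCoeff S (evenSign p (p + 2 * s'))) * constCoeff m A p s' s)ᵀ =
      dgl m n (signCoeff S (evenSign p (p + 2 * s'))) * constCoeff m A p s' s := by
  set d := signCoeff S (evenSign p (p + 2 * s')) with hd
  set d' : ℕ → S := fun j => if j < p + 2 * s' + 1 then d j else -d j with hd'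
  have hOl := skew_sign_oddLow (n := n) hm hA
  rw [← hd] at hOl
  have hdd : dgl m n d' = dgl m n d * ((2 : S) • prj S m n (p + 2 * s' + 1) - 1) := by
    ext a b
    simp only [dgl, prj, diagonal_mul, diagonal_apply, Matrix.sub_apply, Matrix.smul_apply, hd',
      one_apply]
    split_ifs <;> simp <;> ring
  -- On the first p + 2s' + 1 blocks `oddLow` is the identity; on the others skewness of D X gives D
  -- X = -Xᵀ D.
  have hmove : dgl m n d * oddLow m A s = (oddLow m A s)ᵀ * dgl m n d' := by
    have hp := (commute_dgl_prj (m := m) (n := n) (t := p + 2 * s' + 1) d).eq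
    have hz : prj S m n (p + 2 * s' + 1) * oddLow m A s = prj S m n (p + 2 * s' + 1) :=
      (actsAbove_oddLow A (by omega)).left
    have hz' := congrArg transpose hz
    rw [transpose_mul, prj_transpose] at hz'
    rw [transpose_mul, transpose_sub, dgl_transpose, prj_transpose, sub_mul] at hOl
    rw [hdd, ← mul_assoc, mul_sub, mul_one, mul_smul_comm, mul_assoc, hp, ← mul_assoc, hz',
      sub_eq_iff_eq_add.1 hOl, mul_sub, hp]
    module
  have hK := symmetric_dgl_mul_hankel (m := m) (σ := (1 : S)) (a := p)
    (d := d') (Y := fun t => A (m - t)) (fun i hi j hj hij => by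
      simp only [hd']
      rw [if_pos (by omega), if_pos (by omega), hd, signCoeff_of_le (by omega),
        signCoeff_of_le (by omega), hA, smul_smul, ← pow_add, one_mul]
      congr 1
      rw [neg_one_pow_eq_pow_mod_two, neg_one_pow_eq_pow_mod_two (n := j)]
      congr 1
      omega)
  rw [one_smul] at hK
  have hOh := symmetric_sign_oddHigh hm hA (d := d') fun i hi => by
    simp only [hd']
    rw [if_pos (by omega), if_pos (by omega)]
    exact signCoeff_oddHigh hi
  have hEl : (dgl m n d' * evenLow m A s)ᵀ = dgl m n d' * evenLow m A s := by
    refine symmetric_dgl_mul_revProd_swp (disjointPairs_evenLow (by omega)) (fun i hi => ?_)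
      fun i hi => by rw [transpose_neg, transpose_even hA ⟨i + 1, by omega⟩]
    simp only [hd']
    rw [if_neg (by omega), show m - 2 - 2 * i = m - 3 - 2 * i + 1 by omega]
    -- In the one pair that straddles the border, the blocks p + 2s' and p + 2s' + 1, the sign
    -- change of `evenSign` cancels that of d'. This is the reason for the exception i ≠ H in
    -- `evenSign`; in all other pairs the sign is constant.
    split_ifs with h
    · rw [hd, signCoeff_succ_of_not (by omega), neg_neg]
    · rw [hd, signCoeff_succ_of ⟨by omega, ⟨s' + s - i - 1, by omega⟩, by omega⟩]
  have hD : (dgl m n d' * dgb m (m - 1) (-A 0))ᵀ = dgl m n d' * dgb m (m - 1) (-A 0) := by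
    simp only [dgb, mul_add, mul_sub, mul_one, dgl_mul_blk, transpose_add, transpose_sub,
      transpose_smul, blk_transpose, transpose_one, dgl_transpose, transpose_neg,
      transpose_even hA Even.zero]
  have hmid : oddHigh m A p s' * symHigh m A p * (evenLow m A s * dgb m (m - 1) (-A 0)) =
      oddHigh m A p s' + (hankel m (fun t => A (m - t)) p - prj S m n p) + evenLow m A s +
        dgb m (m - 1) (-A 0) - (2 : S) • 1 := by
    have hb : ActsBelow (p + 2 * s') (oddHigh m A p s' * symHigh m A p) :=
      (actsBelow_oddHigh A le_rfl).mul (actsBelow_symHigh A (by omega))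
    rw [hb.mul_eq (actsAbove_trail hm), (actsAbove_oddHigh A).mul_eq (actsBelow_symHigh A le_rfl),
      (actsBelow_evenLow A (by omega) (by omega)).mul_eq (ActsAbove.dgb le_rfl _),
      symHigh_eq_hankel A (by omega)]
    module
  have hP : (dgl m n d' * prj S m n p)ᵀ = dgl m n d' * prj S m n p := by
    rw [transpose_mul, dgl_transpose, prj_transpose, (commute_dgl_prj d').eq]
  have hmid' : (dgl m n d' *
      (oddHigh m A p s' * symHigh m A p * (evenLow m A s * dgb m (m - 1) (-A 0))))ᵀ =
      dgl m n d' *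
      (oddHigh m A p s' * symHigh m A p * (evenLow m A s * dgb m (m - 1) (-A 0))) := by
    rw [hmid]
    simp only [mul_add, mul_sub, transpose_add, transpose_sub, mul_smul_comm, mul_one,
      transpose_smul, dgl_transpose, hOh, hK, hEl, hD, hP]
  rw [constCoeff_eq hm]
  generalize oddHigh m A p s' * symHigh m A p * (evenLow m A s * dgb m (m - 1) (-A 0)) = Y
    at hmid' ⊢
  rw [← mul_assoc, ← mul_assoc, hmove, mul_assoc _ _ Y, transpose_mul, transpose_mul, hmid',
    transpose_transpose]
  simp only [mul_assoc]

end SymmetricPencil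

/-! ### The number i_0(w) of consecutive inversions at 0. -/

section InversionCount

lemma admissible_zero_succ (s : ℕ) :
    ((do let a ← (List.range (s + 1)).reverse; pure (a : ℤ)).flatMap fun i =>
      [((0 : ℕ) : ℤ) + 2 * i + 1, ((0 : ℕ) : ℤ) + 2 * i + 2]) ++ stringZero 0 =
    ((List.range s).reverse.flatMap fun i : ℕ => [2 * (i : ℤ) + 3, 2 * (i : ℤ) + 4]) ++
      [1, 2, 0] := by
  rw [bind_pure_natCast, List.flatMap_map, List.range_succ_eq_map, List.reverse_cons,
    List.flatMap_append, ← List.map_reverse, List.flatMap_map, List.append_assoc]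
  congr 1
  exact List.flatMap_congr fun i _ => by push_cast; ring_nf

/-- For s > 0 the tuple w ends in 1, 2, 0, and all other entries exceed 2: the subtuple (1, 0)
occurs, but (2, 1, 0) does not. -/
lemma inversionsAt_zero_admissible {s : ℕ} {w : List ℤ} (hw : IsAdmissible (2 * s) 0 w) :
    inversionsAt 0 w = (min s 1 : ℕ) := by
  obtain ⟨-, -, hw⟩ := hw
  rw [Nat.sub_zero, Nat.mul_div_cancel_left _ two_pos] at hw
  have h0 : (0 : ℤ) ∈ w := by rw [hw]; simp [stringZero]
  rw [inversionsAt, if_pos h0, Nat.cast_inj, Nat.findGreatest_eq_iff]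
  rcases s with _ | s
  · have hw' : w = [0] := by rw [hw]; simp [stringZero]
    subst hw'
    refine ⟨by simp, by simp, fun k hk hk' h => ?_⟩
    have := h.length_le
    rw [bind_pure_natCast] at this
    simp at this
    omega
  · rw [admissible_zero_succ] at hw
    subst hw
    rw [min_eq_right (by omega)]
    refine ⟨by simp, fun _ => ?_, fun k hk _ h => ?_⟩
    · rw [bind_pure_natCast]
      refine List.Sublist.trans ?_ (List.sublist_append_right _ _)
      have : ((List.range (1 + 1)).reverse.map fun i : ℕ => (i : ℤ)).map (fun i => 0 + i) =
          [1, 0] := by simp [List.range_succ]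
      rw [this]
      decide
    · rw [bind_pure_natCast] at h
      have h3 : ([2, 1, 0] : List ℤ).Sublist
          ((((List.range (k + 1)).reverse.map fun i : ℕ => (i : ℤ))).map fun i => 0 + i) := by
        obtain ⟨j, rfl⟩ : ∃ j, k = 2 + j := ⟨k - 2, by omega⟩
        rw [show 2 + j + 1 = 3 + j by ring, List.range_add, List.reverse_append, List.map_append,
          List.map_append]
        refine List.Sublist.trans ?_ (List.sublist_append_right _ _)
        simp [List.range_succ]
      -- Discarding the entries above 2 preserves the subtuple relation and would make (2, 1, 0) a
      -- subtuple of (1, 2, 0).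
      have h4 := (h3.trans h).filter (fun t => decide (t ≤ 2))
      rw [List.filter_append] at h4
      have h5 : ((List.range s).reverse.flatMap fun i : ℕ =>
          [2 * (i : ℤ) + 3, 2 * (i : ℤ) + 4]).filter (fun t => decide (t ≤ 2)) = [] := by
        rw [List.filter_eq_nil_iff]
        intro t ht
        simp only [List.mem_flatMap, List.mem_cons, List.not_mem_nil, or_false] at ht
        obtain ⟨i, -, rfl | rfl⟩ := ht <;> simp <;> omega
      rw [h5] at h4
      revert h4
      decide

end InversionCount

/-! ### T-even pencils and block matrices. -/

section TEven

variable {ι κ : Type*}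

/-- The substitution x ↦ -x changes the sign of the linear coefficient only. -/
lemma isTEven_pencil_iff {E A : Matrix ι ι ℂ} :
    IsTEven (pencil E A) ↔ Eᵀ = -E ∧ Aᵀ = A := by
  have hentry : ∀ i j, ((pencil E A).map fun f => f.comp (-Polynomial.X))ᵀ i j =
      -(Polynomial.X * Polynomial.C (E j i)) - Polynomial.C (A j i) := fun i j => by
    simp [pencil]
  have hentry' : ∀ i j, pencil E A i j =
      Polynomial.X * Polynomial.C (E i j) - Polynomial.C (A i j) := fun i j => by
    simp [pencil]
  constructor
  · intro h
    have h' : ∀ i j, -(Polynomial.X * Polynomial.C (E j i)) - Polynomial.C (A j i) =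
        Polynomial.X * Polynomial.C (E i j) - Polynomial.C (A i j) := fun i j => by
      rw [← hentry, ← hentry', h]
    constructor
    · ext i j
      have := congrArg (fun f => Polynomial.coeff f 1) (h' i j)
      simp [Polynomial.coeff_C] at this
      simp [← this]
    · ext i j
      have := congrArg (fun f => Polynomial.coeff f 0) (h' i j)
      simpa using this
  · rintro ⟨hE, hA⟩
    refine Matrix.ext fun i j => ?_
    have h1 : E j i = -E i j := congrFun (congrFun hE i) j
    have h2 : A j i = A i j := congrFun (congrFun hA i) j
    rw [hentry, hentry', h1, h2]
    simp

lemma IsTEven.coeffMat_transpose {P : Matrix ι ι ℂ[X]} (h : IsTEven P) (j : ℕ) :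
    (coeffMat P j)ᵀ = (-1 : ℂ) ^ j • coeffMat P j := by
  ext a b
  have := congrArg (fun f => Polynomial.coeff f j) (congrFun (congrFun h b) a)
  simp only [transpose_apply, map_apply] at this
  simp only [coeffMat, transpose_apply, map_apply, Matrix.smul_apply, smul_eq_mul]
  have hc : -Polynomial.X = Polynomial.C (-1 : ℂ) * Polynomial.X := by simp
  rw [← this, hc, Polynomial.comp_C_mul_X_coeff, mul_comm]

lemma isTEven_fromBlocks_iff {P : Matrix ι ι ℂ[X]} {C : Matrix ι κ ℂ} {B : Matrix κ ι ℂ}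
    {D : Matrix κ κ ℂ[X]} :
    IsTEven (fromBlocks P (C.map Polynomial.C) (B.map Polynomial.C) D) ↔
      IsTEven P ∧ C = Bᵀ ∧ IsTEven D := by
  have hC : ∀ M : Matrix ι κ ℂ, (M.map Polynomial.C).map (fun f => f.comp (-Polynomial.X)) =
      M.map Polynomial.C := fun M => by ext; simp
  have hB : ∀ M : Matrix κ ι ℂ, (M.map Polynomial.C).map (fun f => f.comp (-Polynomial.X)) =
      M.map Polynomial.C := fun M => by ext; simp
  simp only [IsTEven, fromBlocks_map, fromBlocks_transpose, fromBlocks_inj, hC, hB]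
  have hinj : ∀ M N : Matrix ι κ ℂ, M.map Polynomial.C = N.map Polynomial.C ↔ M = N :=
    fun M N => (Matrix.map_injective Polynomial.C_injective).eq_iff
  constructor
  · rintro ⟨h1, h2, -, h4⟩
    refine ⟨h1, ?_, h4⟩
    rw [← hinj, ← h2, transpose_map]
  · rintro ⟨h1, rfl, h4⟩
    refine ⟨h1, ?_, ?_, h4⟩
    · rw [transpose_map]
    · rw [transpose_map, transpose_transpose]

lemma IsTEven.neg {P : Matrix ι ι ℂ[X]} (h : IsTEven P) : IsTEven (-P) := by
  unfold IsTEven at *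
  conv_rhs => rw [← h]
  ext i j
  simp

lemma IsTEven.units_smul {P : Matrix ι ι ℂ[X]} (h : IsTEven P) (u : ℤˣ) :
    IsTEven (((u : ℤ) : ℂ[X]) • P) := by
  rcases Int.units_eq_one_or u with rfl | rfl
  · simpa using h
  · simpa using h.neg

end TEven

/-! ### Pencils under constant multiplication, and sign matrices. -/

section Pencils

variable {ι κ μ : Type*}

lemma map_C_mul_pencil [Fintype ι] (N : Matrix μ ι ℂ) (E A : Matrix ι κ ℂ) :
    N.map Polynomial.C * pencil E A = pencil (N * E) (N * A) := by
  simp only [pencil, Matrix.mul_sub, Matrix.mul_smul, Matrix.map_mul]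

lemma pencil_mul_map_C [Fintype κ] (E A : Matrix ι κ ℂ) (N : Matrix κ μ ℂ) :
    pencil E A * N.map Polynomial.C = pencil (E * N) (A * N) := by
  simp only [pencil, Matrix.sub_mul, Matrix.smul_mul, Matrix.map_mul]

lemma pencil_fromBlocks {ι' κ' : Type*} (a a' : Matrix ι κ ℂ) (b b' : Matrix ι κ' ℂ)
    (c c' : Matrix ι' κ ℂ) (d d' : Matrix ι' κ' ℂ) :
    pencil (fromBlocks a b c d) (fromBlocks a' b' c' d') =
      fromBlocks (pencil a a') (pencil b b') (pencil c c') (pencil d d') := by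
  ext (i | i) (j | j) <;> simp [pencil]

lemma pencil_zero_left (A : Matrix ι κ ℂ) : pencil 0 A = -A.map Polynomial.C := by
  ext i j; simp [pencil]

lemma pencil_neg_neg (E A : Matrix ι κ ℂ) : pencil (-E) (-A) = -pencil E A := by
  ext i j; simp [pencil]; ring

variable {m n r : ℕ}

/-- The extension of a family of signs by `1`. -/
def extendSign (δ : Fin m → ℤˣ) (i : ℕ) : ℤˣ := if h : i < m then δ ⟨i, h⟩ else 1

lemma quasiIdentity_eq (δ : Fin m → ℤˣ) :
    quasiIdentity n δ = (dgl m n (signCoeff ℂ (extendSign δ))).map Polynomial.C := by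
  ext p q
  simp only [quasiIdentity, dgl, signCoeff, map_apply, diagonal_apply, extendSign, p.1.2, dif_pos]
  split_ifs <;> simp

lemma dgl_signCoeff_congr {S : Type*} [CommRing S] {δ ε : ℕ → ℤˣ} (h : ∀ i < m, δ i = ε i) :
    dgl m n (signCoeff S δ) = dgl m n (signCoeff S ε) := by
  simp only [dgl, signCoeff]
  congr 1
  ext p
  rw [h _ p.1.2]

lemma dgl_mul_dgl {S : Type*} [CommRing S] (d e : ℕ → S) :
    dgl m n d * dgl m n e = dgl m n (fun i => d i * e i) := by
  simp [dgl]

lemma dgl_signCoeff_sq {S : Type*} [CommRing S] (ε : ℕ → ℤˣ) :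
    dgl m n (signCoeff S ε) * dgl m n (signCoeff S ε) = 1 := by
  have : (fun i => signCoeff S ε i * signCoeff S ε i) = fun _ => 1 := by
    ext i
    rw [signCoeff, ← Int.cast_mul, Int.units_coe_mul_self, Int.cast_one]
  rw [dgl_mul_dgl, this]
  simp [dgl]

lemma isTEven_quasiIdentity_mul_iff (δ : Fin m → ℤˣ) (E A : Matrix (Fin m × Fin n) (Fin m × Fin n) ℂ) :
    IsTEven (quasiIdentity n δ * pencil E A) ↔
      (dgl m n (signCoeff ℂ (extendSign δ)) * E)ᵀ = -(dgl m n (signCoeff ℂ (extendSign δ)) * E) ∧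
      (dgl m n (signCoeff ℂ (extendSign δ)) * A)ᵀ = dgl m n (signCoeff ℂ (extendSign δ)) * A := by
  rw [quasiIdentity_eq, map_C_mul_pencil, isTEven_pencil_iff]

/-- With D² = E² = 1 the hypotheses read Mᵀ = σ D M D = σ E M E, whence E D commutes with M. -/
lemma commute_of_sign_symmetric {S : Type*} [CommRing S] {δ ε : ℕ → ℤˣ} {σ : S}
    {M : Matrix (Fin m × Fin n) (Fin m × Fin n) S} (hσ : σ * σ = 1)
    (h1 : (dgl m n (signCoeff S δ) * M)ᵀ = σ • (dgl m n (signCoeff S δ) * M))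
    (h2 : (dgl m n (signCoeff S ε) * M)ᵀ = σ • (dgl m n (signCoeff S ε) * M)) :
    Commute (dgl m n fun i => signCoeff S ε i * signCoeff S δ i) M := by
  rw [← dgl_mul_dgl]
  rw [transpose_mul, dgl_transpose] at h1 h2
  set D := dgl m n (signCoeff S δ)
  set E := dgl m n (signCoeff S ε)
  have hE : E * E = 1 := dgl_signCoeff_sq ε
  have hD : D * D = 1 := dgl_signCoeff_sq δ
  have hED : E * D = D * E := by
    simp only [D, E, dgl_mul_dgl, mul_comm]
  have h3 : σ • (D * M) * D = σ • (E * M) * E := by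
    rw [← h1, ← h2, mul_assoc, mul_assoc, hD, hE]
  have h4 : D * M * D = E * M * E := by
    have := congrArg (fun x => σ • x) h3
    simpa only [smul_mul_assoc, smul_smul, hσ, one_smul] using this
  calc E * D * M = E * (D * M * D) * D := by simp only [mul_assoc, hD, mul_one]
    _ = E * (E * M * E) * D := by rw [h4]
    _ = E * E * M * (E * D) := by simp only [mul_assoc]
    _ = M * (E * D) := by rw [hE, one_mul]

end Pencils

/-! ### Action of the Fiedler products on block columns and block rows. -/

section BlockVectors

variable {S : Type*} [CommRing S] {m n r : ℕ}

lemma blk_mul_blockCol {a b : ℕ} (hb : b < m) (X : Matrix (Fin n) (Fin n) S)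
    (C : Matrix (Fin n) (Fin r) S) :
    blk m a b X * blockCol m ((b : ℤ) + 1) C = blockCol m ((a : ℤ) + 1) (X * C) := by
  ext p j
  simp only [mul_apply, blk, blockCol, of_apply, Fintype.sum_prod_type]
  rw [Finset.sum_eq_single ⟨b, hb⟩]
  · by_cases h : (p.1 : ℕ) = a <;> simp [h]
  · intro i _ hi
    have : (i : ℕ) ≠ b := fun h => hi (Fin.ext h)
    simp [this]
  · simp

lemma blk_mul_blockCol_ne {a b c : ℕ} (hbc : b ≠ c) (X : Matrix (Fin n) (Fin n) S)
    (C : Matrix (Fin n) (Fin r) S) : blk m a b X * blockCol m ((c : ℤ) + 1) C = 0 := by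
  ext p j
  simp only [mul_apply, blk, blockCol, of_apply, Matrix.zero_apply]
  refine Finset.sum_eq_zero fun i _ => ?_
  by_cases h : (i.1 : ℕ) = b
  · have : (i.1 : ℕ) ≠ c := fun h' => hbc (h.symm.trans h')
    simp [this]
  · simp [h]

lemma blockRow_eq_transpose (k : ℤ) (B : Matrix (Fin r) (Fin n) S) :
    blockRow m k B = (blockCol m k Bᵀ)ᵀ := rfl

lemma blockRow_mul_blk {a b : ℕ} (hb : b < m) (X : Matrix (Fin n) (Fin n) S)
    (B : Matrix (Fin r) (Fin n) S) :
    blockRow m ((b : ℤ) + 1) B * blk m b a X = blockRow m ((a : ℤ) + 1) (B * X) := by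
  rw [blockRow_eq_transpose, blockRow_eq_transpose, ← transpose_transpose (blk m b a X),
    ← transpose_mul, blk_transpose, blk_mul_blockCol hb, transpose_mul]

lemma blockRow_mul_blk_ne {a b c : ℕ} (hbc : c ≠ b) (X : Matrix (Fin n) (Fin n) S)
    (B : Matrix (Fin r) (Fin n) S) : blockRow m ((c : ℤ) + 1) B * blk m b a X = 0 := by
  rw [blockRow_eq_transpose, ← transpose_transpose (blk m b a X),
    ← transpose_mul, blk_transpose, blk_mul_blockCol_ne hbc.symm, transpose_zero]

lemma swp_mul_blockCol {a b : ℕ} (hab : a ≠ b) (hb : b < m) (X : Matrix (Fin n) (Fin n) S)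
    (C : Matrix (Fin n) (Fin r) S) :
    swp m a b X * blockCol m ((b : ℤ) + 1) C = blockCol m ((a : ℤ) + 1) C := by
  simp [swp, Matrix.add_mul, Matrix.sub_mul, blk_mul_blockCol_ne hab, blk_mul_blockCol hb]

lemma swp_mul_blockCol_ne {a b c : ℕ} (ha : a ≠ c) (hb : b ≠ c) (X : Matrix (Fin n) (Fin n) S)
    (C : Matrix (Fin n) (Fin r) S) :
    swp m a b X * blockCol m ((c : ℤ) + 1) C = blockCol m ((c : ℤ) + 1) C := by
  simp [swp, Matrix.add_mul, Matrix.sub_mul, blk_mul_blockCol_ne ha, blk_mul_blockCol_ne hb]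

lemma blockRow_mul_swp {a b : ℕ} (hab : a ≠ b) (hb : b < m) (X : Matrix (Fin n) (Fin n) S)
    (B : Matrix (Fin r) (Fin n) S) :
    blockRow m ((b : ℤ) + 1) B * swp m a b X = blockRow m ((a : ℤ) + 1) B := by
  simp [swp, Matrix.mul_add, Matrix.mul_sub, blockRow_mul_blk_ne hab.symm, blockRow_mul_blk hb]

lemma blockRow_mul_swp_ne {a b c : ℕ} (ha : c ≠ a) (hb : c ≠ b) (X : Matrix (Fin n) (Fin n) S)
    (B : Matrix (Fin r) (Fin n) S) :
    blockRow m ((c : ℤ) + 1) B * swp m a b X = blockRow m ((c : ℤ) + 1) B := by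
  simp [swp, Matrix.mul_add, Matrix.mul_sub, blockRow_mul_blk_ne ha, blockRow_mul_blk_ne hb]

lemma prj_mul_blockCol {t c : ℕ} (h : t ≤ c) (C : Matrix (Fin n) (Fin r) S) :
    prj S m n t * blockCol m ((c : ℤ) + 1) C = 0 := by
  ext p j
  simp only [prj, diagonal_mul, blockCol, of_apply, Matrix.zero_apply]
  by_cases h' : (p.1 : ℕ) = c
  · simp [h', h.not_gt]
  · simp [h']

lemma ActsBelow.mul_blockCol {t c : ℕ} {N : Matrix (Fin m × Fin n) (Fin m × Fin n) S}
    (hN : ActsBelow t N) (h : t ≤ c) (C : Matrix (Fin n) (Fin r) S) :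
    N * blockCol m ((c : ℤ) + 1) C = blockCol m ((c : ℤ) + 1) C := by
  have h1 : blockCol m ((c : ℤ) + 1) C = (1 - prj S m n t) * blockCol m ((c : ℤ) + 1) C := by
    rw [Matrix.sub_mul, prj_mul_blockCol h, sub_zero, Matrix.one_mul]
  rw [h1, ← Matrix.mul_assoc, hN.right]

lemma ActsBelow.blockRow_mul {t c : ℕ} {N : Matrix (Fin m × Fin n) (Fin m × Fin n) S}
    (hN : ActsBelow t N) (h : t ≤ c) (B : Matrix (Fin r) (Fin n) S) :
    blockRow m ((c : ℤ) + 1) B * N = blockRow m ((c : ℤ) + 1) B := by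
  have h1 : blockRow m ((c : ℤ) + 1) B = blockRow m ((c : ℤ) + 1) B * (1 - prj S m n t) := by
    rw [Matrix.mul_sub, blockRow_eq_transpose, ← prj_transpose, ← transpose_mul,
      prj_mul_blockCol h, transpose_zero, sub_zero, Matrix.mul_one]
  rw [h1, Matrix.mul_assoc, hN.left]

variable (A : ℕ → Matrix (Fin n) (Fin n) S) {s : ℕ}

/-- Only M_1 meets the last block; it moves e_m to e_{m-1}, which M_3, M_5, … do not touch. Thus e_m
moves by min(s, 1), which is i_0(w). -/
lemma oddLow_mul_blockCol (h : 2 * s < m) (C : Matrix (Fin n) (Fin r) S) :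
    oddLow m A s * blockCol m (m : ℤ) C = blockCol m ((m : ℤ) - (min s 1 : ℕ)) C := by
  rcases s with _ | s
  · simp [oddLow, revProd]
  · have h1 : (m : ℤ) - (min (s + 1) 1 : ℕ) = ((m - 2 : ℕ) : ℤ) + 1 := by omega
    have h2 : (m : ℤ) = ((m - 1 : ℕ) : ℤ) + 1 := by omega
    rw [h1]
    conv_lhs => rw [h2]
    induction s with
    | zero =>
      rw [oddLow, revProd, revProd, mul_one]
      exact swp_mul_blockCol (by omega) (by omega) _ _
    | succ s ih =>
      have := ih (by omega) (by omega)
      rw [oddLow] at this ⊢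
      rw [revProd, Matrix.mul_assoc, this, swp_mul_blockCol_ne (by omega) (by omega)]

lemma blockRow_mul_oddLow (h : 2 * s < m) (B : Matrix (Fin r) (Fin n) S) :
    blockRow m (m : ℤ) B * oddLow m A s = blockRow m ((m : ℤ) - (min s 1 : ℕ)) B := by
  rcases s with _ | s
  · simp [oddLow, revProd]
  · have h1 : (m : ℤ) - (min (s + 1) 1 : ℕ) = ((m - 2 : ℕ) : ℤ) + 1 := by omega
    have h2 : (m : ℤ) = ((m - 1 : ℕ) : ℤ) + 1 := by omega
    rw [h1]
    conv_lhs => rw [h2]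
    induction s with
    | zero =>
      rw [oddLow, revProd, revProd, mul_one]
      exact blockRow_mul_swp (by omega) (by omega) _ _
    | succ s ih =>
      have := ih (by omega) (by omega)
      rw [oddLow] at this ⊢
      rw [revProd, ← Matrix.mul_assoc, blockRow_mul_swp_ne (by omega) (by omega), this]

lemma oddLow_mul_evenLow_mul_blockCol (h : 2 * s < m) (C : Matrix (Fin n) (Fin r) S) :
    oddLow m A s * evenLow m A s * blockCol m (m : ℤ) C =
      blockCol m ((m : ℤ) - (min s 1 : ℕ)) C := by
  have h2 : (m : ℤ) = ((m - 1 : ℕ) : ℤ) + 1 := by omega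
  have h3 : evenLow m A s * blockCol m (m : ℤ) C =
      blockCol m (m : ℤ) C := by
    rw [h2]
    exact (actsBelow_evenLow A (by omega) h).mul_blockCol le_rfl C
  rw [Matrix.mul_assoc, h3, oddLow_mul_blockCol A h]

lemma blockRow_mul_coeff {p s' : ℕ} (hm : p + 2 * s' + 2 * s + 1 = m)
    (B : Matrix (Fin r) (Fin n) S) :
    blockRow m (m : ℤ) B * (oddLow m A s * (oddHigh m A p s' * symHigh m A p)) =
      blockRow m ((m : ℤ) - (min s 1 : ℕ)) B := by
  have h1 : (m : ℤ) - (min s 1 : ℕ) = ((m - 1 - min s 1 : ℕ) : ℤ) + 1 := by omega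
  rw [← Matrix.mul_assoc, blockRow_mul_oddLow A (by omega), h1]
  exact ((actsBelow_oddHigh A (t := p + 2 * s') le_rfl).mul
    (actsBelow_symHigh A (by omega))).blockRow_mul (by omega) B

end BlockVectors

/-! ### The block form of the system pencil. -/

section SystemPencil

variable {m n r : ℕ}

lemma prod_map_fiedlerPExt (P : Matrix (Fin n) (Fin n) ℂ[X]) (l : List ℤ) :
    (l.map (fiedlerPExt m r P)).prod = fromBlocks (l.map (fiedlerP m P)).prod 0 0 1 := by
  induction l with
  | nil => simp
  | cons k l ih => simp [ih, fiedlerPExt, fromBlocks_multiply]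

lemma prod_map_fiedlerS (R : Realization (Fin n) r) {l : List ℤ}
    (hl : ∀ k ∈ l, k ≠ 0 ∧ k ≠ -(m : ℤ)) :
    (l.map (fiedlerS m R)).prod = fromBlocks (l.map (fiedlerP m R.P)).prod 0 0 1 := by
  rw [← prod_map_fiedlerPExt]
  congr 1
  exact List.map_congr_left fun k hk => by
    rw [fiedlerS, if_neg (hl k hk).1, if_neg (hl k hk).2]

lemma stringZero_eq_cons (p : ℕ) :
    stringZero p = 0 :: (List.range p).map fun i : ℕ => (i : ℤ) + 1 := by
  rw [stringZero, bind_pure_natCast, List.range_succ_eq_map]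
  simp [Function.comp_def]

lemma prod_z_fiedlerS (R : Realization (Fin n) r) {p s : ℕ} (h : p + 2 * s < m) {z : List ℤ}
    (hz : IsAdmissible (p + 2 * s) p (z.map fun t => t + (m : ℤ))) :
    (z.map (fiedlerS m R)).prod = fromBlocks (z.map (fiedlerP m R.P)).prod 0 0 (-R.E) := by
  have hz' := eq_map_sub_of_map_add hz.2.2
  rw [Nat.add_sub_cancel_left, Nat.mul_div_cancel_left _ two_pos, bind_pure_natCast,
    List.flatMap_map, stringZero_eq_cons, List.map_append, List.map_cons, zero_sub,
    List.map_map] at hz'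
  subst hz'
  have hl : ∀ k ∈ ((List.range s).reverse.flatMap fun i : ℕ =>
      [(p : ℤ) + 2 * i + 1, (p : ℤ) + 2 * i + 2]).map (fun t => t - (m : ℤ)),
      k ≠ 0 ∧ k ≠ -(m : ℤ) := by
    intro k hk
    simp only [List.mem_map, List.mem_flatMap, List.mem_reverse, List.mem_range, List.mem_cons,
      List.not_mem_nil, or_false] at hk
    obtain ⟨t, ⟨i, hi, rfl | rfl⟩, rfl⟩ := hk <;> omega
  have hl' : ∀ k ∈ (List.range p).map ((fun t => t - (m : ℤ)) ∘ fun i : ℕ => (i : ℤ) + 1),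
      k ≠ 0 ∧ k ≠ -(m : ℤ) := by
    intro k hk
    simp only [List.mem_map, List.mem_range, Function.comp_apply] at hk
    obtain ⟨i, hi, rfl⟩ := hk
    omega
  have hS : fiedlerS m R (-(m : ℤ)) = fromBlocks (fiedlerP m R.P (-(m : ℤ))) 0 0 (-R.E) := by
    rw [fiedlerS, if_neg (by omega), if_pos rfl]
  rw [List.map_append, List.map_cons, List.prod_append, List.prod_cons, prod_map_fiedlerS R hl,
    prod_map_fiedlerS R hl', hS, List.map_append, List.map_cons, List.prod_append, List.prod_cons]
  simp [fromBlocks_multiply]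

/-- The index 0 occurs once, at the end of w. Hence the other factors act on the block column only,
while the block row stays at e_m until the symmetric complements move it. -/
lemma prod_w_fiedlerS (R : Realization (Fin n) r) {s : ℕ} (h : 2 * s < m) {w : List ℤ}
    (hw : IsAdmissible (2 * s) 0 w) :
    (w.map (fiedlerS m R)).prod = fromBlocks (w.map (fiedlerP m R.P)).prod
      (-blockCol m ((m : ℤ) - (min s 1 : ℕ)) R.C) (-blockRow m (m : ℤ) R.B) (-R.A) := by
  have hw' := hw.2.2
  rw [Nat.sub_zero, Nat.mul_div_cancel_left _ two_pos, bind_pure_natCast, List.flatMap_map] at hw'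
  have hl : ∀ k ∈ (List.range s).reverse.flatMap fun i : ℕ =>
      [((0 : ℕ) : ℤ) + 2 * i + 1, ((0 : ℕ) : ℤ) + 2 * i + 2], k ≠ 0 ∧ k ≠ -(m : ℤ) := by
    intro k hk
    simp only [List.mem_flatMap, List.mem_reverse, List.mem_range, List.mem_cons,
      List.not_mem_nil, or_false] at hk
    obtain ⟨i, hi, rfl | rfl⟩ := hk <;> omega
  have hprod : (((List.range s).reverse.flatMap fun i : ℕ =>
      [((0 : ℕ) : ℤ) + 2 * i + 1, ((0 : ℕ) : ℤ) + 2 * i + 2]).map (fiedlerP m R.P)).prod =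
      oddLow m (coeffMat R.P) s * evenLow m (coeffMat R.P) s := by
    rw [← revProd_pairs_low R.P h, ← revProd_eq_prod]
    exact prod_map_flatMap_pair _ _ _ _
  have hS : fiedlerS m R 0 = fromBlocks (fiedlerP m R.P 0) (-blockCol m (m : ℤ) R.C)
      (-blockRow m (m : ℤ) R.B) (-R.A) := by rw [fiedlerS, if_pos rfl]
  have hs0 : stringZero 0 = [0] := by simp [stringZero_eq_cons]
  rw [hw', hs0, List.map_append, List.prod_append, prod_map_fiedlerS R hl, hprod, List.map_append,
    List.prod_append, hprod]
  simp [fromBlocks_multiply, hS, Matrix.mul_neg, oddLow_mul_evenLow_mul_blockCol _ h]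

variable {s s' p : ℕ} {w z cz : List ℤ}

lemma pencilP_eq (P : Matrix (Fin n) (Fin n) ℂ[X]) (hm : p + 2 * s' + 2 * s + 1 = m)
    (hw : IsAdmissible (2 * s) 0 w)
    (hz : IsAdmissible (p + 2 * s') p (z.map fun t => t + (m : ℤ)))
    (hcz : (cz.map fun t => t + (m : ℤ)) = symmetricComplement (p + 2 * s') p) :
    pencilP m P z w (symmetricComplement (2 * s) 0) cz =
      pencil (leadCoeff m (coeffMat P) p s' s) (constCoeff m (coeffMat P) p s' s) := by
  rw [pencilP, pencil_mul_map_C, pencil_mul_map_C, prod_w P (by omega) hw, prod_z P (by omega) hz,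
    prod_cz P (by omega) hcz, prod_cw P (by omega)]
  rfl

lemma blockCol_map {S T : Type*} [CommRing S] [CommRing T] (f : S →+* T) (k : ℤ)
    (C : Matrix (Fin n) (Fin r) S) : (blockCol m k C).map f = blockCol m k (C.map f) := by
  ext p j
  simp only [blockCol, map_apply, of_apply]
  split_ifs <;> simp

lemma blockRow_map {S T : Type*} [CommRing S] [CommRing T] (f : S →+* T) (k : ℤ)
    (B : Matrix (Fin r) (Fin n) S) : (blockRow m k B).map f = blockRow m k (B.map f) := by
  ext p j
  simp only [blockRow, map_apply, of_apply]
  split_ifs <;> simp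

lemma pencilS_eq (R : Realization (Fin n) r) (hm : p + 2 * s' + 2 * s + 1 = m)
    (hw : IsAdmissible (2 * s) 0 w)
    (hz : IsAdmissible (p + 2 * s') p (z.map fun t => t + (m : ℤ)))
    (hcz : (cz.map fun t => t + (m : ℤ)) = symmetricComplement (p + 2 * s') p) :
    pencilS m R z w (symmetricComplement (2 * s) 0) cz =
      fromBlocks (pencilP m R.P z w (symmetricComplement (2 * s) 0) cz)
        ((blockCol m ((m : ℤ) - (min s 1 : ℕ)) R.C).map Polynomial.C)
        ((blockRow m ((m : ℤ) - (min s 1 : ℕ)) R.B).map Polynomial.C) (-pencil R.E R.A) := by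
  have hrow : blockRow m (m : ℤ) R.B * ((symmetricComplement (2 * s) 0).map (fiedlerP m R.P)).prod *
      (cz.map (fiedlerP m R.P)).prod = blockRow m ((m : ℤ) - (min s 1 : ℕ)) R.B := by
    rw [prod_cz R.P (by omega) hcz, prod_cw R.P (by omega), Matrix.mul_assoc,
      blockRow_mul_coeff _ hm]
  rw [pencilS, pencilP, prod_z_fiedlerS R (by omega) hz, prod_w_fiedlerS R (by omega) hw,
    prod_map_fiedlerPExt, prod_map_fiedlerPExt, pencil_mul_map_C, pencil_mul_map_C,
    pencil_mul_map_C, pencil_mul_map_C]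
  simp only [fromBlocks_multiply, pencil_fromBlocks, Matrix.mul_zero, Matrix.zero_mul, add_zero,
    zero_add, Matrix.mul_one, Matrix.neg_mul, hrow]
  rw [pencil_neg_neg, pencil_zero_left, pencil_zero_left]
  congr 1 <;> ext i j <;> simp

end SystemPencil

/-! ### Transfer functions: the substitution x ↦ -x, and minimality. -/

section Transfer

lemma eval₂_C_neg_X (f : ℂ[X]) :
    f.eval₂ (RatFunc.C : ℂ →+* RatFunc ℂ) (-RatFunc.X) =
      algebraMap ℂ[X] (RatFunc ℂ) (f.comp (-Polynomial.X)) := by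
  rw [Polynomial.comp, Polynomial.hom_eval₂, map_neg, RatFunc.algebraMap_X]
  congr 1

/-- `RatFunc.eval` respects sums and products only where denominators do not vanish. At -x they
never do, so the substitution is a ring homomorphism. -/
lemma eval₂_C_neg_X_ne_zero {f : ℂ[X]} (hf : f ≠ 0) :
    f.eval₂ (RatFunc.C : ℂ →+* RatFunc ℂ) (-RatFunc.X) ≠ 0 := by
  rw [eval₂_C_neg_X]
  intro h
  exact hf (Polynomial.comp_neg_X_eq_zero_iff.1 ((map_eq_zero_iff _
    (RatFunc.algebraMap_injective ℂ)).1 h))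

/-- The substitution `x ↦ -x` in rational functions. -/
def negSubst : RatFunc ℂ →+* RatFunc ℂ where
  toFun f := f.eval RatFunc.C (-RatFunc.X)
  map_one' := RatFunc.eval_one _ _
  map_zero' := RatFunc.eval_zero _ _
  map_add' f g := RatFunc.eval_add _ _ (eval₂_C_neg_X_ne_zero f.denom_ne_zero)
    (eval₂_C_neg_X_ne_zero g.denom_ne_zero)
  map_mul' f g := RatFunc.eval_mul _ _ (eval₂_C_neg_X_ne_zero f.denom_ne_zero)
    (eval₂_C_neg_X_ne_zero g.denom_ne_zero)

lemma negSubst_C (a : ℂ) : negSubst (RatFunc.C a) = RatFunc.C a := RatFunc.eval_C _ _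

lemma negSubst_X : negSubst RatFunc.X = -RatFunc.X := RatFunc.eval_X _ _

lemma negSubst_algebraMap (f : ℂ[X]) : negSubst (algebraMap ℂ[X] (RatFunc ℂ) f) =
    algebraMap ℂ[X] (RatFunc ℂ) (f.comp (-Polynomial.X)) := by
  rw [← eval₂_C_neg_X]
  exact RatFunc.eval_algebraMap _ _ f

lemma map_nonsing_inv {K L ι : Type*} [Field K] [Field L] [Fintype ι] [DecidableEq ι] (f : K →+* L)
    (M : Matrix ι ι K) : M⁻¹.map f = (M.map f)⁻¹ := by
  rw [inv_def, inv_def, Ring.inverse_eq_inv', Ring.inverse_eq_inv', ← RingHom.mapMatrix_apply,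
    ← RingHom.mapMatrix_apply, ← RingHom.map_det, ← RingHom.map_adjugate, ← map_inv₀]
  ext i j
  simp

lemma Realization.IsTEvenRealization.transfer {ι : Type*} {r : ℕ} {R : Realization ι r}
    (h : R.IsTEvenRealization) : IsTEvenRat R.transfer := by
  obtain ⟨hC, hP, hE⟩ := h
  obtain ⟨hE, hA⟩ := isTEven_pencil_iff.1 hE
  have hconst : ∀ M : Matrix ι (Fin r) ℂ, (M.map RatFunc.C).map negSubst = M.map RatFunc.C :=
    fun M => by ext; simp [negSubst_C]
  have hconst' : ∀ M : Matrix (Fin r) ι ℂ, (M.map RatFunc.C).map negSubst = M.map RatFunc.C :=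
    fun M => by ext; simp [negSubst_C]
  set N : Matrix (Fin r) (Fin r) (RatFunc ℂ) :=
    (RatFunc.X : RatFunc ℂ) • R.E.map RatFunc.C - R.A.map RatFunc.C with hN
  have hNt : (N.map negSubst)ᵀ = N := by
    ext i j
    have h1 : R.E j i = -R.E i j := congrFun (congrFun hE i) j
    have h2 : R.A j i = R.A i j := congrFun (congrFun hA i) j
    simp [hN, negSubst_C, negSubst_X, h1, h2]
  have hPt : ((R.P.map (algebraMap ℂ[X] (RatFunc ℂ))).map negSubst)ᵀ =
      R.P.map (algebraMap ℂ[X] (RatFunc ℂ)) := by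
    ext i j
    simp only [transpose_apply, map_apply, negSubst_algebraMap]
    congr 1
    exact congrFun (congrFun hP i) j
  change (R.transfer.map negSubst)ᵀ = R.transfer
  rw [Realization.transfer, ← hN, Matrix.map_add _ (map_add negSubst), Matrix.map_mul,
    Matrix.map_mul, hconst, hconst', map_nonsing_inv, transpose_add, hPt, transpose_mul,
    transpose_mul, transpose_nonsing_inv, hNt, hC, transpose_map,
    transpose_transpose, Matrix.mul_assoc]

/-- If B = 0, the transfer function is a polynomial matrix and has a realization of size 0. -/
lemma Realization.IsMinimal.B_ne_zero {n r : ℕ} {R : Realization (Fin n) r} (h : R.IsMinimal)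
    (hr : 0 < r) : R.B ≠ 0 := by
  intro hB
  refine (h 0 ⟨R.P, 0, 0, 0, 0, by simp⟩ ?_).not_gt hr
  simp [Realization.transfer, hB]

/-- The realization of a diagonal block of a rational matrix, with a modified polynomial part. -/
def Realization.block {ι κ : Type*} {r : ℕ} (R : Realization ι r) (f : κ → ι)
    (Q : Matrix κ κ ℂ[X]) : Realization κ r where
  P := R.P.submatrix f f + Q
  C := R.C.submatrix f id
  E := R.E
  A := R.A
  B := R.B.submatrix id f
  isUnit_det_E := R.isUnit_det_E

lemma Realization.transfer_block {ι κ : Type*} {r : ℕ} (R : Realization ι r) (f : κ → ι)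
    (Q : Matrix κ κ ℂ[X]) : (R.block f Q).transfer =
      R.transfer.submatrix f f + Q.map (algebraMap ℂ[X] (RatFunc ℂ)) := by
  ext i j
  simp only [Realization.transfer, Realization.block, Matrix.add_apply, map_apply, submatrix_apply,
    mul_apply, map_add, id]
  ring

/-- The diagonal block k of the lifted transfer function differs from that of R by a polynomial
matrix. Restricting any competing realization to this block and correcting its polynomial part gives
a realization of the original transfer function of the same size. -/
lemma isMinimal_liftRealization {m n r : ℕ} {R : Realization (Fin n) r} (hR : R.IsMinimal)
    (hC : R.C = R.Bᵀ) {k : ℤ} (k' : Fin m) (hk : ((k' : ℕ) : ℤ) + 1 = k)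
    (L : Matrix (Fin m × Fin n) (Fin m × Fin n) ℂ[X]) :
    (liftRealization m R k L).IsMinimal := by
  intro r' R' hR'
  let f : Fin n → Fin m × Fin n := fun i => (k', i)
  refine hR r' (R'.block f (R.P - L.submatrix f f)) ?_
  rw [Realization.transfer_block, hR', Realization.transfer, Realization.transfer]
  have h1 : ∀ i j, blockCol m k R.Bᵀ (f i) j = R.C i j := fun i j => by
    simp [blockCol, f, hk, hC]
  have h2 : ∀ i j, blockRow m k R.B i (f j) = R.B i j := fun i j => by
    simp [blockRow, f, hk]
  ext i j
  simp only [liftRealization, Matrix.add_apply, map_apply, submatrix_apply, mul_apply, map_sub,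
    Matrix.sub_apply, h1, h2]
  ring

end Transfer

/-! ### Factorization of the pencil into constant factors and a full Fiedler chain. -/

section ChainFactorization

variable {S : Type*} [CommRing S] {m n : ℕ} (A : ℕ → Matrix (Fin n) (Fin n) S) {p s s' : ℕ}

/-- The steps of the chain whose Fiedler factor stands on the left. -/
def leftStep (p j : ℕ) : Bool := decide (p ≤ j ∧ Even (j - p))

/-- The left factor of the Fiedler product of the indices `-m, …, j - m`. -/
def highL (m : ℕ) (A : ℕ → Matrix (Fin n) (Fin n) S) (p j : ℕ) :
    Matrix (Fin m × Fin n) (Fin m × Fin n) S :=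
  chainL m id (fun j => A (m - (j + 1))) (leftStep p) j

/-- The right factor of the Fiedler product of the indices `-m, …, j - m`. -/
def highR (m : ℕ) (A : ℕ → Matrix (Fin n) (Fin n) S) (p j : ℕ) :
    Matrix (Fin m × Fin n) (Fin m × Fin n) S :=
  chainR m id (fun j => A (m - (j + 1))) (leftStep p) j

/-- The left factor of the Fiedler product of the indices `0, …, j`. -/
def lowL (m : ℕ) (A : ℕ → Matrix (Fin n) (Fin n) S) (p j : ℕ) :
    Matrix (Fin m × Fin n) (Fin m × Fin n) S :=
  chainL m (fun j => m - 1 - j) (fun j => -A (j + 1)) (fun j => leftStep p (m - 2 - j)) j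

/-- The right factor of the Fiedler product of the indices `0, …, j`. -/
def lowR (m : ℕ) (A : ℕ → Matrix (Fin n) (Fin n) S) (p j : ℕ) :
    Matrix (Fin m × Fin n) (Fin m × Fin n) S :=
  chainR m (fun j => m - 1 - j) (fun j => -A (j + 1)) (fun j => leftStep p (m - 2 - j)) j

lemma highL_succ (j : ℕ) : highL m A p (j + 1) =
    if leftStep p j then swp m (j + 1) j (A (m - (j + 1))) * highL m A p j
    else highL m A p j := rfl

lemma highR_succ (j : ℕ) : highR m A p (j + 1) =
    if leftStep p j then highR m A p j
    else highR m A p j * swp m (j + 1) j (A (m - (j + 1))) := rfl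

lemma lowL_succ (j : ℕ) : lowL m A p (j + 1) =
    if leftStep p (m - 2 - j) then swp m (m - 1 - (j + 1)) (m - 1 - j) (-A (j + 1)) * lowL m A p j
    else lowL m A p j := rfl

lemma lowR_succ (j : ℕ) : lowR m A p (j + 1) =
    if leftStep p (m - 2 - j) then lowR m A p j
    else lowR m A p j * swp m (m - 1 - (j + 1)) (m - 1 - j) (-A (j + 1)) := rfl

lemma leftStep_of_lt {j : ℕ} (h : j < p) : leftStep p j = false := by
  simp [leftStep, h.not_ge]

lemma leftStep_even (i : ℕ) : leftStep p (p + 2 * i) = true := by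
  simp [leftStep]

lemma leftStep_odd (i : ℕ) : leftStep p (p + 2 * i + 1) = false := by
  simp only [leftStep, decide_eq_false_iff_not, not_and]
  rintro - ⟨k, hk⟩
  omega

lemma highL_mul_highR_of_le {j : ℕ} (h : j ≤ p) :
    highL m A p j * dgb m 0 (A m) * highR m A p j = strHigh m A (j + 1) := by
  induction j with
  | zero => simp [highL, highR, chainL, chainR, strHigh, fwdProd, shf]
  | succ j ih =>
    have h2 : strHigh m A (j + 1 + 1) =
        strHigh m A (j + 1) * swp m (j + 1) j (A (m - (j + 1))) := rfl
    rw [highL_succ, highR_succ, leftStep_of_lt h, h2, ← ih (by omega)]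
    simp only [Bool.false_eq_true, if_false, mul_assoc]

/-- Going up from M_{-m}, the string indices are appended on the right; after that each odd index
goes to the left and the following even one to the right. The even factor is supported beyond the
blocks of the product built so far, so it can be commuted to its place in the admissible order. -/
lemma highL_mul_highR {i : ℕ} (h : p + 2 * i < m) :
    highL m A p (p + 2 * i) * dgb m 0 (A m) * highR m A p (p + 2 * i) =
      oddHigh m A p i * evenHigh m A p i * strHigh m A (p + 1) := by
  induction i with
  | zero =>
    rw [mul_zero, add_zero, highL_mul_highR_of_le A le_rfl]
    simp [oddHigh, evenHigh, revProd]
  | succ i ih =>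
    have hodd : oddHigh m A p (i + 1) = swp m (p + 2 * i + 1) (p + 2 * i)
      (A (m - (p + 2 * i + 1))) * oddHigh m A p i := rfl
    have heven : evenHigh m A p (i + 1) = swp m (p + 2 * i + 2) (p + 2 * i + 1)
      (A (m - (p + 2 * i + 2))) * evenHigh m A p i := rfl
    have hab : ActsAbove (p + 2 * i + 1) (swp m (p + 2 * i + 2) (p + 2 * i + 1)
      (A (m - (p + 2 * i + 2)))) := ActsAbove.swp (by omega) (by omega) _
    have hc1 := hab.commute (actsBelow_oddHigh (m := m) A (s := i) (p := p) (by omega))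
    have hc2 := hab.commute (((actsBelow_oddHigh (m := m) A (s := i) (p := p) (by omega)).mul
      (actsBelow_evenHigh (m := m) A (s := i) (p := p) (by omega))).mul
        (actsBelow_strHigh (m := m) A (p := p + 1) (by omega)))
    rw [show p + 2 * (i + 1) = p + 2 * i + 1 + 1 by ring, highL_succ, highR_succ, leftStep_odd,
      highL_succ, highR_succ, leftStep_even, hodd, heven]
    simp only [Bool.false_eq_true, if_false, if_true]
    generalize swp m (p + 2 * i + 2) (p + 2 * i + 1) (A (m - (p + 2 * i + 2))) = g at *
    generalize swp m (p + 2 * i + 1) (p + 2 * i) (A (m - (p + 2 * i + 1))) = g' at *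
    calc _ = g' * ((highL m A p (p + 2 * i) * dgb m 0 (A m) * highR m A p (p + 2 * i)) * g) := by
          simp only [mul_assoc]
      _ = g' * (g * oddHigh m A p i) * (evenHigh m A p i * strHigh m A (p + 1)) := by
          rw [ih (by omega), ← hc2.eq]; simp only [mul_assoc]
      _ = _ := by rw [hc1.eq]; simp only [mul_assoc]

lemma oddHigh_mul_evenHigh (i : ℕ) : oddHigh m A p i * evenHigh m A p i =
    revProd (fun i => swp m (p + 2 * i + 1) (p + 2 * i) (A (m - (p + 2 * i + 1))) *
      swp m (p + 2 * i + 2) (p + 2 * i + 1) (A (m - (p + 2 * i + 2)))) i := by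
  rw [oddHigh, evenHigh, ← revProd_mul]
  intro i hi j hj
  exact swp_commute_swp (by omega) (by omega) (by omega) (by omega) _ _

lemma oddLow_mul_evenLow {i : ℕ} (h : 2 * i < m) : oddLow m A i * evenLow m A i =
    revProd (fun i => swp m (m - 2 - 2 * i) (m - 1 - 2 * i) (-A (2 * i + 1)) *
      swp m (m - 3 - 2 * i) (m - 2 - 2 * i) (-A (2 * i + 2))) i := by
  rw [oddLow, evenLow, ← revProd_mul]
  intro i hi j hj
  exact swp_commute_swp (by omega) (by omega) (by omega) (by omega) _ _

/-- The j-th string M_{2j+1} M_{2j+2} meets M_{-(2j+2)} M_{-(2j+1)}, the top string still present in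
the high product, and cancels it. -/
lemma low_mul_high (hm : p + 2 * s' + 2 * s + 1 = m) :
    oddLow m A s * evenLow m A s * (oddHigh m A p (s' + s) * evenHigh m A p (s' + s)) =
      oddHigh m A p s' * evenHigh m A p s' := by
  rw [oddLow_mul_evenLow A (by omega), oddHigh_mul_evenHigh, oddHigh_mul_evenHigh]
  have key : ∀ j ≤ s, revProd (fun i => swp m (m - 2 - 2 * i) (m - 1 - 2 * i) (-A (2 * i + 1)) *
      swp m (m - 3 - 2 * i) (m - 2 - 2 * i) (-A (2 * i + 2))) j *
      revProd (fun i => swp m (p + 2 * i + 1) (p + 2 * i) (A (m - (p + 2 * i + 1))) *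
      swp m (p + 2 * i + 2) (p + 2 * i + 1) (A (m - (p + 2 * i + 2)))) (s' + s) =
      revProd (fun i => swp m (p + 2 * i + 1) (p + 2 * i) (A (m - (p + 2 * i + 1))) *
      swp m (p + 2 * i + 2) (p + 2 * i + 1) (A (m - (p + 2 * i + 2)))) (s' + s - j) := by
    intro j hj
    induction j with
    | zero => simp [revProd]
    | succ j ih =>
      rw [revProd, mul_assoc, ih (by omega), show s' + s - j = s' + s - (j + 1) + 1 by omega,
        revProd, show p + 2 * (s' + s - (j + 1)) + 1 = m - 2 - 2 * j by omega,
        show p + 2 * (s' + s - (j + 1)) + 2 = m - 1 - 2 * j by omega,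
        show p + 2 * (s' + s - (j + 1)) = m - 3 - 2 * j by omega,
        show m - (m - 2 - 2 * j) = 2 * j + 2 by omega,
        show m - (m - 1 - 2 * j) = 2 * j + 1 by omega]
      rw [mul_assoc (swp m (m - 2 - 2 * j) _ _), mul_assoc (swp m (m - 2 - 2 * j) _ _),
        ← mul_assoc (swp m (m - 3 - 2 * j) _ _), swp_mul_swp' (by omega) (by omega) (by omega),
        one_mul, ← mul_assoc, swp_mul_swp' (by omega) (by omega) (by omega), one_mul]
  have := key s le_rfl
  rwa [show s' + s - s = s' by omega] at this

/-- The low chain runs through the same steps from the other end, with inverse factors on the same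
sides, so it removes the outermost factors one at a time. -/
lemma lowL_mul_highL {j : ℕ} (hj : j + 1 ≤ m) :
    lowL m A p j * highL m A p (m - 1) = highL m A p (m - 1 - j) := by
  induction j with
  | zero => simp [lowL, chainL]
  | succ j ih =>
    have h := ih (by omega)
    rw [show m - 1 - j = m - 2 - j + 1 by omega, highL_succ] at h
    rw [lowL_succ, show m - 1 - (j + 1) = m - 2 - j by omega]
    split_ifs at h ⊢
    · rw [mul_assoc, h, show m - (m - 2 - j + 1) = j + 1 by omega, ← mul_assoc,
        show m - 1 - j = m - 2 - j + 1 by omega, swp_mul_swp' (by omega) (by omega) (by omega),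
        one_mul]
    · exact h

lemma highR_mul_lowR {j : ℕ} (hj : j + 1 ≤ m) :
    highR m A p (m - 1) * lowR m A p j = highR m A p (m - 1 - j) := by
  induction j with
  | zero => simp [lowR, chainR]
  | succ j ih =>
    have h := ih (by omega)
    rw [show m - 1 - j = m - 2 - j + 1 by omega, highR_succ] at h
    rw [lowR_succ, show m - 1 - (j + 1) = m - 2 - j by omega]
    split_ifs at h ⊢
    · exact h
    · rw [← mul_assoc, h, show m - (m - 2 - j + 1) = j + 1 by omega, mul_assoc,
        show m - 1 - j = m - 2 - j + 1 by omega, swp_mul_swp (by omega) (by omega) (by omega),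
        mul_one]

lemma lowL_mul_highL_eq_one (hm : 0 < m) : lowL m A p (m - 1) * highL m A p (m - 1) = 1 := by
  rw [lowL_mul_highL A (by omega), Nat.sub_self]
  rfl

lemma highR_mul_lowR_eq_one (hm : 0 < m) : highR m A p (m - 1) * lowR m A p (m - 1) = 1 := by
  rw [highR_mul_lowR A (by omega), Nat.sub_self]
  rfl

/-- The constant left factor common to both coefficients of the pencil. -/
def commonL (m : ℕ) (A : ℕ → Matrix (Fin n) (Fin n) S) (s : ℕ) :
    Matrix (Fin m × Fin n) (Fin m × Fin n) S := oddLow m A s * evenLow m A s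

/-- The constant right factor common to both coefficients of the pencil. -/
def commonR (m : ℕ) (A : ℕ → Matrix (Fin n) (Fin n) S) (p s' s : ℕ) :
    Matrix (Fin m × Fin n) (Fin m × Fin n) S := oddLow m A s * (oddHigh m A p s' * symHigh m A p)

lemma leadCoeff_factor (hm : p + 2 * s' + 2 * s + 1 = m) :
    leadCoeff m A p s' s = commonL m A s *
      (highL m A p (m - 1) * dgb m 0 (A m) * highR m A p (m - 1)) * commonR m A p s' s := by
  have h := highL_mul_highR (m := m) A (p := p) (i := s' + s) (by omega)
  rw [show p + 2 * (s' + s) = m - 1 by omega] at h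
  rw [h, leadCoeff, ← low_mul_high A hm, commonL, commonR]
  simp only [mul_assoc]

lemma constCoeff_factor : constCoeff m A p s' s =
    commonL m A s * dgb m (m - 1) (-A 0) * commonR m A p s' s := by
  rw [constCoeff, commonL, commonR]
  simp only [mul_assoc]

lemma isUnit_commonL (h : 2 * s < m) : IsUnit (commonL m A s) :=
  (isUnit_oddLow A h).mul
    (isUnit_revProd fun i hi => isUnit_swp (by omega) (by omega) (by omega) _)

lemma isUnit_commonR (hm : p + 2 * s' + 2 * s + 1 = m) (hA : IsUnit (A m) ∨ p = 0) :
    IsUnit (commonR m A p s' s) :=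
  (isUnit_oddLow A (by omega)).mul ((isUnit_oddHigh A (by omega)).mul
    (isUnit_symHigh A (by omega) hA))

end ChainFactorization

/-! ### Reduction along a chain through all blocks. -/

section FullChain

variable {S : Type*} [CommRing S] {m n : ℕ}

lemma sum_blk_eq_one : ∑ i ∈ Finset.range m, blk m i i (1 : Matrix (Fin n) (Fin n) S) = 1 := by
  have : ∀ t, ∑ i ∈ Finset.range t, blk m i i (1 : Matrix (Fin n) (Fin n) S) = prj S m n t := by
    intro t
    induction t with
    | zero => simp [prj_zero]
    | succ t ih => rw [Finset.sum_range_succ, ih, prj_succ]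
  rw [this, prj_eq_one le_rfl]

/-- Once the chain exhausts all blocks, the term prepared for outside blocks disappears. -/
lemma chainLead_full {c : ℕ → ℕ} {K : ℕ} (x : S) (Z : Matrix (Fin n) (Fin n) S)
    (h : ∑ i ∈ Finset.range (K + 1), blk m (c i) (c i) (1 : Matrix (Fin n) (Fin n) S) = 1) :
    chainLead m c x K Z = x • dgb m (c K) Z := by
  have h' := h
  rw [Finset.sum_range_succ, ← eq_sub_iff_add_eq] at h'
  rw [chainLead, h, h', dgb, blk_smul]
  module

lemma blk_eq_mul {a : ℕ} (ha : a < m) (W : Matrix (Fin n) (Fin n) S) :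
    blk m a a W = blk m a a 1 * blk m a a W * blk m a a 1 := by
  rw [blk_mul_same ha, blk_mul_same ha, Matrix.one_mul, Matrix.mul_one]

/-- Reduction of the pencil `x M_Z - M_0` at finite points. -/
theorem exists_reduction_finite (hm : 0 < m) (A : ℕ → Matrix (Fin n) (Fin n) S) (p : ℕ) (x : S) :
    ∃ U V : Matrix (Fin m × Fin n) (Fin m × Fin n) S, IsUnit U ∧ IsUnit V ∧
      U * (x • (highL m A p (m - 1) * dgb m 0 (A m) * highR m A p (m - 1)) -
        dgb m (m - 1) (-A 0)) * V =
        dgb m (m - 1) (∑ i ∈ Finset.range (m + 1), x ^ i • A i) ∧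
      U * blk m (m - 1) (m - 1) 1 = blk m (m - 1) (m - 1) 1 ∧
      blk m (m - 1) (m - 1) 1 * V = blk m (m - 1) (m - 1) 1 := by
  obtain ⟨U, V, hU, hV, hUV, hUL, hRV⟩ := chain_elimination (m := m) (K := m - 1)
    (c := fun j => m - 1 - j) (X := fun j => -A (j + 1)) (left := fun j => leftStep p (m - 2 - j))
    (fun i hi => by omega) (fun i hi j hj h => by omega) x le_rfl (A m)
  have hsum : ∑ i ∈ Finset.range (m - 1 + 1),
      blk m (m - 1 - i) (m - 1 - i) (1 : Matrix (Fin n) (Fin n) S) = 1 := by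
    rw [show m - 1 + 1 = m by omega,
      Finset.sum_range_reflect (fun i => blk m i i (1 : Matrix (Fin n) (Fin n) S)) m,
      sum_blk_eq_one]
  rw [chainLead_full (c := fun j => m - 1 - j) x (A m) hsum] at hUV
  simp only [Nat.sub_self, Nat.sub_zero] at hUV hUL hRV
  change U * (_ - lowL m A p (m - 1) * _ * lowR m A p (m - 1)) * V = _ at hUV
  change U * lowL m A p (m - 1) * _ = _ at hUL
  change _ * (lowR m A p (m - 1) * V) = _ at hRV
  have h1 := lowL_mul_highL_eq_one (p := p) A hm
  have h2 := highR_mul_lowR_eq_one (p := p) A hm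
  have hlL : IsUnit (lowL m A p (m - 1)) := IsUnit.of_mul_eq_one _ h1
  have hlR : IsUnit (lowR m A p (m - 1)) := IsUnit.of_mul_eq_one _ (mul_eq_one_comm.1 h2)
  -- Multiplying by the inverses of the high factors moves the chain from the leading to the
  -- constant coefficient; it now starts at the last block, the one that carries A_0 and the state
  -- part.
  refine ⟨U * lowL m A p (m - 1), lowR m A p (m - 1) * V, hU.mul hlL, hlR.mul hV, ?_, hUL, hRV⟩
  have hx : lowL m A p (m - 1) * (x • (highL m A p (m - 1) * dgb m 0 (A m) *
      highR m A p (m - 1)) - dgb m (m - 1) (-A 0)) * lowR m A p (m - 1) =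
      x • dgb m 0 (A m) - lowL m A p (m - 1) * (1 - blk m (m - 1) (m - 1) 1) *
        lowR m A p (m - 1) - lowL m A p (m - 1) * blk m (m - 1) (m - 1) (-A 0) *
          lowR m A p (m - 1) := by
    have h3 : lowL m A p (m - 1) * (highL m A p (m - 1) * dgb m 0 (A m) *
        highR m A p (m - 1)) * lowR m A p (m - 1) = dgb m 0 (A m) := by
      rw [← mul_assoc, ← mul_assoc, h1, one_mul, mul_assoc, h2, mul_one]
    rw [mul_sub, sub_mul, mul_smul_comm, smul_mul_assoc, h3, dgb, dgb, mul_add, add_mul]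
    abel
  -- The elimination omits the block -A 0; it is preserved by the transformations and supplies the
  -- last term of the polynomial.
  have hblk : U * (lowL m A p (m - 1) * blk m (m - 1) (m - 1) (-A 0) * lowR m A p (m - 1)) * V =
      blk m (m - 1) (m - 1) (-A 0) := by
    rw [blk_eq_mul (by omega) (-A 0)]
    calc _ = (U * lowL m A p (m - 1) * blk m (m - 1) (m - 1) 1) * blk m (m - 1) (m - 1) (-A 0) *
          (blk m (m - 1) (m - 1) 1 * (lowR m A p (m - 1) * V)) := by simp only [mul_assoc]
      _ = _ := by rw [hUL, hRV]
  calc _ = U * (lowL m A p (m - 1) * (x • (highL m A p (m - 1) * dgb m 0 (A m) *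
      highR m A p (m - 1)) - dgb m (m - 1) (-A 0)) * lowR m A p (m - 1)) * V := by
        simp only [mul_assoc]
    _ = _ := by
      rw [hx, mul_sub, sub_mul, hUV, hblk, smul_horner, dgb, add_sub_assoc, ← blk_sub]
      congr 2
      obtain ⟨k, rfl⟩ : ∃ k, m = k + 1 := ⟨m - 1, by omega⟩
      rw [Finset.sum_range_succ, Finset.sum_range_succ']
      simp only [Nat.add_sub_cancel, smul_neg, Finset.sum_neg_distrib, pow_zero, one_smul]
      abel

/-- Reduction of the reversed pencil `M_Z - x M_0`. -/
theorem exists_reduction_infinite (hm : 0 < m) (A : ℕ → Matrix (Fin n) (Fin n) S) (p : ℕ) (x : S)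
    (Z : Matrix (Fin n) (Fin n) S) :
    ∃ U V : Matrix (Fin m × Fin n) (Fin m × Fin n) S, IsUnit U ∧ IsUnit V ∧
      U * (highL m A p (m - 1) * dgb m 0 (A m) * highR m A p (m - 1) - x • dgb m (m - 1) Z) * V =
        dgb m (m - 1) (A m + ∑ i ∈ Finset.range (m - 1), x ^ (i + 1) • A (m - (i + 1)) -
          x ^ m • Z) := by
  obtain ⟨U, V, hU, hV, hUV, hUL, hRV⟩ := chain_elimination (m := m) (K := m - 1)
    (c := id) (X := fun j => A (m - (j + 1))) (left := leftStep p)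
    (fun i hi => by simp only [id]; omega) (fun i hi j hj h => h) x le_rfl Z
  have hsum : ∑ i ∈ Finset.range (m - 1 + 1),
      blk m (id i) (id i) (1 : Matrix (Fin n) (Fin n) S) = 1 := by
    rw [show m - 1 + 1 = m by omega]
    exact sum_blk_eq_one
  rw [chainLead_full x Z hsum] at hUV
  simp only [id] at hUV hUL hRV
  change U * (_ - highL m A p (m - 1) * _ * highR m A p (m - 1)) * V = _ at hUV
  change U * highL m A p (m - 1) * _ = _ at hUL
  change _ * (highR m A p (m - 1) * V) = _ at hRV
  have hblk : U * (highL m A p (m - 1) * blk m 0 0 (A m) * highR m A p (m - 1)) * V =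
      blk m 0 0 (A m) := by
    rw [blk_eq_mul (by omega) (A m)]
    calc _ = (U * highL m A p (m - 1) * blk m 0 0 1) * blk m 0 0 (A m) *
          (blk m 0 0 1 * (highR m A p (m - 1) * V)) := by simp only [mul_assoc]
      _ = _ := by rw [hUL, hRV]
  set W : Matrix (Fin n) (Fin n) S :=
    A m + ∑ i ∈ Finset.range (m - 1), x ^ (i + 1) • A (m - (i + 1)) - x ^ m • Z with hW
  have h1 : U * (highL m A p (m - 1) * dgb m 0 (A m) * highR m A p (m - 1) -
      x • dgb m (m - 1) Z) * V = blk m 0 0 W - (1 - blk m 0 0 1) := by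
    have h2 : highL m A p (m - 1) * dgb m 0 (A m) * highR m A p (m - 1) - x • dgb m (m - 1) Z =
        highL m A p (m - 1) * blk m 0 0 (A m) * highR m A p (m - 1) -
        (x • dgb m (m - 1) Z -
          highL m A p (m - 1) * (1 - blk m 0 0 1) * highR m A p (m - 1)) := by
      rw [dgb, mul_add, add_mul]
      abel
    rw [h2, mul_sub, sub_mul, hblk, hUV, smul_horner, hW, show m - 1 + 1 = m by omega]
    simp only [blk_sub, blk_add]
    abel
  -- Here the chain product is the positive term of the pencil, so the eliminated blocks come out as
  -- -1; this involution corrects them.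
  have hJ : IsUnit ((2 : S) • blk m 0 0 1 - 1 : Matrix (Fin m × Fin n) (Fin m × Fin n) S) :=
    IsUnit.of_mul_eq_one ((2 : S) • blk m 0 0 1 - 1) <| by
      simp only [mul_sub, sub_mul, mul_one, one_mul, smul_mul_assoc, mul_smul_comm,
        blk_mul_same hm]
      module
  have h3 : ((2 : S) • blk m 0 0 1 - 1) * (blk m 0 0 W - (1 - blk m 0 0 1)) = dgb m 0 W := by
    simp only [dgb, mul_sub, sub_mul, mul_one, one_mul, smul_mul_assoc, blk_mul_same hm]
    module
  -- The polynomial ends up in block 0 and must be exchanged with the last block; `swp` needs two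
  -- distinct blocks, and for m = 1 there is nothing to exchange.
  by_cases hm1 : m - 1 = 0
  · refine ⟨((2 : S) • blk m 0 0 1 - 1) * U, V, hJ.mul hU, hV, ?_⟩
    rw [mul_assoc, mul_assoc, ← mul_assoc U, h1, h3, hm1]
  · have hT := isUnit_swp (S := S) (n := n) (a := 0) (b := m - 1) hm (by omega) (Ne.symm hm1) 0
    refine ⟨swp m 0 (m - 1) 0 * (((2 : S) • blk m 0 0 1 - 1) * U), V * swp m 0 (m - 1) 0,
      hT.mul (hJ.mul hU), hV.mul hT, ?_⟩
    have h4 : swp m 0 (m - 1) 0 * dgb m 0 W * swp m 0 (m - 1) 0 = dgb m (m - 1) W := by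
      have hm' : m - 1 < m := by omega
      simp only [swp, dgb, mul_add, add_mul, mul_sub, sub_mul, one_mul, mul_one, blk_mul_blk, hm,
        hm', hm1, Ne.symm hm1, and_true, if_true, if_false, blk_zero, add_zero, zero_mul]
      abel
    rw [← h4, ← h3, ← h1]
    simp only [mul_assoc]

end FullChain

/-! ### Base change, and reduction of the signed pencil together with its state part. -/

section PencilReduction

variable {S T : Type*} [CommRing S] [CommRing T] {m n r : ℕ}

lemma chainL_map (f : S →+* T) (c : ℕ → ℕ) (X : ℕ → Matrix (Fin n) (Fin n) S) (left : ℕ → Bool)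
    (j : ℕ) : (chainL m c X left j).map f = chainL m c (fun i => (X i).map f) left j := by
  induction j with
  | zero => exact Matrix.map_one f (map_zero f) (map_one f)
  | succ j ih =>
    rw [chainL, chainL]
    split_ifs
    · rw [Matrix.map_mul, ih, swp_map]
    · exact ih

lemma chainR_map (f : S →+* T) (c : ℕ → ℕ) (X : ℕ → Matrix (Fin n) (Fin n) S) (left : ℕ → Bool)
    (j : ℕ) : (chainR m c X left j).map f = chainR m c (fun i => (X i).map f) left j := by
  induction j with
  | zero => exact Matrix.map_one f (map_zero f) (map_one f)
  | succ j ih =>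
    rw [chainR, chainR]
    split_ifs
    · exact ih
    · rw [Matrix.map_mul, ih, swp_map]

lemma padIdentity_eq_dgb (M : Matrix (Fin n) (Fin n) S) : padIdentity m M = dgb m (m - 1) M := by
  ext p q
  have hp := p.1.2
  have hq := q.1.2
  rw [dgb_apply, padIdentity, of_apply]
  by_cases h : (p.1 : ℕ) + 1 = m ∧ (q.1 : ℕ) + 1 = m
  · rw [if_pos h, if_pos ⟨by omega, by omega⟩]
  · have h' : ¬((p.1 : ℕ) = m - 1 ∧ (q.1 : ℕ) = m - 1) := fun h' => h ⟨by omega, by omega⟩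
    rw [if_neg h, if_neg h', ← one_apply_block, one_apply]

lemma blockCol_mul_mul_blockRow (hm : 0 < m) (C : Matrix (Fin n) (Fin r) S)
    (D : Matrix (Fin r) (Fin r) S) (B : Matrix (Fin r) (Fin n) S) :
    blockCol m (m : ℤ) C * D * blockRow m (m : ℤ) B = blk m (m - 1) (m - 1) (C * D * B) := by
  ext p q
  have hp : (p.1 : ℕ) < m := p.1.2
  have hq : (q.1 : ℕ) < m := q.1.2
  have hp' : (((p.1 : ℕ) : ℤ) + 1 = m) ↔ (p.1 : ℕ) = m - 1 := by omega
  have hq' : (((q.1 : ℕ) : ℤ) + 1 = m) ↔ (q.1 : ℕ) = m - 1 := by omega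
  simp only [mul_apply, blockCol, blockRow, blk, of_apply, hp', hq']
  by_cases h : (p.1 : ℕ) = m - 1 <;> by_cases h' : (q.1 : ℕ) = m - 1 <;> simp [h, h']

lemma blk_one_mul_blockCol (hm : 0 < m) (C : Matrix (Fin n) (Fin r) S) :
    blk m (m - 1) (m - 1) (1 : Matrix (Fin n) (Fin n) S) * blockCol m (m : ℤ) C =
      blockCol m (m : ℤ) C := by
  have h : (m : ℤ) = ((m - 1 : ℕ) : ℤ) + 1 := by omega
  rw [h, blk_mul_blockCol (by omega), Matrix.one_mul]

lemma blockRow_mul_blk_one (hm : 0 < m) (B : Matrix (Fin r) (Fin n) S) :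
    blockRow m (m : ℤ) B * blk m (m - 1) (m - 1) (1 : Matrix (Fin n) (Fin n) S) =
      blockRow m (m : ℤ) B := by
  have h : (m : ℤ) = ((m - 1 : ℕ) : ℤ) + 1 := by omega
  rw [h, blockRow_mul_blk (by omega), Matrix.mul_one]

lemma dgl_mul_blockCol (d : ℕ → S) (k : ℕ) (C : Matrix (Fin n) (Fin r) S) :
    dgl m n d * blockCol m ((k : ℤ) + 1) C = d k • blockCol m ((k : ℤ) + 1) C := by
  ext p j
  simp only [dgl, diagonal_mul, blockCol, of_apply, Matrix.smul_apply, smul_eq_mul]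
  split_ifs with h
  · rw [show (p.1 : ℕ) = k by omega]
  · simp

lemma isUnit_dgl_signCoeff (δ : ℕ → ℤˣ) : IsUnit (dgl m n (signCoeff S δ)) :=
  IsUnit.of_mul_eq_one _ (dgl_signCoeff_sq δ)

variable {A : ℕ → Matrix (Fin n) (Fin n) S} {p s s' : ℕ} {δ : ℕ → ℤˣ}

lemma highL_map (f : S →+* T) (j : ℕ) :
    (highL m A p j).map f = highL m (fun i => (A i).map f) p j := chainL_map f _ _ _ j

lemma highR_map (f : S →+* T) (j : ℕ) :
    (highR m A p j).map f = highR m (fun i => (A i).map f) p j := chainR_map f _ _ _ j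

/-- The factorization of the signed Fiedler pencil into constant regular factors and a chain,
over an extension ring. -/
lemma exists_factorization (hm : p + 2 * s' + 2 * s + 1 = m)
    (hA : IsUnit (A m) ∨ p = 0) (hδ : δ (m - 1 - min s 1) = 1)
    (C : Matrix (Fin n) (Fin r) S) (B : Matrix (Fin r) (Fin n) S) (f : S →+* T) :
    ∃ W W' N N' : Matrix (Fin m × Fin n) (Fin m × Fin n) T, W' * W = 1 ∧ N * N' = 1 ∧
      (dgl m n (signCoeff S δ) * leadCoeff m A p s' s).map f =
        W * (highL m (fun i => (A i).map f) p (m - 1) * dgb m 0 ((A m).map f) *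
          highR m (fun i => (A i).map f) p (m - 1)) * N ∧
      (dgl m n (signCoeff S δ) * constCoeff m A p s' s).map f =
        W * dgb m (m - 1) (-(A 0).map f) * N ∧
      (blockCol m ((m : ℤ) - (min s 1 : ℕ)) C).map f = W * blockCol m (m : ℤ) (C.map f) ∧
      (blockRow m ((m : ℤ) - (min s 1 : ℕ)) B).map f = blockRow m (m : ℤ) (B.map f) * N := by
  obtain ⟨W, hW⟩ := (isUnit_dgl_signCoeff (m := m) (n := n) (S := S) δ).mul
    (isUnit_commonL A (m := m) (s := s) (by omega))
  obtain ⟨N, hN⟩ := isUnit_commonR A hm hA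
  refine ⟨W.val.map f, (W⁻¹).val.map f, N.val.map f, (N⁻¹).val.map f, ?_, ?_, ?_, ?_, ?_, ?_⟩
  · rw [← Matrix.map_mul, W.inv_mul, Matrix.map_one f (map_zero f) (map_one f)]
  · rw [← Matrix.map_mul, N.mul_inv, Matrix.map_one f (map_zero f) (map_one f)]
  · rw [leadCoeff_factor A hm, ← highL_map, ← highR_map, ← dgb_map, ← Matrix.map_mul,
      ← Matrix.map_mul, ← Matrix.map_mul, ← Matrix.map_mul, hW, hN]
    simp only [mul_assoc]
  · have h : -(A 0).map f = (-A 0).map f := by ext; simp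
    rw [constCoeff_factor A, h, ← dgb_map, ← Matrix.map_mul, ← Matrix.map_mul, hW, hN]
    simp only [mul_assoc]
  · have h : (m : ℤ) - (min s 1 : ℕ) = ((m - 1 - min s 1 : ℕ) : ℤ) + 1 := by omega
    rw [← blockCol_map, ← Matrix.map_mul, hW, commonL, Matrix.mul_assoc,
      oddLow_mul_evenLow_mul_blockCol A (by omega), h, dgl_mul_blockCol, signCoeff, hδ]
    simp
  · rw [← blockRow_map, ← Matrix.map_mul, hN, commonR, blockRow_mul_coeff A hm]

/-- The reduction of the signed Fiedler pencil at finite points, over an extension ring. -/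
theorem exists_reduction_pencil_finite (hm : p + 2 * s' + 2 * s + 1 = m)
    (hA : IsUnit (A m) ∨ p = 0) (hδ : δ (m - 1 - min s 1) = 1)
    (C : Matrix (Fin n) (Fin r) S) (B : Matrix (Fin r) (Fin n) S) (f : S →+* T) (x : T) :
    ∃ U V : Matrix (Fin m × Fin n) (Fin m × Fin n) T, IsUnit U ∧ IsUnit V ∧
      U * (x • (dgl m n (signCoeff S δ) * leadCoeff m A p s' s).map f -
        (dgl m n (signCoeff S δ) * constCoeff m A p s' s).map f) * V =
        dgb m (m - 1) (∑ i ∈ Finset.range (m + 1), x ^ i • (A i).map f) ∧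
      U * (blockCol m ((m : ℤ) - (min s 1 : ℕ)) C).map f = blockCol m (m : ℤ) (C.map f) ∧
      (blockRow m ((m : ℤ) - (min s 1 : ℕ)) B).map f * V = blockRow m (m : ℤ) (B.map f) := by
  obtain ⟨U, V, hU, hV, hUV, hUL, hRV⟩ :=
    exists_reduction_finite (m := m) (by omega) (fun i => (A i).map f) p x
  obtain ⟨W, W', N, N', hW, hN, hlead, hconst, hcol, hrow⟩ :=
    exists_factorization (A := A) hm hA hδ C B f
  refine ⟨U * W', N' * V, hU.mul (IsUnit.of_mul_eq_one _ hW),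
    (IsUnit.of_mul_eq_one _ (mul_eq_one_comm.1 hN)).mul hV, ?_, ?_, ?_⟩
  · rw [← hUV, hlead, hconst]
    set M := highL m (fun i => (A i).map f) p (m - 1) * dgb m 0 ((A m).map f) *
      highR m (fun i => (A i).map f) p (m - 1)
    have h : x • (W * M * N) - W * dgb m (m - 1) (-(A 0).map f) * N =
        W * (x • M - dgb m (m - 1) (-(A 0).map f)) * N := by
      rw [mul_sub, sub_mul, mul_smul_comm, smul_mul_assoc]
    rw [h]
    calc _ = U * ((W' * W) * (x • M - dgb m (m - 1) (-(A 0).map f)) * (N * N')) * V := by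
          simp only [mul_assoc]
      _ = _ := by rw [hW, hN, one_mul, mul_one]
  · rw [hcol, Matrix.mul_assoc, ← Matrix.mul_assoc W', hW, Matrix.one_mul,
      ← blk_one_mul_blockCol (by omega), ← Matrix.mul_assoc, hUL]
  · rw [hrow, ← Matrix.mul_assoc, Matrix.mul_assoc _ N, hN, Matrix.mul_one,
      ← blockRow_mul_blk_one (by omega), Matrix.mul_assoc, hRV]

/-- The reduction of the reversed signed Fiedler pencil, over an extension ring. -/
theorem exists_reduction_pencil_infinite (hm : p + 2 * s' + 2 * s + 1 = m)
    (hA : IsUnit (A m) ∨ p = 0) (hδ : δ (m - 1 - min s 1) = 1)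
    (C : Matrix (Fin n) (Fin r) S) (B : Matrix (Fin r) (Fin n) S) (f : S →+* T) (x : T)
    (D : Matrix (Fin r) (Fin r) T) :
    ∃ U V : Matrix (Fin m × Fin n) (Fin m × Fin n) T, IsUnit U ∧ IsUnit V ∧
      U * ((dgl m n (signCoeff S δ) * leadCoeff m A p s' s).map f -
        x • (dgl m n (signCoeff S δ) * constCoeff m A p s' s).map f +
        x • ((blockCol m ((m : ℤ) - (min s 1 : ℕ)) C).map f * D *
          (blockRow m ((m : ℤ) - (min s 1 : ℕ)) B).map f)) * V =
        dgb m (m - 1) ((A m).map f +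
          ∑ i ∈ Finset.range (m - 1), x ^ (i + 1) • (A (m - (i + 1))).map f +
          x ^ m • ((A 0).map f + C.map f * D * B.map f)) := by
  obtain ⟨U, V, hU, hV, hUV⟩ := exists_reduction_infinite (m := m) (by omega)
    (fun i => (A i).map f) p x (-((A 0).map f + C.map f * D * B.map f))
  obtain ⟨W, W', N, N', hW, hN, hlead, hconst, hcol, hrow⟩ :=
    exists_factorization (A := A) hm hA hδ C B f
  refine ⟨U * W', N' * V, hU.mul (IsUnit.of_mul_eq_one _ hW),
    (IsUnit.of_mul_eq_one _ (mul_eq_one_comm.1 hN)).mul hV, ?_⟩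
  rw [smul_neg, sub_neg_eq_add] at hUV
  rw [← hUV, hlead, hconst, hcol, hrow]
  set M := highL m (fun i => (A i).map f) p (m - 1) * dgb m 0 ((A m).map f) *
    highR m (fun i => (A i).map f) p (m - 1)
  have h1 : W * blockCol m (m : ℤ) (C.map f) * D * (blockRow m (m : ℤ) (B.map f) * N) =
      W * blk m (m - 1) (m - 1) (C.map f * D * B.map f) * N := by
    rw [← blockCol_mul_mul_blockRow (by omega)]
    simp only [Matrix.mul_assoc]
  -- Once the constant factors are removed, the state term sits in the last block and merges with
  -- A_0, so the polynomial reduction applies to A_0 + C D B.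
  have h2 : dgb m (m - 1) (-((A 0).map f + C.map f * D * B.map f)) =
      dgb m (m - 1) (-(A 0).map f) - blk m (m - 1) (m - 1) (C.map f * D * B.map f) := by
    rw [dgb, dgb, neg_add, ← sub_eq_add_neg, blk_sub, add_sub_assoc]
  have h : W * M * N - x • (W * dgb m (m - 1) (-(A 0).map f) * N) +
      x • (W * blk m (m - 1) (m - 1) (C.map f * D * B.map f) * N) =
      W * (M - x • dgb m (m - 1) (-((A 0).map f + C.map f * D * B.map f))) * N := by
    rw [h2, smul_sub]
    simp only [mul_sub, sub_mul, mul_smul_comm, smul_mul_assoc]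
    abel
  rw [h1, h]
  generalize M - x • dgb m (m - 1) (-((A 0).map f + C.map f * D * B.map f)) = M'
  calc _ = U * ((W' * W) * M' * (N * N')) * V := by simp only [mul_assoc]
    _ = _ := by rw [hW, hN, one_mul, mul_one]

end PencilReduction

/-! ### The ring of proper rational functions and its units. -/

section ProperRational

open Filter Bornology Topology

/-- A denominator has finitely many zeros, so evaluation is compatible with the ring operations near
infinity, whatever its default values at poles. -/
lemma eventually_denom_ne_zero (f : RatFunc ℂ) :
    ∀ᶠ z in cobounded ℂ, f.denom.eval₂ (RingHom.id ℂ) z ≠ 0 := by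
  have h : {z : ℂ | f.denom.IsRoot z}.Finite := Polynomial.finite_setOfPred_isRoot f.denom_ne_zero
  filter_upwards [isBounded_def.1 h.isBounded] with z hz hz'
  exact hz hz'

lemma eventually_eval_add (f g : RatFunc ℂ) : ∀ᶠ z in cobounded ℂ,
    (f + g).eval (RingHom.id ℂ) z = f.eval (RingHom.id ℂ) z + g.eval (RingHom.id ℂ) z := by
  filter_upwards [eventually_denom_ne_zero f, eventually_denom_ne_zero g] with z hf hg
  exact RatFunc.eval_add _ _ hf hg

lemma eventually_eval_mul (f g : RatFunc ℂ) : ∀ᶠ z in cobounded ℂ,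
    (f * g).eval (RingHom.id ℂ) z = f.eval (RingHom.id ℂ) z * g.eval (RingHom.id ℂ) z := by
  filter_upwards [eventually_denom_ne_zero f, eventually_denom_ne_zero g] with z hf hg
  exact RatFunc.eval_mul _ _ hf hg

/-- `f(z) → a` as `z → ∞`. -/
def HasLimitAtInfinity (f : RatFunc ℂ) (a : ℂ) : Prop :=
  Tendsto (fun z : ℂ => f.eval (RingHom.id ℂ) z) (cobounded ℂ) (𝓝 a)

lemma HasLimitAtInfinity.add {f g : RatFunc ℂ} {a b : ℂ} (hf : HasLimitAtInfinity f a)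
    (hg : HasLimitAtInfinity g b) : HasLimitAtInfinity (f + g) (a + b) :=
  (Tendsto.add hf hg).congr' ((eventually_eval_add f g).mono fun _ h => h.symm)

lemma HasLimitAtInfinity.mul {f g : RatFunc ℂ} {a b : ℂ} (hf : HasLimitAtInfinity f a)
    (hg : HasLimitAtInfinity g b) : HasLimitAtInfinity (f * g) (a * b) :=
  (Tendsto.mul hf hg).congr' ((eventually_eval_mul f g).mono fun _ h => h.symm)

lemma hasLimitAtInfinity_C (a : ℂ) : HasLimitAtInfinity (RatFunc.C a) a := by
  simp only [HasLimitAtInfinity, RatFunc.eval_C, RingHom.id_apply, tendsto_const_nhds]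

lemma eventually_eval_inv {f : RatFunc ℂ} (hf : f ≠ 0) : ∀ᶠ z in cobounded ℂ,
    (f⁻¹).eval (RingHom.id ℂ) z = (f.eval (RingHom.id ℂ) z)⁻¹ := by
  filter_upwards [eventually_eval_mul f f⁻¹] with z hz
  rw [mul_inv_cancel₀ hf, RatFunc.eval_one] at hz
  exact eq_inv_of_mul_eq_one_right hz.symm

lemma HasLimitAtInfinity.inv {f : RatFunc ℂ} {a : ℂ} (hf : HasLimitAtInfinity f a) (ha : a ≠ 0) :
    HasLimitAtInfinity f⁻¹ a⁻¹ := by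
  have h0 : f ≠ 0 := by
    rintro rfl
    have h := hasLimitAtInfinity_C 0
    rw [map_zero] at h
    exact ha (tendsto_nhds_unique hf h)
  exact (Tendsto.inv₀ hf ha).congr' ((eventually_eval_inv h0).mono fun _ h => h.symm)

lemma hasLimitAtInfinity_X_inv : HasLimitAtInfinity RatFunc.X⁻¹ 0 := by
  refine tendsto_inv₀_cobounded.congr' ((eventually_eval_inv RatFunc.X_ne_zero).mono fun z h => ?_)
  simp only [h, RatFunc.eval_X]

/-- The ring of proper rational functions. -/
def properRing : Subring (RatFunc ℂ) where
  carrier := {f | ∃ a, HasLimitAtInfinity f a}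
  mul_mem' := fun ⟨a, ha⟩ ⟨b, hb⟩ => ⟨a * b, ha.mul hb⟩
  one_mem' := ⟨1, by simpa using hasLimitAtInfinity_C 1⟩
  add_mem' := fun ⟨a, ha⟩ ⟨b, hb⟩ => ⟨a + b, ha.add hb⟩
  zero_mem' := ⟨0, by simpa using hasLimitAtInfinity_C 0⟩
  neg_mem' := fun {f} ⟨a, ha⟩ => ⟨-1 * a, by
    simpa only [map_neg, map_one, neg_one_mul] using (hasLimitAtInfinity_C (-1)).mul ha⟩

/-- The value of a proper rational function at infinity. -/
def valueAtInfinity (f : properRing) : ℂ := f.2.choose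

lemma hasLimitAtInfinity_value (f : properRing) : HasLimitAtInfinity f (valueAtInfinity f) :=
  f.2.choose_spec

lemma valueAtInfinity_eq {f : properRing} {a : ℂ} (h : HasLimitAtInfinity f a) :
    valueAtInfinity f = a := tendsto_nhds_unique (hasLimitAtInfinity_value f) h

/-- The value at infinity as a ring homomorphism. -/
def evalAtInfinity : properRing →+* ℂ where
  toFun := valueAtInfinity
  map_one' := valueAtInfinity_eq (by simpa using hasLimitAtInfinity_C 1)
  map_mul' f g := valueAtInfinity_eq
    ((hasLimitAtInfinity_value f).mul (hasLimitAtInfinity_value g))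
  map_zero' := valueAtInfinity_eq (by simpa using hasLimitAtInfinity_C 0)
  map_add' f g := valueAtInfinity_eq
    ((hasLimitAtInfinity_value f).add (hasLimitAtInfinity_value g))

/-- The constants as proper rational functions. -/
def properC : ℂ →+* properRing where
  toFun a := ⟨RatFunc.C a, a, hasLimitAtInfinity_C a⟩
  map_one' := Subtype.ext (map_one _)
  map_mul' a b := Subtype.ext (map_mul _ a b)
  map_zero' := Subtype.ext (map_zero _)
  map_add' a b := Subtype.ext (map_add _ a b)

/-- The proper rational function `1 / x`. -/
def properXInv : properRing := ⟨RatFunc.X⁻¹, 0, hasLimitAtInfinity_X_inv⟩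

lemma evalAtInfinity_properC (a : ℂ) : evalAtInfinity (properC a) = a :=
  valueAtInfinity_eq (hasLimitAtInfinity_C a)

lemma evalAtInfinity_properXInv : evalAtInfinity properXInv = 0 :=
  valueAtInfinity_eq hasLimitAtInfinity_X_inv

lemma isUnit_of_evalAtInfinity_ne_zero {f : properRing} (h : evalAtInfinity f ≠ 0) :
    IsUnit f := by
  have hf := hasLimitAtInfinity_value f
  refine IsUnit.of_mul_eq_one ⟨(f : RatFunc ℂ)⁻¹, _, hf.inv h⟩ (Subtype.ext ?_)
  refine mul_inv_cancel₀ fun h0 => h ?_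
  have : f = 0 := Subtype.ext h0
  rw [this, map_zero]

/-- The value at infinity is a ring homomorphism, so it sends invertible matrices to nonsingular
ones. -/
lemma isBiproper_of_isUnit {ι : Type*} [Fintype ι] [DecidableEq ι] {U : Matrix ι ι properRing}
    (hU : IsUnit U) : IsBiproper (U.map properRing.subtype) := by
  refine ⟨U.map evalAtInfinity, ?_, fun i j => hasLimitAtInfinity_value (U i j)⟩
  rw [← RingHom.mapMatrix_apply, ← RingHom.map_det]
  exact ((isUnit_iff_isUnit_det U).1 hU).map evalAtInfinity

lemma isUnimodular_of_isUnit {ι : Type*} [Fintype ι] [DecidableEq ι] {U : Matrix ι ι ℂ[X]}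
    (hU : IsUnit U) : IsUnimodular U := by
  obtain ⟨c, hc, h⟩ := Polynomial.isUnit_iff.1 ((isUnit_iff_isUnit_det U).1 hU)
  exact ⟨c, hc.ne_zero, h.symm⟩

/-- The resolvent `(x E - A)⁻¹` is `1 / x` times a proper rational matrix. -/
lemma exists_resolvent {r : ℕ} {E : Matrix (Fin r) (Fin r) ℂ} (hE : IsUnit E.det)
    (A : Matrix (Fin r) (Fin r) ℂ) : ∃ W : Matrix (Fin r) (Fin r) properRing,
      ((RatFunc.X : RatFunc ℂ) • E.map RatFunc.C - A.map RatFunc.C)⁻¹ =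
        W.map properRing.subtype := by
  have hX : (RatFunc.X : RatFunc ℂ) * RatFunc.X⁻¹ = 1 := mul_inv_cancel₀ RatFunc.X_ne_zero
  set M : Matrix (Fin r) (Fin r) properRing := E.map properC - properXInv • A.map properC with hM
  have hdet : IsUnit M := by
    rw [isUnit_iff_isUnit_det]
    refine isUnit_of_evalAtInfinity_ne_zero ?_
    have : M.map evalAtInfinity = E := by
      ext i j
      simp [hM, evalAtInfinity_properC, evalAtInfinity_properXInv]
    rw [RingHom.map_det, RingHom.mapMatrix_apply, this]
    exact hE.ne_zero
  obtain ⟨u, hu⟩ := hdet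
  refine ⟨properXInv • (u⁻¹).val, Matrix.inv_eq_right_inv ?_⟩
  -- Here xE - A = x(E - x⁻¹A), and E - x⁻¹A has the nonsingular value E at infinity.
  have h1 : (RatFunc.X : RatFunc ℂ) • E.map RatFunc.C - A.map RatFunc.C =
      (RatFunc.X : RatFunc ℂ) • M.map properRing.subtype := by
    ext i j
    simp only [hM, Matrix.sub_apply, Matrix.smul_apply, map_apply, smul_eq_mul, map_sub, map_mul]
    change _ = RatFunc.X * (RatFunc.C (E i j) - RatFunc.X⁻¹ * RatFunc.C (A i j))
    rw [mul_sub, ← mul_assoc, hX, one_mul]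
  have h2 : (properXInv • (u⁻¹).val).map properRing.subtype =
      (RatFunc.X : RatFunc ℂ)⁻¹ • (u⁻¹).val.map properRing.subtype := by
    ext i j
    rfl
  rw [h1, h2, Matrix.smul_mul, Matrix.mul_smul, smul_smul, hX, one_smul, ← Matrix.map_mul, ← hu,
    u.mul_inv, Matrix.map_one _ (map_zero _) (map_one _)]

end ProperRational

/-! ### The Rosenbrock strong linearization. -/

section Linearization

variable {m n r p s s' : ℕ}

lemma sum_X_pow_smul_coeffMat {ι : Type*} {P : Matrix ι ι ℂ[X]} (hP : ∀ i j, (P i j).natDegree ≤ m) :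
    ∑ t ∈ Finset.range (m + 1), (Polynomial.X : ℂ[X]) ^ t • (coeffMat P t).map Polynomial.C = P := by
  ext1 i j
  rw [Matrix.sum_apply]
  conv_rhs => rw [(P i j).as_sum_range' (m + 1) (by have := hP i j; omega)]
  refine Finset.sum_congr rfl fun t _ => ?_
  rw [Matrix.smul_apply, map_apply, coeffMat, map_apply, smul_eq_mul, mul_comm,
    Polynomial.C_mul_X_pow_eq_monomial]

/-- The reversal at infinity of a matrix polynomial of degree at most `m`. -/
lemma inv_X_pow_smul_map {P : Matrix (Fin n) (Fin n) ℂ[X]} (hm : 0 < m)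
    (hP : ∀ i j, (P i j).natDegree ≤ m) :
    ((RatFunc.X : RatFunc ℂ) ^ m)⁻¹ • P.map (algebraMap ℂ[X] (RatFunc ℂ)) =
      ((coeffMat P m).map properC +
          ∑ i ∈ Finset.range (m - 1), properXInv ^ (i + 1) • (coeffMat P (m - (i + 1))).map properC +
          properXInv ^ m • (coeffMat P 0).map properC).map properRing.subtype := by
  obtain ⟨k, rfl⟩ : ∃ k, m = k + 1 := ⟨m - 1, by omega⟩
  have hX : (RatFunc.X : RatFunc ℂ) ≠ 0 := RatFunc.X_ne_zero
  have h0 : P.map (algebraMap ℂ[X] (RatFunc ℂ)) = ∑ t ∈ Finset.range (k + 1 + 1),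
      (RatFunc.X : RatFunc ℂ) ^ t • (coeffMat P t).map RatFunc.C := by
    conv_lhs => rw [← sum_X_pow_smul_coeffMat hP]
    ext i j
    simp [Matrix.sum_apply]
    exact Finset.sum_congr rfl fun _ _ => mul_comm _ _
  have h1 : ((coeffMat P (k + 1)).map properC +
      ∑ i ∈ Finset.range (k + 1 - 1),
        properXInv ^ (i + 1) • (coeffMat P (k + 1 - (i + 1))).map properC +
          properXInv ^ (k + 1) • (coeffMat P 0).map properC) =
      ∑ t ∈ Finset.range (k + 1 + 1), properXInv ^ t • (coeffMat P (k + 1 - t)).map properC := by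
    rw [Finset.sum_range_succ, Finset.sum_range_succ']
    simp only [pow_zero, one_smul, Nat.sub_zero, Nat.sub_self, Nat.add_sub_cancel]
    abel
  rw [h1, h0, Finset.smul_sum, ← Finset.sum_range_reflect]
  ext1 i j
  rw [map_apply, Matrix.sum_apply, Matrix.sum_apply, map_sum]
  refine Finset.sum_congr rfl fun t ht => ?_
  have ht' : t ≤ k + 1 := by have := Finset.mem_range.1 ht; omega
  rw [Matrix.smul_apply, Matrix.smul_apply, Matrix.smul_apply, smul_eq_mul, smul_eq_mul, smul_eq_mul,
    map_mul, map_pow]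
  change _ = (RatFunc.X⁻¹ : RatFunc ℂ) ^ t * RatFunc.C (coeffMat P (k + 1 - t) i j)
  rw [← mul_assoc, show k + 1 + 1 - 1 - t = k + 1 - t by omega, map_apply]
  congr 1
  rw [inv_pow, inv_mul_eq_iff_eq_mul₀ (pow_ne_zero _ hX), eq_mul_inv_iff_mul_eq₀ (pow_ne_zero _ hX),
    ← pow_add, Nat.sub_add_cancel ht']

lemma map_properC {ι κ : Type*} (M : Matrix ι κ ℂ) :
    (M.map properC).map properRing.subtype = M.map RatFunc.C := rfl

/-- One elimination serves twice, over ℂ[x] at x and over the proper rational functions at 1/x. The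
sign at block m - α is taken to be 1 so that the block column loses its sign. -/
theorem isRosenbrockStrongLinearization_liftRealization {R : Realization (Fin n) r}
    (hdeg : HasDegree R.P m) (hmin : R.IsMinimal) (hC : R.C = R.Bᵀ)
    (hm : p + 2 * s' + 2 * s + 1 = m) (hA : IsUnit (coeffMat R.P m) ∨ p = 0) {δ : ℕ → ℤˣ}
    (hδ : δ (m - 1 - min s 1) = 1) :
    IsRosenbrockStrongLinearization m R (liftRealization m R ((m : ℤ) - (min s 1 : ℕ))
      (pencil (dgl m n (signCoeff ℂ δ) * leadCoeff m (coeffMat R.P) p s' s)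
        (dgl m n (signCoeff ℂ δ) * constCoeff m (coeffMat R.P) p s' s))).systemMatrix := by
  set Y := dgl m n (signCoeff ℂ δ) * leadCoeff m (coeffMat R.P) p s' s with hY
  set Y₀ := dgl m n (signCoeff ℂ δ) * constCoeff m (coeffMat R.P) p s' s with hY₀
  refine ⟨_, rfl, ⟨-Y₀, -Y, ?_⟩, ?_, ?_, ?_⟩
  · rw [pencil_neg_neg, neg_neg]
    rfl
  · exact isMinimal_liftRealization hmin hC ⟨m - 1 - min s 1, by omega⟩ (by push_cast; omega) _
  · obtain ⟨U, V, hU, hV, hUV, hcol, hrow⟩ := exists_reduction_pencil_finite (A := coeffMat R.P) hm hA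
      hδ R.C R.B Polynomial.C Polynomial.X
    rw [sum_X_pow_smul_coeffMat hdeg.1] at hUV
    refine ⟨U, V, 1, 1, isUnimodular_of_isUnit hU, isUnimodular_of_isUnit hV, by simp, by simp, ?_⟩
    rw [Matrix.map_one _ Polynomial.C_0 Polynomial.C_1, Realization.systemMatrix, padSystem,
      fromBlocks_multiply, fromBlocks_multiply]
    simp only [Matrix.mul_zero, Matrix.zero_mul, add_zero, zero_add, Matrix.mul_one, Matrix.one_mul,
      liftRealization, padIdentity_eq_dgb, ← hC, hcol, hrow]
    congr 1
  · obtain ⟨W, hW⟩ := exists_resolvent R.isUnit_det_E R.A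
    obtain ⟨U, V, hU, hV, hUV⟩ := exists_reduction_pencil_infinite (A := coeffMat R.P) hm hA
      hδ R.C R.B properC properXInv W
    refine ⟨_, _, isBiproper_of_isUnit hU, isBiproper_of_isUnit hV, ?_⟩
    have hX : (RatFunc.X : RatFunc ℂ)⁻¹ * RatFunc.X = 1 := inv_mul_cancel₀ RatFunc.X_ne_zero
    -- The transfer function divided by x has entries in the ring of proper rational functions,
    -- where it becomes the reversed pencil plus its state term.
    have h1 : (RatFunc.X : RatFunc ℂ)⁻¹ • (liftRealization m R ((m : ℤ) - (min s 1 : ℕ))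
        (pencil Y Y₀)).transfer = (Y.map properC - properXInv • Y₀.map properC +
        properXInv • ((blockCol m ((m : ℤ) - (min s 1 : ℕ)) R.C).map properC * W *
          (blockRow m ((m : ℤ) - (min s 1 : ℕ)) R.B).map properC)).map properRing.subtype := by
      rw [Matrix.map_add _ (map_add _), Matrix.map_sub _ (map_sub _), Realization.transfer, smul_add]
      congr 1
      · ext i j
        simp only [liftRealization, pencil, Matrix.smul_apply, Matrix.sub_apply, map_apply, map_sub,
          smul_eq_mul, map_mul, RatFunc.algebraMap_X, RatFunc.algebraMap_C, mul_sub, ← mul_assoc, hX,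
          one_mul]
        rfl
      · have h2 : ∀ M : Matrix (Fin m × Fin n) (Fin m × Fin n) properRing,
            (properXInv • M).map properRing.subtype =
              (RatFunc.X : RatFunc ℂ)⁻¹ • M.map properRing.subtype := fun M => rfl
        rw [h2, Matrix.map_mul, Matrix.map_mul, map_properC, map_properC, ← hW, hC]
        rfl
    rw [h1, ← Matrix.map_mul, ← Matrix.map_mul, hUV, dgb_map, padIdentity_eq_dgb]
    congr 1
    have h3 : properXInv ^ m • ((coeffMat R.P 0).map properC + R.C.map properC * W * R.B.map properC) =
        properXInv ^ m • (coeffMat R.P 0).map properC +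
          properXInv ^ m • (R.C.map properC * W * R.B.map properC) := smul_add _ _ _
    rw [h3, ← add_assoc, Matrix.map_add _ (map_add _), ← inv_X_pow_smul_map (by omega) hdeg.1,
      Realization.transfer, smul_add]
    congr 1
    have h2 : ∀ M : Matrix (Fin n) (Fin n) properRing,
        (properXInv ^ m • M).map properRing.subtype =
          ((RatFunc.X : RatFunc ℂ) ^ m)⁻¹ • M.map properRing.subtype := fun M => by
      rw [← inv_pow]
      ext i j
      rw [map_apply, Matrix.smul_apply, smul_eq_mul, map_mul, map_pow]
      rfl
    rw [h2, Matrix.map_mul, Matrix.map_mul, map_properC, map_properC, ← hW]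

end Linearization

/-! ### Uniqueness of the signs up to a common factor. -/

section SignUniqueness

variable {m n r p s s' : ℕ}

lemma smul_quasiIdentity (u : ℤˣ) (δ : Fin m → ℤˣ) :
    ((u : ℤ) : ℂ[X]) • quasiIdentity n δ = quasiIdentity n (fun i => u * δ i) := by
  ext p q
  simp only [quasiIdentity, Matrix.smul_apply, diagonal_apply, smul_eq_mul, mul_ite, mul_zero,
    Units.val_mul, Int.cast_mul]

lemma quasiIdentity_restrict (η : ℕ → ℤˣ) :
    quasiIdentity n (fun i : Fin m => η i) = (dgl m n (signCoeff ℂ η)).map Polynomial.C := by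
  rw [quasiIdentity_eq]
  congr 1
  exact dgl_signCoeff_congr fun i hi => by rw [extendSign, dif_pos hi]

lemma quasiIdentity_mul_blockCol (δ : Fin m → ℤˣ) (k : Fin m) (C : Matrix (Fin n) (Fin r) ℂ) :
    quasiIdentity n δ * (blockCol m (((k : ℕ) : ℤ) + 1) C).map Polynomial.C =
      (((δ k : ℤ) : ℂ) • blockCol m (((k : ℕ) : ℤ) + 1) C).map Polynomial.C := by
  rw [quasiIdentity_eq, ← Matrix.map_mul, dgl_mul_blockCol, signCoeff, extendSign, dif_pos k.2]

/-- Two sign matrices that make a Fiedler pencil T-even agree up to a common sign. -/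
theorem exists_eq_mul_of_isTEven [NeZero n] {A : ℕ → Matrix (Fin n) (Fin n) ℂ}
    (hm : p + 2 * s' + 2 * s + 1 = m) (hA : A m ≠ 0) {δ ε : Fin m → ℤˣ}
    (hδ : IsTEven (quasiIdentity n δ * pencil (leadCoeff m A p s' s) (constCoeff m A p s' s)))
    (hε : IsTEven (quasiIdentity n ε * pencil (leadCoeff m A p s' s) (constCoeff m A p s' s))) :
    ∃ c : ℤˣ, ∀ i, δ i = c * ε i := by
  rw [isTEven_quasiIdentity_mul_iff] at hδ hε
  have h1 := commute_of_sign_symmetric (σ := (-1 : ℂ)) (by norm_num)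
    (by rw [hδ.1, neg_one_smul]) (by rw [hε.1, neg_one_smul])
  have h2 := commute_of_sign_symmetric (σ := (1 : ℂ)) (by norm_num)
    (by rw [hδ.2, one_smul]) (by rw [hε.2, one_smul])
  refine ⟨extendSign ε 0 * extendSign δ 0, fun i => ?_⟩
  have h := dgl_eq_of_commute_coeffs hm hA h1 h2 i.2
  simp only [signCoeff, ← Int.cast_mul, ← Units.val_mul] at h
  have h' := Units.ext (Int.cast_injective h)
  rw [← h', extendSign, extendSign, dif_pos i.2, dif_pos i.2, mul_right_comm,
    Int.units_mul_self, one_mul]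

end SignUniqueness

end

/-! ### The main theorem. -/

theorem theorem4p14 (n m r h : ℕ) (hh : Even h) (hhm : h < m)
    (G : Matrix (Fin n) (Fin n) (RatFunc ℂ)) (hG : IsTEvenRat G)
    (R : Realization (Fin n) r) (hRG : R.transfer = G)
    (hRdeg : HasDegree R.P m) (hRmin : R.IsMinimal) (hReven : R.IsTEvenRealization)
    (w z cw cz : List ℤ) (q p : ℕ)
    (hw : IsAdmissible h q w) (hsimple : q = 0 ∨ q = 1)
    (hz : IsAdmissible (m - h - 1) p (z.map fun t => t + (m : ℤ)))
    (hcw : cw = symmetricComplement h q)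
    (hcz : (cz.map fun t => t + (m : ℤ)) = symmetricComplement (m - h - 1) p) :
    ∃ k : Fin m, ((k : ℕ) : ℤ) + 1 = (m : ℤ) - inversionsAt 0 w ∧
    ∃ ε : Fin m → ℤˣ,
      let L := pencilP m R.P z w cw cz
      let LL := pencilS m R z w cw cz
      -- `s Q`, where `Q` has the parameters `δ` and `s` is its parameter number `m - i₀(w)`
      let sQ := fun δ : Fin m → ℤˣ => ((δ k : ℤ) : ℂ[X]) • quasiIdentity n δ
      let QQ := quasiIdentityExt r (sQ ε)
      let R' := liftRealization m R ((m : ℤ) - inversionsAt 0 w) (sQ ε * L)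
      -- `Q L` is T-even, and `Q` is unique with this property up to multiplication by `-1`
      (IsTEven (quasiIdentity n ε * L) ∧
        ∀ δ : Fin m → ℤˣ, IsTEven (quasiIdentity n δ * L) →
          quasiIdentity n δ = quasiIdentity n ε ∨ quasiIdentity n δ = -quasiIdentity n ε) ∧
      -- `diag(s Q, I_r)` makes the pencil T-even, with the displayed block form
      (QQ * LL = R'.systemMatrix ∧ IsTEven (QQ * LL)) ∧
      -- it is the only matrix of this form that does
      (∀ δ : Fin m → ℤˣ,
        IsTEven (quasiIdentityExt r (sQ δ) * LL) → quasiIdentityExt r (sQ δ) = QQ) ∧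
      (0 < r → ∀ δ : Fin m → ℤˣ,
        IsTEven (quasiIdentityExt r (quasiIdentity n δ) * LL) →
          quasiIdentityExt r (quasiIdentity n δ) = QQ) ∧
      ((¬ IsUnit (coeffMat R.P m).det → p = 0) → IsRosenbrockStrongLinearization m R (QQ * LL)) ∧
      IsTEvenRat R'.transfer := by
  obtain ⟨s, hs⟩ := hh
  obtain rfl : h = 2 * s := by omega
  -- Index 1 is excluded by parity: both h and h - q are even.
  obtain rfl : q = 0 := by
    rcases hsimple with hq | rfl
    · exact hq
    · obtain ⟨h1, ⟨t, ht⟩, -⟩ := hw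
      omega
  obtain ⟨s', hs'⟩ := hz.2.1
  have hp := hz.1
  have hm : p + 2 * s' + 2 * s + 1 = m := by omega
  have hH : m - 2 * s - 1 = p + 2 * s' := by omega
  rw [hH] at hz hcz
  -- A nonzero leading coefficient rules out n = 0, where all sign matrices would coincide.
  have hn : NeZero n := ⟨by rintro rfl; exact hRdeg.2 (Subsingleton.elim _ _)⟩
  obtain ⟨hC, hP, hE⟩ := hReven
  subst hcw
  rw [inversionsAt_zero_admissible hw]
  set L := pencilP m R.P z w (symmetricComplement (2 * s) 0) cz with hL
  rw [pencilP_eq R.P hm hw hz hcz] at hL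
  obtain ⟨k, hk⟩ : ∃ k : Fin m, ((k : ℕ) : ℤ) + 1 = (m : ℤ) - (min s 1 : ℕ) :=
    ⟨⟨m - 1 - min s 1, by omega⟩, by simp only; omega⟩
  have hkk : m - 1 - min s 1 = k := by omega
  set η := evenSign p (p + 2 * s') with hη
  refine ⟨k, hk, fun i => η i, ?_⟩
  simp only [smul_quasiIdentity]
  set LL := pencilS m R z w (symmetricComplement (2 * s) 0) cz with hLLdef
  set Q := quasiIdentity n (fun i : Fin m => η k * η i) with hQ
  have hQL : IsTEven (quasiIdentity n (fun i : Fin m => η i) * L) := by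
    rw [quasiIdentity_restrict, hL, map_C_mul_pencil, isTEven_pencil_iff]
    exact ⟨leadCoeff_skew hm hP.coeffMat_transpose, constCoeff_symmetric hm hP.coeffMat_transpose⟩
  have huniq : ∀ δ : Fin m → ℤˣ, IsTEven (quasiIdentity n δ * L) → ∃ c : ℤˣ, ∀ i : Fin m,
      δ i = c * η i := fun δ hδ => by
    rw [hL] at hδ hQL
    exact exists_eq_mul_of_isTEven hm hRdeg.2 hδ hQL
  -- The signs act on rows, so δ k appears at the block column and not at the block row; T-evenness
  -- with a nonzero B will force δ k = 1.
  have hLL : ∀ δ : Fin m → ℤˣ, quasiIdentityExt r (quasiIdentity n δ) * LL =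
      fromBlocks (quasiIdentity n δ * L)
        ((((δ k : ℤ) : ℂ) • blockCol m (((k : ℕ) : ℤ) + 1) R.C).map Polynomial.C)
        ((blockRow m (((k : ℕ) : ℤ) + 1) R.B).map Polynomial.C) (-pencil R.E R.A) := fun δ => by
    rw [quasiIdentityExt, hLLdef, pencilS_eq R hm hw hz hcz, fromBlocks_multiply, ← hk,
      quasiIdentity_mul_blockCol]
    simp only [Matrix.zero_mul, add_zero, zero_add, Matrix.one_mul]
    rfl
  have hform : quasiIdentityExt r Q * LL =
      (liftRealization m R ((m : ℤ) - (min s 1 : ℕ)) (Q * L)).systemMatrix := by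
    rw [hLL, Int.units_mul_self, Realization.systemMatrix]
    simp only [Units.val_one, Int.cast_one, one_smul, liftRealization, hk, hC, hQ]
  have heven : IsTEven (Q * L) := by
    rw [hQ, ← smul_quasiIdentity, Matrix.smul_mul]
    exact hQL.units_smul _
  have hext : ∀ δ : Fin m → ℤˣ,
      IsTEven (quasiIdentityExt r (quasiIdentity n fun i => δ k * δ i) * LL) →
      quasiIdentityExt r (quasiIdentity n fun i => δ k * δ i) = quasiIdentityExt r Q :=
    fun δ hδ => by
      rw [hLL, isTEven_fromBlocks_iff] at hδ
      obtain ⟨c, hc⟩ := huniq _ hδ.1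
      -- At the index k the normalized sign is δ k * δ k = 1, which determines the common factor.
      have hck : c = η k := by
        have := hc k
        rw [Int.units_mul_self] at this
        rw [← mul_one c, ← Int.units_mul_self (η k), ← mul_assoc, ← this, one_mul]
      congr 2
      ext1 i
      rw [hc, hck]
  refine ⟨⟨hQL, fun δ hδ => ?_⟩, ⟨hform, ?_⟩, hext, fun hr δ hδ => ?_, fun hA => ?_,
    Realization.IsTEvenRealization.transfer ⟨rfl, heven, hE⟩⟩
  · obtain ⟨c, hc⟩ := huniq δ hδ
    obtain rfl := funext hc
    rw [← smul_quasiIdentity]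
    rcases Int.units_eq_one_or c with rfl | rfl
    · left; simp
    · right; simp
  · rw [hform]
    exact isTEven_fromBlocks_iff.2 ⟨heven, rfl, hE.neg⟩
  · have h1 := hδ
    rw [hLL, isTEven_fromBlocks_iff] at h1
    -- Otherwise Bᵀ = -Bᵀ, so B = 0, which contradicts minimality when r > 0.
    have hδk : δ k = 1 := by
      refine (Int.units_eq_one_or (δ k)).resolve_right fun h2 => hRmin.B_ne_zero hr ?_
      have h3 := h1.2.1
      rw [h2, blockRow_eq_transpose, transpose_transpose, hC] at h3
      ext i j
      have h4 := congrFun (congrFun h3 (k, j)) i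
      simp only [Matrix.smul_apply, blockCol, of_apply, if_true, transpose_apply,
        smul_eq_mul] at h4
      push_cast at h4
      rw [Matrix.zero_apply]
      linear_combination (-1 / 2 : ℂ) * h4
    have h2 := hext δ
    simp only [hδk, one_mul] at h2
    exact h2 hδ
  · have hA' : IsUnit (coeffMat R.P m) ∨ p = 0 := by
      rw [isUnit_iff_isUnit_det]
      exact or_iff_not_imp_left.2 hA
    have h1 := isRosenbrockStrongLinearization_liftRealization hRdeg hRmin hC hm hA'
      (δ := fun i => η k * η i) (by simp only [hkk, Int.units_mul_self])
    rwa [← map_C_mul_pencil, ← hL, ← quasiIdentity_restrict (fun i => η k * η i), ← hform] at h1
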